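/- Lie groups and manifolds are smooth, real, without boundary and modelled on Banach spaces (for instance finite dimensional); forms and maps are smooth. Let $1\to\mathbb{T}\to\widehat\Gamma\xrightarrow{q}\Gamma\to 1$ be a central extension of Lie groups by the unit circle $\mathbb{T}$, such that $q$ is a principal $\mathbb{T}$-bundle. It induces the exact sequence $0\to i\mathbb{R}\to\mathrm{Lie}\,\widehat\Gamma\xrightarrow{q_*}\mathrm{Lie}\,\Gamma\to0$, and $i\mathbb{R}$ is identified with its image in $\mathrm{Lie}\,\widehat\Gamma$. For $\gamma\in\Gamma$ let $\mathrm{Ad}_\gamma$ act on $\mathrm{Lie}\,\widehat\Gamma$ as $\mathrm{Ad}_{\widehat\gamma}$ for any $\widehat\gamma$ with $q(\widehat\gamma)=\gamma$. Let $\sigma:\mathrm{Lie}\,\Gamma\to\mathrm{Lie}\,\widehat\Gamma$ be a (continuous) linear map with $q_*\sigma=\mathrm{id}$, and put $$Z_\sigma(\gamma,Y)=\mathrm{Ad}_\gamma\sigma(Y)-\sigma(\mathrm{Ad}_\gamma Y)\in i\mathbb{R},\qquad \omega_\sigma(Y,Z)=[\sigma(Y),\sigma(Z)]-\sigma([Y,Z])\in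 i\mathbb{R}.$$ Let $\pi:B\to X$ be a principal $\Gamma$-bundle with a connection $\theta\in\Omega^1(B;\mathrm{Lie}\,\Gamma)$, let $F_\theta=d\theta+\frac12[\theta,\theta]$, and let $L:B\times_{\mathrm{Ad}}\mathrm{Lie}\,\widehat\Gamma\to B\times_{\mathrm{Ad}}i\mathbb{R}\cong X\times i\mathbb{R}$ be a splitting, that is, a vector bundle map which is the identity on $B\times_{\mathrm{Ad}}i\mathbb{R}$. Let $l_\sigma:B\times\mathrm{Lie}\,\Gamma\to i\mathbb{R}$, $l_\sigma(b,Y)=L([b,\sigma(Y)])$, be the reduced splitting induced from $L$, and put $$\kappa_{\theta,\sigma}(b;V,W)=l_\sigma(b,F_\theta(b;V,W)).$$ Let $B^{[2]}=\{(b_1,b_2)\in B\times B:\pi(b_1)=\pi(b_2)\}$ with projections $\pi_1,\pi_2$ to $B$, let $\zeta:B^{[2]}\to\Gamma$ be defined by $b_1\zeta(b_1,b_2)=b_2$, and let $\rho:J_B=\zeta^*\widehat\Gamma\to B^{[2]}$ be the $\mathbb{T}$-bundle of the lifting bundle gerbe, with the product induced by the multiplication of $\widehat\Gamma$. Let $\mu,\widehat\mu$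 be the left invariant Maurer-Cartan forms of $\Gamma,\widehat\Gamma$, let $\nu_\sigma=\widehat\mu-\sigma(q^*\mu)$, and let $$\nabla_{\theta,\sigma}=\zeta^*\nu_\sigma+\rho^*Z_\sigma(\zeta^{-1},\pi_1^*\theta),$$ where $\zeta^*\nu_\sigma$ is the pull-back along the bundle map $J_B\to\widehat\Gamma$ covering $\zeta$. Theorem. $\kappa_{\theta,\sigma}$ is a smooth $i\mathbb{R}$-valued $2$-form on $B$, and the curvature of $\nabla_{\theta,\sigma}$ (the $2$-form on $B^{[2]}$ whose pull-back under $\rho$ is $d\nabla_{\theta,\sigma}$) is $$F_{\nabla_{\theta,\sigma}}=\pi_1^*\Big(\tfrac12\omega_\sigma(\theta,\theta)+\kappa_{\theta,\sigma}\Big)-\pi_2^*\Big(\tfrac12\omega_\sigma(\theta,\theta)+\kappa_{\theta,\sigma}\Big).$$ Hence $f_{\theta,\sigma}=-\tfrac12\omega_\sigma(\theta,\theta)-\kappa_{\theta,\sigma}$ is a curving for $\nabla_{\theta,\sigma}$. That is, $\nabla_{\theta,\sigma}$ is a bundle gerbe connection on $J_B$ (a connection on the $\mathbb{T}$-bundle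 $J_B$ compatible with the product), $f_{\theta,\sigma}$ is a smooth $i\mathbb{R}$-valued $2$-form on $B$, and $F_{\nabla_{\theta,\sigma}}=-\pi_1^*f_{\theta,\sigma}+\pi_2^*f_{\theta,\sigma}$. -/

import Mathlib

open scoped Manifold ContDiff Topology

noncomputable section

/-! ### Differential forms on manifolds without boundary -/

section Forms

variable {E H : Type*} [NormedAddCommGroup E] [NormedSpace ℝ E] [TopologicalSpace H]
  (I : ModelWithCorners ℝ E H)
  {E' H' : Type*} [NormedAddCommGroup E'] [NormedSpace ℝ E'] [TopologicalSpace H']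
  (I' : ModelWithCorners ℝ E' H')
  {M : Type*} [TopologicalSpace M] [ChartedSpace H M]
  {M' : Type*} [TopologicalSpace M'] [ChartedSpace H' M']
  {F : Type*} [NormedAddCommGroup F] [NormedSpace ℝ F]
  {F' : Type*} [NormedAddCommGroup F'] [NormedSpace ℝ F']
  {F'' : Type*} [NormedAddCommGroup F''] [NormedSpace ℝ F'']

/-- Differential `n`-forms on `M` with values in `F`, not necessarily smooth. -/
abbrev DForm (M : Type*) [TopologicalSpace M] [ChartedSpace H M]
    (F : Type*) [NormedAddCommGroup F] [NormedSpace ℝ F] (n : ℕ) : Type _ :=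
  ∀ x : M, TangentSpace I x [⋀^Fin n]→L[ℝ] F

namespace DForm

variable {I I'}

/-- A family of continuous linear functionals regarded as a `1`-form. -/
def ofCLM (α : ∀ x : M, TangentSpace I x →L[ℝ] F) : DForm I M F 1 :=
  fun x => ContinuousAlternatingMap.ofSubsingleton ℝ (TangentSpace I x) F (0 : Fin 1) (α x)

/-- Composition of a form with a continuous linear map of the coefficients. -/
def mapVal {n : ℕ} (T : F →L[ℝ] F') (η : DForm I M F n) : DForm I M F' n :=
  fun x => T.compContinuousAlternatingMap (η x)

variable (I I') in
/-- The pull-back `f^* η`. -/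
def pullback {n : ℕ} (f : M → M') (η : DForm I' M' F n) : DForm I M F n :=
  fun x => (η (f x)).compContinuousLinearMap (mfderiv I I' f x)

/-- The coordinate expression of a form in the preferred chart at `x`. -/
def inChart {n : ℕ} (η : DForm I M F n) (x : M) : E → E [⋀^Fin n]→L[ℝ] F :=
  fun y => (η ((extChartAt I x).symm y)).compContinuousLinearMap
    (mfderiv 𝓘(ℝ, E) I (extChartAt I x).symm y)

/-- Smoothness, tested in the charts. -/
def Smooth {n : ℕ} (η : DForm I M F n) : Prop :=
  ∀ x : M, ContDiffOn ℝ ∞ (η.inChart x) (extChartAt I x).target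

/-- The exterior derivative, computed in the preferred chart at each point;
`(dα)(V, W) = V α(W) - W α(V) - α([V, W])` on `1`-forms. -/
def d {n : ℕ} (η : DForm I M F n) : DForm I M F (n + 1) :=
  fun x => (extDeriv (η.inChart x) (extChartAt I x x)).compContinuousLinearMap
    (mfderiv I 𝓘(ℝ, E) (extChartAt I x) x)

/-- A `1`-form at a point as a continuous linear functional. -/
def toCLM (α : DForm I M F 1) (x : M) : TangentSpace I x →L[ℝ] F :=
  (ContinuousAlternatingMap.ofSubsingleton ℝ (TangentSpace I x) F (0 : Fin 1)).symm (α x)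

theorem toCLM_apply (α : DForm I M F 1) (x : M) (v : TangentSpace I x) :
    α.toCLM x v = α x (fun _ => v) := rfl

/-- `β(α, α')`, that is, `(V, W) ↦ β(α(V), α'(W)) - β(α(W), α'(V))`. -/
def wedge (β : F →L[ℝ] F' →L[ℝ] F'') (α : DForm I M F 1) (α' : DForm I M F' 1) :
    DForm I M F'' 2 := fun x =>
  { toFun := fun v => β (α.toCLM x (v 0)) (α'.toCLM x (v 1))
      - β (α.toCLM x (v 1)) (α'.toCLM x (v 0))
    map_update_add' := by
      intro _ v i a b
      fin_cases i <;> simp [Function.update] <;> abel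
    map_update_smul' := by
      intro _ v i r a
      fin_cases i <;> simp [Function.update, smul_sub]
    cont := by
      have h0 : Continuous fun v : Fin 2 → TangentSpace I x => v 0 := continuous_apply 0
      have h1 : Continuous fun v : Fin 2 → TangentSpace I x => v 1 := continuous_apply 1
      have e0 := (α.toCLM x).continuous.comp h0
      have e1 := (α.toCLM x).continuous.comp h1
      have f0 := (α'.toCLM x).continuous.comp h0
      have f1 := (α'.toCLM x).continuous.comp h1
      exact ((β.continuous.comp e0).clm_apply f1).sub ((β.continuous.comp e1).clm_apply f0)
    map_eq_zero_of_eq' := by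
      intro v i j hv hij
      have h : v 0 = v 1 := by fin_cases i <;> fin_cases j <;> simp_all
      rw [h, sub_self] }

theorem wedge_apply (β : F →L[ℝ] F' →L[ℝ] F'') (α : DForm I M F 1) (α' : DForm I M F' 1)
    (x : M) (v w : TangentSpace I x) :
    wedge β α α' x ![v, w]
      = β (α.toCLM x v) (α'.toCLM x w) - β (α.toCLM x w) (α'.toCLM x v) := rfl

end DForm
end Forms

/-! ### The Lie algebra of a Banach Lie group -/

theorem LinearMap.continuous_of_antisymm {E : Type*} [NormedAddCommGroup E] [NormedSpace ℝ E]
    [CompleteSpace E] (B : E →ₗ[ℝ] (E →L[ℝ] E)) (hB : ∀ X Y, B X Y = - B Y X) :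
    Continuous B := by
  apply LinearMap.continuous_of_seq_closed_graph
  intro u X T hu hT
  ext Y
  have h1 : Filter.Tendsto (fun n => B (u n) Y) Filter.atTop (𝓝 (T Y)) :=
    ((ContinuousLinearMap.apply ℝ E Y).continuous.tendsto T).comp hT
  have h2 : Filter.Tendsto (fun n => B (u n) Y) Filter.atTop (𝓝 (B X Y)) := by
    have e : ∀ Z : E, B Z Y = - B Y Z := fun Z => hB Z Y
    simp only [e]
    exact (((B Y).continuous.neg).tendsto X).comp hu
  exact tendsto_nhds_unique h1 h2

theorem lieGroup3 {E H : Type*} [NormedAddCommGroup E] [NormedSpace ℝ E] [TopologicalSpace H]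
    (I : ModelWithCorners ℝ E H) (G : Type*) [TopologicalSpace G] [ChartedSpace H G] [Group G]
    [LieGroup I ∞ G] : LieGroup I (minSmoothness ℝ 3) G := by
  have h : minSmoothness ℝ 3 ≤ (∞ : WithTop ℕ∞) := by
    rw [minSmoothness_of_isRCLikeNormedField]
    exact WithTop.coe_le_coe.2 le_top
  exact LieGroup.of_le h

section LieBracket
variable {E H : Type*} [NormedAddCommGroup E] [NormedSpace ℝ E] [CompleteSpace E]
  [TopologicalSpace H] (I : ModelWithCorners ℝ E H) [I.Boundaryless]
  (G : Type*) [TopologicalSpace G] [ChartedSpace H G] [Group G] [LieGroup I ∞ G]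

/-- The bracket of the Lie algebra `T₁G`, whose underlying Banach space is the model space `E`. -/
def lieBr (X Y : E) : E :=
  Bracket.bracket (L := GroupLieAlgebra I G) (M := GroupLieAlgebra I G) X Y

theorem lieBr_swap (X Y : E) : lieBr I G X Y = - lieBr I G Y X := by
  have := lieGroup3 I G
  exact (lie_skew (L := GroupLieAlgebra I G) X Y).symm

theorem lieBr_add_right (X Y Z : E) : lieBr I G X (Y + Z) = lieBr I G X Y + lieBr I G X Z := by
  have := lieGroup3 I G
  exact lie_add (L := GroupLieAlgebra I G) (M := GroupLieAlgebra I G) X Y Z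

theorem lieBr_smul_right (c : ℝ) (X Y : E) : lieBr I G X (c • Y) = c • lieBr I G X Y := by
  have := lieGroup3 I G
  exact lie_smul (L := GroupLieAlgebra I G) (M := GroupLieAlgebra I G) c X Y

open VectorField in
theorem lieBr_continuous_right (X : E) : Continuous (lieBr I G X) := by
  have := lieGroup3 I G
  let x0 : E := extChartAt I (1 : G) 1
  let S : E → G := (extChartAt I (1 : G)).symm
  let A : E → (E →L[ℝ] E) := fun y =>
    ((mfderiv[Set.range I] S y).inverse : E →L[ℝ] E).comp
      (mfderiv I I (fun h : G => S y * h) (1 : G) : E →L[ℝ] E)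
  let B : E →L[ℝ] E := ((mfderiv I 𝓘(ℝ, E) (extChartAt I (1 : G)) (1 : G)).inverse : E →L[ℝ] E)
  have hdiff : ∀ v : E, DifferentiableAt ℝ (fun y => A y v) x0 := by
    intro v
    have h1 : MDifferentiableWithinAt I I.tangent
        (fun g : G => (mulInvariantVectorField (I := I) (v : GroupLieAlgebra I G) g : TangentBundle I G)) Set.univ 1 :=
      (mdifferentiableAt_mulInvariantVectorField (I := I) (G := G) v).mdifferentiableWithinAt
    have h2 := h1.differentiableWithinAt_mpullbackWithin_vectorField
    have h3 : (extChartAt I (1 : G)).symm ⁻¹' Set.univ ∩ Set.range I = Set.univ := by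
      simp [I.range_eq_univ]
    rw [h3] at h2
    have h4 : DifferentiableWithinAt ℝ (fun y => A y v) Set.univ x0 := h2
    exact differentiableWithinAt_univ.1 h4
  have key : ∀ Y : E, lieBr I G X Y =
      B (fderiv ℝ (fun y => A y Y) x0 (A x0 X) - fderiv ℝ (fun y => A y X) x0 (A x0 Y)) := by
    intro Y
    have h3 : (extChartAt I (1 : G)).symm ⁻¹' Set.univ ∩ Set.range I = Set.univ := by
      simp [I.range_eq_univ]
    have e1 : lieBr I G X Y =
      B (lieBracketWithin ℝ (E := E) (fun y => A y X) (fun y => A y Y)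
        ((extChartAt I (1 : G)).symm ⁻¹' Set.univ ∩ Set.range I) x0) := rfl
    rw [e1, h3, lieBracketWithin_univ]
    rfl
  have hlim : Continuous (fun Y : E => fderiv ℝ (fun y => A y Y) x0 (A x0 X)) := by
    let c : ℕ → ℝ := fun n => (n : ℝ) + 1
    let T : ℕ → (E →L[ℝ] E) := fun n => c n • (A (x0 + (c n)⁻¹ • A x0 X) - A x0)
    have hT : Filter.Tendsto (fun n (Y : E) => T n Y) Filter.atTop
        (𝓝 (fun Y : E => fderiv ℝ (fun y => A y Y) x0 (A x0 X))) := by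
      rw [tendsto_pi_nhds]
      intro Y
      have hc : Filter.Tendsto c Filter.atTop Filter.atTop :=
        Filter.tendsto_atTop_add_const_right _ _ tendsto_natCast_atTop_atTop
      have := (hdiff Y).hasFDerivAt.lim (A x0 X) (c := c) (l := Filter.atTop) ?_
      · exact this
      · exact Filter.tendsto_abs_atTop_atTop.comp hc
    exact (continuousLinearMapOfTendsto T hT).continuous
  have : lieBr I G X = fun Y => B (fderiv ℝ (fun y => A y Y) x0 (A x0 X) -
      fderiv ℝ (fun y => A y X) x0 (A x0 Y)) := funext key
  rw [this]
  fun_prop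

/-- The continuous linear map `Y ↦ [X, Y]`. -/
def lieBrRight (X : E) : E →L[ℝ] E where
  toFun := lieBr I G X
  map_add' := lieBr_add_right I G X
  map_smul' := fun c => lieBr_smul_right I G c X
  cont := lieBr_continuous_right I G X

/-- The linear map `X ↦ [X, ·]`. -/
def lieBrLin : E →ₗ[ℝ] (E →L[ℝ] E) where
  toFun := lieBrRight I G
  map_add' := fun X X' => by
    ext Y
    change lieBr I G (X + X') Y = lieBr I G X Y + lieBr I G X' Y
    rw [lieBr_swap, lieBr_add_right, lieBr_swap I G X, lieBr_swap I G X', neg_add]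
  map_smul' := fun c X => by
    ext Y
    change lieBr I G (c • X) Y = c • lieBr I G X Y
    rw [lieBr_swap, lieBr_smul_right, lieBr_swap I G X, smul_neg]

theorem lieBrLin_continuous : Continuous (lieBrLin I G) :=
  LinearMap.continuous_of_antisymm (lieBrLin I G) (fun X Y => lieBr_swap I G X Y)

/-- The Lie bracket of `Lie G` as a continuous bilinear map. -/
def lieBrCLM : E →L[ℝ] E →L[ℝ] E := ⟨lieBrLin I G, lieBrLin_continuous I G⟩

theorem lieBrCLM_apply (X Y : E) : lieBrCLM I G X Y = lieBr I G X Y := rfl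
end LieBracket

section LieGroups

variable {E H : Type*} [NormedAddCommGroup E] [NormedSpace ℝ E] [TopologicalSpace H]
  (I : ModelWithCorners ℝ E H)
  (G : Type*) [TopologicalSpace G] [ChartedSpace H G] [Group G]

/-- The adjoint action `Ad_g` on `Lie G = T₁G`. -/
def lieAd (g : G) : E →L[ℝ] E := mfderiv I I (fun h : G => g * h * g⁻¹) (1 : G)

/-- The left invariant Maurer-Cartan form. -/
def maurerCartan : DForm I G E 1 :=
  DForm.ofCLM fun g => (mfderiv I I (fun h : G => g⁻¹ * h) g : TangentSpace I g →L[ℝ] E)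

end LieGroups

/-! ### Principal bundles and central extensions -/

section Bundles

variable {EG HG : Type*} [NormedAddCommGroup EG] [NormedSpace ℝ EG] [TopologicalSpace HG]
  (IG : ModelWithCorners ℝ EG HG)
  {G : Type*} [TopologicalSpace G] [ChartedSpace HG G] [Group G]
  {EB HB : Type*} [NormedAddCommGroup EB] [NormedSpace ℝ EB] [TopologicalSpace HB]
  (IB : ModelWithCorners ℝ EB HB)
  {B : Type*} [TopologicalSpace B] [ChartedSpace HB B]
  {EX HX : Type*} [NormedAddCommGroup EX] [NormedSpace ℝ EX] [TopologicalSpace HX]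
  (IX : ModelWithCorners ℝ EX HX)
  {X : Type*} [TopologicalSpace X] [ChartedSpace HX X]

/-- `proj : B → X` with the right action `act` is a smooth principal `G`-bundle: it is locally
isomorphic, smoothly, over `X`, and equivariantly, to `U × G`. -/
structure IsPrincipalBundle (proj : B → X) (act : B → G → B) : Prop where
  act_one : ∀ b, act b 1 = b
  act_mul : ∀ b g h, act b (g * h) = act (act b g) h
  contMDiff_proj : ContMDiff IB IX ∞ proj
  contMDiff_act : ContMDiff (IB.prod IG) IB ∞ fun p : B × G => act p.1 p.2
  proj_act : ∀ b g, proj (act b g) = proj b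
  locally_trivial : ∀ x : X, ∃ (U : Set X) (φ : OpenPartialHomeomorph B (X × G)),
    IsOpen U ∧ x ∈ U ∧ φ.source = proj ⁻¹' U ∧ φ.target = U ×ˢ Set.univ ∧
    ContMDiffOn IB (IX.prod IG) ∞ φ φ.source ∧
    ContMDiffOn (IX.prod IG) IB ∞ φ.symm φ.target ∧
    (∀ b ∈ φ.source, (φ b).1 = proj b) ∧
    ∀ b ∈ φ.source, ∀ g, φ (act b g) = ((φ b).1, (φ b).2 * g)

variable (G B X) in
/-- A smooth principal `G`-bundle `B → X`. -/
structure PrincipalBundle where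
  proj : B → X
  act : B → G → B
  isPrincipalBundle : IsPrincipalBundle IG IB IX proj act

end Bundles

section CentralExtensions

variable {EG HG : Type*} [NormedAddCommGroup EG] [NormedSpace ℝ EG] [TopologicalSpace HG]
  (IG : ModelWithCorners ℝ EG HG)
  (G : Type*) [TopologicalSpace G] [ChartedSpace HG G] [Group G]
  {EK HK : Type*} [NormedAddCommGroup EK] [NormedSpace ℝ EK] [TopologicalSpace HK]
  (IK : ModelWithCorners ℝ EK HK)
  (K : Type*) [TopologicalSpace K] [ChartedSpace HK K] [Group K]

/-- A central extension `1 → 𝕋 → K → G → 1` of Lie groups by the unit circle; as usual for Lie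
groups, `q : K → G` is required to be a principal `𝕋`-bundle. -/
structure CentralExtension where
  incl : Circle →* K
  q : K →* G
  incl_injective : Function.Injective incl
  q_surjective : Function.Surjective q
  exact : q.ker = incl.range
  central : ∀ (u : Circle) (k : K), incl u * k = k * incl u
  isPrincipalBundle : IsPrincipalBundle (𝓡 1) IK IG q fun k u => k * incl u

namespace CentralExtension

variable {IG G IK K} (C : CentralExtension IG G IK K)

/-- The inclusion `iℝ = Lie 𝕋 → Lie K`. Throughout, `iℝ` is identified with `ℝ` through
`it ↔ t`, where `it` is the velocity at `s = 0` of `s ↦ exp(ist)`. -/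
def inclStar : ℝ →L[ℝ] EK :=
  mfderiv 𝓘(ℝ, ℝ) IK (fun s : ℝ => C.incl (Circle.exp s)) 0

theorem inclStar_ne_zero : C.inclStar 1 ≠ 0 := by
  intro h0
  obtain ⟨U, φ, -, hxU, hsrc, -, hφ, -, -, hact⟩ := C.isPrincipalBundle.locally_trivial (C.q 1)
  have h1 : (1 : K) ∈ φ.source := by rw [hsrc]; exact hxU
  let f : ℝ → K := fun s => C.incl (Circle.exp s)
  have hf : ContMDiff 𝓘(ℝ, ℝ) IK ∞ f := by
    have e : f = (fun p : K × Circle => p.1 * C.incl p.2) ∘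
        fun s : ℝ => ((1 : K), Circle.exp s) := by
      funext s; simp [f]
    rw [e]
    exact C.isPrincipalBundle.contMDiff_act.comp
      (contMDiff_const.prodMk contMDiff_circleExp)
  have hf0 : f 0 = 1 := by simp [f]
  let h : K → ℂ := fun k => ((φ k).2 : ℂ)
  have hh : MDifferentiableAt IK 𝓘(ℝ, ℂ) h (f 0) := by
    rw [hf0]
    have e1 : ContMDiffAt IK (IG.prod (𝓡 1)) ∞ φ 1 :=
      hφ.contMDiffAt (φ.open_source.mem_nhds h1)
    have e2 : ContMDiffAt IK (𝓡 1) ∞ (fun k => (φ k).2) 1 := e1.snd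
    have e3 : ContMDiff (𝓡 1) 𝓘(ℝ, ℂ) ∞ (fun u : Circle => (u : ℂ)) := by
      have : Fact (Module.finrank ℝ ℂ = 1 + 1) := ⟨Complex.finrank_real_complex⟩
      exact contMDiff_coe_sphere
    exact (e3.contMDiffAt.comp (1 : K) e2).mdifferentiableAt (by simp)
  have hcomp : h ∘ f = fun s : ℝ => ((φ 1).2 : ℂ) * Complex.exp (s * Complex.I) := by
    funext s
    have := hact 1 h1 (Circle.exp s)
    simp only [one_mul] at this
    simp [h, f, this, Circle.coe_exp]
  have hd : mfderiv 𝓘(ℝ, ℝ) 𝓘(ℝ, ℂ) (h ∘ f) 0 (1 : ℝ) = 0 := by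
    rw [mfderiv_comp (0 : ℝ) hh (hf.mdifferentiableAt (by simp))]
    have h0' : mfderiv 𝓘(ℝ, ℝ) IK f 0 (1 : ℝ) = 0 := h0
    change mfderiv IK 𝓘(ℝ, ℂ) h (f 0) (mfderiv 𝓘(ℝ, ℝ) IK f 0 (1 : ℝ)) = 0
    rw [h0', map_zero]
  have hder : HasDerivAt (fun s : ℝ => ((φ 1).2 : ℂ) * Complex.exp (s * Complex.I))
      (((φ 1).2 : ℂ) * Complex.I) 0 := by
    have e1 : HasDerivAt (fun s : ℝ => (s : ℂ) * Complex.I) (1 * Complex.I) 0 :=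
      (Complex.ofRealCLM.hasDerivAt).mul_const _
    simpa using (e1.cexp).const_mul (((φ 1).2 : ℂ))
  rw [hcomp, mfderiv_eq_fderiv] at hd
  have hd' : deriv (fun s : ℝ => ((φ 1).2 : ℂ) * Complex.exp (s * Complex.I)) 0 = 0 := hd
  rw [hder.deriv] at hd'
  simp at hd'

theorem exists_centralCoord : ∃ c : EK →L[ℝ] ℝ, ∀ t : ℝ, c (C.inclStar t) = t := by
  obtain ⟨c, hc⟩ := SeparatingDual.exists_eq_one (R := ℝ) C.inclStar_ne_zero
  refine ⟨c, fun t => ?_⟩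
  have : C.inclStar t = t • C.inclStar 1 := by rw [← map_smul]; simp
  rw [this, map_smul, hc]; simp

/-- A continuous linear functional which restricts to the inverse of `inclStar` on the central line
`inclStar(iℝ) = ker qStar` of `Lie K`. It is only ever applied to elements of this line, where its
values do not depend on the choice; it expresses the identification of that line with `iℝ`. -/
def centralCoord : EK →L[ℝ] ℝ := Classical.choose C.exists_centralCoord

theorem centralCoord_inclStar (t : ℝ) : C.centralCoord (C.inclStar t) = t :=
  Classical.choose_spec C.exists_centralCoord t

/-- The map `q_* : Lie K → Lie G`. -/
def qStar : EK →L[ℝ] EG := mfderiv IK IG C.q 1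

/-- A split `σ : Lie G → Lie K` of the exact sequence of Lie algebras, as (topological) vector
spaces. -/
structure Split where
  toCLM : EG →L[ℝ] EK
  qStar_toCLM : ∀ Y : EG, C.qStar (toCLM Y) = Y

/-- The action of `G` on `Lie K`: `Ad_g = Ad_k` for any `k` with `q k = g` (independent of `k`,
since the kernel of `q` is central). -/
def lieAdHat (g : G) : EK →L[ℝ] EK := lieAd IK K (Function.surjInv C.q_surjective g)

/-- The group cocycle `Z_σ(g, Y) = Ad_g σ(Y) - σ(Ad_g Y) ∈ iℝ`. -/
def groupCocycle (σ : C.Split) (g : G) : EG →L[ℝ] ℝ :=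
  C.centralCoord.comp ((C.lieAdHat g).comp σ.toCLM - σ.toCLM.comp (lieAd IG G g))

/-- The connection `ν_σ = μ_K - σ(q^* μ_G)` on the `𝕋`-bundle `q : K → G`. -/
def connectionForm (σ : C.Split) : DForm IK K ℝ 1 :=
  DForm.mapVal C.centralCoord
    (maurerCartan IK K - DForm.mapVal σ.toCLM (DForm.pullback IK IG C.q (maurerCartan IG G)))

section Cocycle

variable [CompleteSpace EG] [IG.Boundaryless] [LieGroup IG ∞ G]
  [CompleteSpace EK] [IK.Boundaryless] [LieGroup IK ∞ K]

/-- The Lie algebra cocycle `ω_σ(Y, Z) = [σ(Y), σ(Z)] - σ([Y, Z]) ∈ iℝ`. -/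
def lieCocycle (σ : C.Split) : EG →L[ℝ] EG →L[ℝ] ℝ :=
  (ContinuousLinearMap.compL ℝ EG EK ℝ C.centralCoord).comp
    ((lieBrCLM IK K).bilinearComp σ.toCLM σ.toCLM
      - (ContinuousLinearMap.compL ℝ EG EG EK σ.toCLM).comp (lieBrCLM IG G))

theorem lieCocycle_apply (σ : C.Split) (Y Z : EG) :
    C.lieCocycle σ Y Z = C.centralCoord
      (lieBr IK K (σ.toCLM Y) (σ.toCLM Z) - σ.toCLM (lieBr IG G Y Z)) := rfl

end Cocycle

end CentralExtension
end CentralExtensions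

/-! ### The lifting bundle gerbe -/

section Transport

variable {H : Type*} [TopologicalSpace H] {S M : Type*} [TopologicalSpace S] [TopologicalSpace M]
  [ChartedSpace H M]

/-- The manifold structure on `S` which makes the homeomorphism `e : S ≃ₜ M` a diffeomorphism. -/
@[reducible] def Homeomorph.transportCharts (e : S ≃ₜ M) : ChartedSpace H S where
  atlas := {c | ∃ c' ∈ atlas H M, c = e.toOpenPartialHomeomorph ≫ₕ c'}
  chartAt s := e.toOpenPartialHomeomorph ≫ₕ chartAt H (e s)
  mem_chart_source s := by simp
  chart_mem_atlas s := ⟨_, chart_mem_atlas H (e s), rfl⟩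

end Transport

section LiftingGerbe

variable {EG HG : Type*} [NormedAddCommGroup EG] [NormedSpace ℝ EG] [TopologicalSpace HG]
  {IG : ModelWithCorners ℝ EG HG}
  {G : Type*} [TopologicalSpace G] [ChartedSpace HG G] [Group G]
  {EK HK : Type*} [NormedAddCommGroup EK] [NormedSpace ℝ EK] [TopologicalSpace HK]
  {IK : ModelWithCorners ℝ EK HK}
  {K : Type*} [TopologicalSpace K] [ChartedSpace HK K] [Group K]
  {EB HB : Type*} [NormedAddCommGroup EB] [NormedSpace ℝ EB] [TopologicalSpace HB]
  {IB : ModelWithCorners ℝ EB HB}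
  {B : Type*} [TopologicalSpace B] [ChartedSpace HB B]
  {EX HX : Type*} [NormedAddCommGroup EX] [NormedSpace ℝ EX] [TopologicalSpace HX]
  {IX : ModelWithCorners ℝ EX HX}
  {X : Type*} [TopologicalSpace X] [ChartedSpace HX X]

namespace PrincipalBundle

variable (P : PrincipalBundle IG G IB B IX X)

/-- The fibre product `B^[2] = {(b₁, b₂) | π(b₁) = π(b₂)}`, with the subspace topology. -/
def FibreSq : Type _ := {p : B × B // P.proj p.1 = P.proj p.2}

instance : TopologicalSpace P.FibreSq := inferInstanceAs (TopologicalSpace {p : B × B // _})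

/-- The projection `π₁ : B^[2] → B`. -/
def pr1 (p : P.FibreSq) : B := p.1.1

/-- The projection `π₂ : B^[2] → B`. -/
def pr2 (p : P.FibreSq) : B := p.1.2

theorem continuous_pr1 : Continuous P.pr1 := continuous_fst.comp continuous_subtype_val

theorem continuous_pr2 : Continuous P.pr2 := continuous_snd.comp continuous_subtype_val

theorem local_triv (b : B) : ∃ φ : OpenPartialHomeomorph B (X × G), b ∈ φ.source ∧
    (∀ b₁ ∈ φ.source, ∀ b₂, P.proj b₁ = P.proj b₂ → b₂ ∈ φ.source) ∧
    (∀ b₁ ∈ φ.source, ∀ b₂ ∈ φ.source, P.proj b₁ = P.proj b₂ → (φ b₁).1 = (φ b₂).1) ∧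
    (∀ b₁ ∈ φ.source, ∀ g, P.act b₁ g ∈ φ.source ∧
      φ (P.act b₁ g) = ((φ b₁).1, (φ b₁).2 * g)) := by
  obtain ⟨U, φ, -, hx, hs, -, -, -, hp, ha⟩ := P.isPrincipalBundle.locally_trivial (P.proj b)
  refine ⟨φ, by rw [hs]; exact hx, ?_, ?_, ?_⟩
  · intro b₁ h₁ b₂ h
    rw [hs] at h₁ ⊢
    simpa [← h] using h₁
  · intro b₁ h₁ b₂ h₂ h
    rw [hp b₁ h₁, hp b₂ h₂, h]
  · intro b₁ h₁ g
    refine ⟨?_, ha b₁ h₁ g⟩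
    rw [hs] at h₁ ⊢
    simpa [P.isPrincipalBundle.proj_act] using h₁

theorem act_injective (b : B) (g h : G) (e : P.act b g = P.act b h) : g = h := by
  obtain ⟨φ, hb, -, -, ha⟩ := P.local_triv b
  have h1 := (ha b hb g).2
  rw [e, (ha b hb h).2] at h1
  exact (mul_left_cancel (congrArg Prod.snd h1)).symm

theorem exists_act_eq (p : P.FibreSq) : ∃ g : G, P.act (P.pr1 p) g = P.pr2 p := by
  obtain ⟨φ, hb, hm, hf, ha⟩ := P.local_triv (P.pr1 p)
  have hb2 := hm _ hb (P.pr2 p) p.2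
  refine ⟨(φ (P.pr1 p)).2⁻¹ * (φ (P.pr2 p)).2, ?_⟩
  have h := ha _ hb ((φ (P.pr1 p)).2⁻¹ * (φ (P.pr2 p)).2)
  refine φ.injOn h.1 hb2 ?_
  rw [h.2]
  refine Prod.ext (hf _ hb _ hb2 p.2) ?_
  simp

/-- The map `ζ : B^[2] → G` with `b₁ ζ(b₁, b₂) = b₂`. -/
def zeta (p : P.FibreSq) : G := Classical.choose (P.exists_act_eq p)

theorem act_zeta (p : P.FibreSq) : P.act (P.pr1 p) (P.zeta p) = P.pr2 p :=
  Classical.choose_spec (P.exists_act_eq p)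

/-- The point `(b, b g)`. -/
def mkSq (b : B) (g : G) : P.FibreSq :=
  ⟨(b, P.act b g), (P.isPrincipalBundle.proj_act b g).symm⟩

theorem zeta_mkSq (b : B) (g : G) : P.zeta (P.mkSq b g) = g :=
  P.act_injective b _ _ (P.act_zeta (P.mkSq b g))

theorem continuous_act : Continuous fun p : B × G => P.act p.1 p.2 :=
  P.isPrincipalBundle.contMDiff_act.continuous

theorem continuous_mkSq : Continuous fun p : B × G => P.mkSq p.1 p.2 :=
  Continuous.subtype_mk (continuous_fst.prodMk P.continuous_act) _

theorem continuous_zeta [IsTopologicalGroup G] : Continuous P.zeta := by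
  rw [continuous_iff_continuousAt]
  intro p
  obtain ⟨φ, hb, hm, hf, ha⟩ := P.local_triv (P.pr1 p)
  have hb2 := hm _ hb (P.pr2 p) p.2
  have hc : ContinuousAt (fun p' => (φ (P.pr1 p')).2⁻¹ * (φ (P.pr2 p')).2) p := by
    have e1 : ContinuousAt (fun p' => φ (P.pr1 p')) p :=
      ContinuousAt.comp (f := P.pr1) (φ.continuousAt hb) P.continuous_pr1.continuousAt
    have e2 : ContinuousAt (fun p' => φ (P.pr2 p')) p :=
      ContinuousAt.comp (f := P.pr2) (φ.continuousAt hb2) P.continuous_pr2.continuousAt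
    exact (e1.snd.inv).mul e2.snd
  refine hc.congr ?_
  filter_upwards [P.continuous_pr1.continuousAt.preimage_mem_nhds (φ.open_source.mem_nhds hb)]
    with p' hp'
  have h := (ha _ hp' (P.zeta p')).2
  rw [P.act_zeta] at h
  rw [h]
  simp

section Manifold

variable [LieGroup IG ∞ G]

theorem isTopologicalGroup_of_bundle (_ : PrincipalBundle IG G IB B IX X) :
    IsTopologicalGroup G := topologicalGroup_of_lieGroup IG ∞

/-- `B^[2] ≃ B × G`, `(b₁, b₂) ↦ (b₁, ζ(b₁, b₂))`. For the submanifold structure of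
`B^[2] ⊆ B × B` this is a diffeomorphism, with inverse `(b, g) ↦ (b, b g)`. -/
def fibreSqHomeo : P.FibreSq ≃ₜ B × G where
  toFun p := (P.pr1 p, P.zeta p)
  invFun p := P.mkSq p.1 p.2
  left_inv p := Subtype.ext (Prod.ext rfl (P.act_zeta p))
  right_inv p := Prod.ext rfl (P.zeta_mkSq p.1 p.2)
  continuous_toFun :=
    haveI := P.isTopologicalGroup_of_bundle
    P.continuous_pr1.prodMk P.continuous_zeta
  continuous_invFun := P.continuous_mkSq

/-- The smooth structure of `B^[2]`. -/
instance : ChartedSpace (ModelProd HB HG) P.FibreSq := P.fibreSqHomeo.transportCharts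

end Manifold

/-- `θ ∈ Ω¹(B; Lie G)` is a connection on the principal bundle. -/
structure IsConnection (θ : DForm IB B EG 1) : Prop where
  smooth : θ.Smooth
  vertical : ∀ (b : B) (Y : EG), θ.toCLM b (mfderiv IG IB (fun g : G => P.act b g) 1 Y) = Y
  equivariant : ∀ g : G, DForm.pullback IB IB (fun b => P.act b g) θ
    = DForm.mapVal (lieAd IG G g⁻¹) θ

end PrincipalBundle

/-- The curvature `F_θ = dθ + ½[θ, θ]`. -/
def connCurvature (IG : ModelWithCorners ℝ EG HG) (G : Type*) [TopologicalSpace G]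
    [ChartedSpace HG G] [Group G] [CompleteSpace EG] [IG.Boundaryless] [LieGroup IG ∞ G]
    (θ : DForm IB B EG 1) : DForm IB B EG 2 :=
  θ.d + (1 / 2 : ℝ) • DForm.wedge (lieBrCLM IG G) θ θ

variable (P : PrincipalBundle IG G IB B IX X) (C : CentralExtension IG G IK K)

/-- The associated bundle `B ×_Ad Lie K`: pairs `[b, Y]` with `[b, Y] = [b g, Ad_{g⁻¹} Y]`. -/
def AdHatBundle : Type _ :=
  Quot fun p p' : B × EK => ∃ g : G, p'.1 = P.act p.1 g ∧ p'.2 = C.lieAdHat g⁻¹ p.2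

/-- The class `[b, Y]`. -/
def AdHatBundle.mk (b : B) (Y : EK) : AdHatBundle P C := Quot.mk _ (b, Y)

/-- A splitting of the bundle: a smooth vector bundle map from `B ×_Ad Lie K` to
`B ×_Ad iℝ = X × iℝ` which is the identity on the subbundle `B ×_Ad iℝ`. The linear structure on
the fibre over `π(b)` is the one for which `Y ↦ [b, Y]` is linear, and a map out of `B ×_Ad Lie K`
is smooth if and only if its composition with the submersion `B × Lie K → B ×_Ad Lie K` is. -/
structure Splitting where
  toFun : AdHatBundle P C → X × ℝ
  base : ∀ (b : B) (Y : EK), (toFun (AdHatBundle.mk P C b Y)).1 = P.proj b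
  add : ∀ (b : B) (Y Z : EK), (toFun (AdHatBundle.mk P C b (Y + Z))).2
    = (toFun (AdHatBundle.mk P C b Y)).2 + (toFun (AdHatBundle.mk P C b Z)).2
  smul : ∀ (b : B) (r : ℝ) (Y : EK), (toFun (AdHatBundle.mk P C b (r • Y))).2
    = r * (toFun (AdHatBundle.mk P C b Y)).2
  smooth : ContMDiff (IB.prod 𝓘(ℝ, EK)) 𝓘(ℝ, ℝ) ∞
    fun p : B × EK => (toFun (AdHatBundle.mk P C p.1 p.2)).2
  center : ∀ (b : B) (t : ℝ), (toFun (AdHatBundle.mk P C b (C.inclStar t))).2 = t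

/-- The map `(b, Y) ↦ L[b, Y] ∈ iℝ` on `B × Lie K`. -/
def Splitting.lift {P : PrincipalBundle IG G IB B IX X} {C : CentralExtension IG G IK K}
    (L : Splitting P C) (b : B) : EK →L[ℝ] ℝ where
  toFun Y := (L.toFun (AdHatBundle.mk P C b Y)).2
  map_add' := L.add b
  map_smul' := L.smul b
  cont := L.smooth.continuous.comp (continuous_const.prodMk continuous_id)

/-- The reduced splitting `l_σ(b, Y) = L[b, σ(Y)]` induced from `L`. -/
def Splitting.reduced {P : PrincipalBundle IG G IB B IX X} {C : CentralExtension IG G IK K}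
    (L : Splitting P C) (σ : C.Split) (b : B) : EG →L[ℝ] ℝ :=
  (L.lift b).comp σ.toCLM

/-- The total space of the pull-back `J_B = ζ^* K` over `B^[2]` of the `𝕋`-bundle `q : K → G`. -/
def LiftingGerbe : Type _ := {j : P.FibreSq × K // P.zeta j.1 = C.q j.2}

namespace LiftingGerbe

instance : TopologicalSpace (LiftingGerbe P C) :=
  inferInstanceAs (TopologicalSpace {_j : P.FibreSq × K // _})

variable {P C}

/-- The bundle projection `ρ : J_B → B^[2]`. -/
def rho (j : LiftingGerbe P C) : P.FibreSq := j.1.1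

/-- The map `J_B → K` covering `ζ`. -/
def hat (j : LiftingGerbe P C) : K := j.1.2

theorem continuous_rho : Continuous (rho : LiftingGerbe P C → P.FibreSq) :=
  continuous_fst.comp continuous_subtype_val

theorem continuous_hat : Continuous (hat : LiftingGerbe P C → K) :=
  continuous_snd.comp continuous_subtype_val

theorem ext_of_pr1_hat {j j' : LiftingGerbe P C} (h₁ : P.pr1 j.rho = P.pr1 j'.rho)
    (h₂ : j.hat = j'.hat) : j = j' := by
  have hz : P.zeta j.rho = P.zeta j'.rho := by
    have e : P.zeta j.rho = C.q j.hat := j.2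
    have e' : P.zeta j'.rho = C.q j'.hat := j'.2
    rw [e, e', h₂]
  have hp : P.pr2 j.rho = P.pr2 j'.rho := by rw [← P.act_zeta, ← P.act_zeta, h₁, hz]
  exact Subtype.ext (Prod.ext (Subtype.ext (Prod.ext h₁ hp)) h₂)

variable (P C) in
/-- The point of `J_B` over `(b, b q(k))` given by `k`. -/
def mk (b : B) (k : K) : LiftingGerbe P C := ⟨(P.mkSq b (C.q k), k), P.zeta_mkSq b (C.q k)⟩

theorem continuous_q (C : CentralExtension IG G IK K) : Continuous C.q :=
  C.isPrincipalBundle.contMDiff_proj.continuous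

variable (P C) in
/-- `J_B ≃ B × K`, `(b₁, b₂, k) ↦ (b₁, k)`. For the pull-back smooth structure of `J_B` this is a
diffeomorphism, with inverse `(b, k) ↦ (b, b q(k), k)`. -/
def homeo : LiftingGerbe P C ≃ₜ B × K where
  toFun j := (P.pr1 j.rho, j.hat)
  invFun p := mk P C p.1 p.2
  left_inv _ := ext_of_pr1_hat rfl rfl
  right_inv _ := rfl
  continuous_toFun := (P.continuous_pr1.comp continuous_rho).prodMk continuous_hat
  continuous_invFun := Continuous.subtype_mk
    ((P.continuous_mkSq.comp
      (continuous_fst.prodMk ((continuous_q C).comp continuous_snd))).prodMk continuous_snd) _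

/-- The smooth structure of `J_B`. -/
instance : ChartedSpace (ModelProd HB HK) (LiftingGerbe P C) := (homeo P C).transportCharts

/-- The action of `𝕋` on `J_B`. -/
def act (j : LiftingGerbe P C) (u : Circle) : LiftingGerbe P C :=
  ⟨(j.rho, j.hat * C.incl u), by
    have h : C.q (C.incl u) = 1 := by
      have : C.incl u ∈ C.q.ker := by rw [C.exact]; exact ⟨u, rfl⟩
      exact this
    have e : P.zeta j.rho = C.q j.hat := j.2
    rw [map_mul, h, mul_one, e]⟩

variable (P C) in
/-- The pairs of points of `J_B` over `(b₁, b₂)` and `(b₂, b₃)`, that is, the fibre product of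
`π₁₂^* J_B` and `π₂₃^* J_B` over `B^[3]`. -/
def Pairs : Type _ :=
  {p : LiftingGerbe P C × LiftingGerbe P C // P.pr2 p.1.rho = P.pr1 p.2.rho}

instance : TopologicalSpace (Pairs P C) :=
  inferInstanceAs (TopologicalSpace {_p : LiftingGerbe P C × LiftingGerbe P C // _})

/-- The first component. -/
def Pairs.fst (p : Pairs P C) : LiftingGerbe P C := p.1.1

/-- The second component. -/
def Pairs.snd (p : Pairs P C) : LiftingGerbe P C := p.1.2

theorem pr2_rho (j : LiftingGerbe P C) : P.pr2 j.rho = P.act (P.pr1 j.rho) (C.q j.hat) := by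
  have e : P.zeta j.rho = C.q j.hat := j.2
  rw [← e, P.act_zeta]

/-- The point `(b₁, b₃)`. -/
def Pairs.outer (p : Pairs P C) : P.FibreSq :=
  ⟨(P.pr1 p.fst.rho, P.pr2 p.snd.rho), p.fst.rho.2.trans
      ((congrArg P.proj p.2).trans p.snd.rho.2)⟩

/-- The product `m` of the lifting bundle gerbe, given by the multiplication of `K`. -/
def Pairs.mul (p : Pairs P C) : LiftingGerbe P C :=
  ⟨(p.outer, p.fst.hat * p.snd.hat), by
    have e : P.act (P.pr1 p.fst.rho) (P.zeta p.outer) = P.pr2 p.snd.rho := P.act_zeta p.outer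
    have h : P.pr2 p.fst.rho = P.pr1 p.snd.rho := p.2
    refine P.act_injective (P.pr1 p.fst.rho) _ _ (e.trans ?_)
    rw [map_mul, P.isPrincipalBundle.act_mul, ← pr2_rho, h, ← pr2_rho]⟩

variable (P C) in
/-- The space of composable pairs is diffeomorphic to `B × K × K`. -/
def Pairs.homeo : Pairs P C ≃ₜ B × (K × K) where
  toFun p := (P.pr1 p.fst.rho, p.fst.hat, p.snd.hat)
  invFun p := ⟨(mk P C p.1 p.2.1, mk P C (P.act p.1 (C.q p.2.1)) p.2.2), rfl⟩
  left_inv p := by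
    refine Subtype.ext (Prod.ext (ext_of_pr1_hat rfl rfl) (ext_of_pr1_hat ?_ rfl))
    have h : P.pr2 p.fst.rho = P.pr1 p.snd.rho := p.2
    exact (pr2_rho p.fst).symm.trans h
  right_inv _ := rfl
  continuous_toFun := by
    have h1 : Continuous (Pairs.fst : Pairs P C → _) := continuous_fst.comp continuous_subtype_val
    have h2 : Continuous (Pairs.snd : Pairs P C → _) := continuous_snd.comp continuous_subtype_val
    exact (P.continuous_pr1.comp (continuous_rho.comp h1)).prodMk
      ((continuous_hat.comp h1).prodMk (continuous_hat.comp h2))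
  continuous_invFun := by
    have hm : Continuous fun p : B × K => mk P C p.1 p.2 := (LiftingGerbe.homeo P C).symm.continuous
    refine Continuous.subtype_mk (Continuous.prodMk
      (hm.comp (continuous_fst.prodMk (continuous_fst.comp continuous_snd)))
      (hm.comp (Continuous.prodMk (P.continuous_act.comp
        (continuous_fst.prodMk ((continuous_q C).comp (continuous_fst.comp continuous_snd))))
        (continuous_snd.comp continuous_snd)))) _

/-- The smooth structure of the space of composable pairs. -/
instance : ChartedSpace (ModelProd HB (ModelProd HK HK)) (Pairs P C) :=
  (Pairs.homeo P C).transportCharts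

/-- `A` is a bundle gerbe connection: an `iℝ`-valued connection form on the `𝕋`-bundle `J_B` which is
compatible with the product, `π₁₂^* A + π₂₃^* A = m^* π₁₃^* A`. -/
structure IsGerbeConnection (A : DForm (IB.prod IK) (LiftingGerbe P C) ℝ 1) : Prop where
  smooth : A.Smooth
  vertical : ∀ (j : LiftingGerbe P C) (t : ℝ),
    A.toCLM j
      (mfderiv 𝓘(ℝ, ℝ) (IB.prod IK) (fun s : ℝ => j.act (Circle.exp s)) 0 t) = t
  invariant : ∀ u : Circle,
    DForm.pullback (IB.prod IK) (IB.prod IK) (fun j : LiftingGerbe P C => j.act u) A = A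
  product :
    DForm.pullback (IB.prod (IK.prod IK)) (IB.prod IK) Pairs.fst A
      + DForm.pullback (IB.prod (IK.prod IK)) (IB.prod IK) Pairs.snd A
      = DForm.pullback (IB.prod (IK.prod IK)) (IB.prod IK) Pairs.mul A

variable [LieGroup IG ∞ G]

/-- `Φ` is the curvature `F_A` of the `𝕋`-connection `A`: the (unique) `2`-form on the base `B^[2]`
whose pull-back to the total space is `dA`. -/
def IsCurvatureOf (A : DForm (IB.prod IK) (LiftingGerbe P C) ℝ 1)
    (Φ : DForm (IB.prod IG) P.FibreSq ℝ 2) : Prop :=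
  A.d = DForm.pullback (IB.prod IK) (IB.prod IG) rho Φ

/-- `f ∈ iΩ²(B)` is a curving for the bundle gerbe connection `A`: `F_A = -π₁^* f + π₂^* f`. -/
structure IsCurving (A : DForm (IB.prod IK) (LiftingGerbe P C) ℝ 1) (f : DForm IB B ℝ 2) :
    Prop where
  isGerbeConnection : IsGerbeConnection A
  smooth : f.Smooth
  curvature_eq : IsCurvatureOf A
    (- DForm.pullback (IB.prod IG) IB P.pr1 f + DForm.pullback (IB.prod IG) IB P.pr2 f)

variable (P C) in
/-- The `1`-form `ζ^* ν_σ + ρ^* Z_σ(ζ⁻¹, π₁^* θ)` on `J_B`. -/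
def connection (θ : DForm IB B EG 1) (σ : C.Split) :
    DForm (IB.prod IK) (LiftingGerbe P C) ℝ 1 :=
  DForm.pullback (IB.prod IK) IK hat (C.connectionForm σ)
    + DForm.pullback (IB.prod IK) (IB.prod IG) rho
      (fun p => (C.groupCocycle σ (P.zeta p)⁻¹).compContinuousAlternatingMap
        (DForm.pullback (IB.prod IG) IB P.pr1 θ p))

end LiftingGerbe

section Curving

variable [CompleteSpace EG] [IG.Boundaryless] [LieGroup IG ∞ G]

/-- `κ(b; V, W) = l_σ(b, F_θ(b; V, W))`. -/
def kappa {P : PrincipalBundle IG G IB B IX X} {C : CentralExtension IG G IK K}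
    (θ : DForm IB B EG 1) (L : Splitting P C) (σ : C.Split) : DForm IB B ℝ 2 :=
  fun b => (L.reduced σ b).compContinuousAlternatingMap (connCurvature IG G θ b)

end Curving

end LiftingGerbe

end

/-! Write a point of $J_B$ as $(b_1,b_2,k)$ with $b_2=b_1q(k)$, and put $\alpha=\pi_1^*\theta$,
$\alpha'=\pi_2^*\theta$ on $J_B$. Since $b_2=b_1q(k)$, the two are gauge related:
$\alpha'=q(k)^*\mu+\mathrm{Ad}_{q(k)^{-1}}\alpha$ (`pullback_pr2`). The $\mathrm{Lie}\,K$-valued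
form $\Theta=k^*\widehat\mu+\mathrm{Ad}_{k^{-1}}\sigma(\alpha)$ (`liftForm`) obeys the same formula
upstairs, so $q_*\Theta=\alpha'$, and the given connection is the central difference
$\nabla=\Theta-\sigma(\alpha')$ (`connection_eq`).

Curvature changes by $\mathrm{Ad}$ under gauge transformations (`gauge_curvature`). In $K$ this
gives
$d\Theta+\frac12[\Theta,\Theta]=\mathrm{Ad}_{k^{-1}}(\sigma(d\alpha)+\frac12[\sigma\alpha,\sigma\alpha])$.
As $\Theta$ and $\sigma(\alpha')$ differ by a central term,
$[\Theta,\Theta]=[\sigma\alpha',\sigma\alpha']$. Replacing each $[\sigma\cdot,\sigma\cdot]$ by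
$\sigma[\cdot,\cdot]+\omega_\sigma$ yields
$d\nabla=\frac12\omega_\sigma(\alpha,\alpha)-\frac12\omega_\sigma(\alpha',\alpha')+\mathrm{Ad}_{k^{-1}}\sigma(F_\alpha)-\sigma(F_{\alpha'})$
(`connection_d_apply`). In $G$ the same lemma gives $F_{\alpha'}=\mathrm{Ad}_{q(k)^{-1}}F_\alpha$.
The last difference is therefore a value of the group cocycle $Z_\sigma$, and this is exactly how
the reduced splitting changes from $b_1$ to $b_2$ (`reduced_sub_reduced_act`). So it equals
$\pi_1^*\kappa-\pi_2^*\kappa$.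

The axioms of a gerbe connection also come from $\nabla=\Theta-\sigma(\alpha')$: its values are
central, hence fixed by $\mathrm{Ad}$, and $\widehat\mu$ satisfies the product rule
`maurerCartan_mul_apply`. The analytic input is that `d` is natural and may be computed in any
parametrisation, the Maurer-Cartan equation, and the derivative of $\mathrm{Ad}$, which is itself
extracted from the Maurer-Cartan equation on $G\times G$. -/

noncomputable section

set_option linter.unusedSectionVars false

/-! ### Smooth dependence of pulled back alternating maps -/

section AlternatingSmooth

variable {E F G : Type*} [NormedAddCommGroup E] [NormedSpace ℝ E] [NormedAddCommGroup F]
  [NormedSpace ℝ F] [NormedAddCommGroup G] [NormedSpace ℝ G]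

/-- Alternatization of continuous multilinear maps as a continuous linear map. -/
def alternatizationCLM (E F : Type*) [NormedAddCommGroup E] [NormedSpace ℝ E]
    [NormedAddCommGroup F] [NormedSpace ℝ F] (n : ℕ) :
    ContinuousMultilinearMap ℝ (fun _ : Fin n => E) F →L[ℝ] E [⋀^Fin n]→L[ℝ] F :=
  LinearMap.mkContinuous
    { toFun := fun f => f.alternatization
      map_add' := map_add _
      map_smul' := fun c f => by
        ext v
        simp [ContinuousMultilinearMap.alternatization_apply_apply, Finset.smul_sum, smul_comm c] }
    (Fintype.card (Equiv.Perm (Fin n))) (fun f => by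
      refine ContinuousAlternatingMap.opNorm_le_bound _ (mul_nonneg (Nat.cast_nonneg _) (norm_nonneg _)) fun v => ?_
      simp only [LinearMap.coe_mk, AddHom.coe_mk,
        ContinuousMultilinearMap.alternatization_apply_apply]
      refine (norm_sum_le _ _).trans ?_
      rw [mul_assoc, ← nsmul_eq_mul]
      refine Finset.sum_le_card_nsmul _ _ _ fun s _ => ?_
      have h1 : ‖Equiv.Perm.sign s • f (v ∘ s)‖ = ‖f (v ∘ s)‖ := by
        rcases Int.units_eq_one_or (Equiv.Perm.sign s) with h | h <;> simp [h]
      rw [h1]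
      refine (f.le_opNorm _).trans (le_of_eq ?_)
      congr 1
      exact Equiv.prod_comp s (fun i => ‖v i‖))

theorem alternatizationCLM_apply {n : ℕ} (f : ContinuousMultilinearMap ℝ (fun _ : Fin n => E) F) :
    alternatizationCLM E F n f = f.alternatization := rfl

/-- On a map that is already alternating all $n!$ signed permutations agree. Hence alternatization
divided by $n!$ is a continuous linear left inverse of forgetting alternation. -/
theorem alternatizationCLM_coe {n : ℕ} (f : E [⋀^Fin n]→L[ℝ] F) :
    alternatizationCLM E F n f.toContinuousMultilinearMap = (n.factorial : ℝ) • f := by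
  rw [alternatizationCLM_apply]
  ext v
  have h := congrArg (fun g : E [⋀^Fin n]→ₗ[ℝ] F => g v)
    (AlternatingMap.coe_alternatization f.toAlternatingMap)
  rw [ContinuousMultilinearMap.alternatization_apply_apply]
  simp only [MultilinearMap.alternatization_apply, Fintype.card_fin] at h
  rw [← Nat.cast_smul_eq_nsmul ℝ] at h
  exact h

/-- For multilinear maps, composition is linear in `f` and multilinear in the copies of `g`, so it
is smooth. The alternating case passes through the multilinear one and returns by alternatization
divided by $n!$. -/
theorem ContDiffAt.continuousAlternatingMap_compContinuousLinearMap {n : ℕ} {r : WithTop ℕ∞}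
    {f : E → F [⋀^Fin n]→L[ℝ] G} {E' : Type*} [NormedAddCommGroup E'] [NormedSpace ℝ E']
    {g : E → E' →L[ℝ] F} {x : E} (hf : ContDiffAt ℝ r f x) (hg : ContDiffAt ℝ r g x) :
    ContDiffAt ℝ r (fun y => (f y).compContinuousLinearMap (g y)) x := by
  have h1 : ContDiffAt ℝ r (fun y =>
      ContinuousMultilinearMap.compContinuousLinearMapContinuousMultilinear ℝ
        (fun _ : Fin n => E') (fun _ => F) G (fun _ => g y)) x :=
    (ContinuousMultilinearMap.contDiff _).contDiffAt.comp x (contDiffAt_pi.2 fun _ => hg)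
  have h2 : ContDiffAt ℝ r (fun y => (f y).toContinuousMultilinearMap) x :=
    (ContinuousAlternatingMap.toContinuousMultilinearMapCLM (𝕜 := ℝ) (E := F) (F := G)
      (ι := Fin n) ℝ).contDiff.contDiffAt.comp x hf
  have h3 := ((alternatizationCLM E' G n).contDiff (n := r)).contDiffAt.comp x (h1.clm_apply h2)
  have h4 := h3.const_smul ((n.factorial : ℝ)⁻¹)
  convert h4 using 1
  funext y
  have e := alternatizationCLM_coe ((f y).compContinuousLinearMap (g y))
  have e' : alternatizationCLM E' G n
      ((f y).compContinuousLinearMap (g y)).toContinuousMultilinearMap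
      = ((alternatizationCLM E' G n) ∘ fun y =>
        (ContinuousMultilinearMap.compContinuousLinearMapContinuousMultilinear ℝ
          (fun _ : Fin n => E') (fun _ => F) G fun _ => g y)
            (f y).toContinuousMultilinearMap) y := rfl
  change _ = ((n.factorial : ℝ)⁻¹) • _
  rw [← e', e, smul_smul, inv_mul_cancel₀ (by positivity), one_smul]

end AlternatingSmooth

/-! ### Forms read in arbitrary parametrisations -/

section Forms

variable {E H : Type*} [NormedAddCommGroup E] [NormedSpace ℝ E] [TopologicalSpace H]
  {I : ModelWithCorners ℝ E H}
  {E' H' : Type*} [NormedAddCommGroup E'] [NormedSpace ℝ E'] [TopologicalSpace H']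
  {I' : ModelWithCorners ℝ E' H'}
  {M : Type*} [TopologicalSpace M] [ChartedSpace H M]
  {M' : Type*} [TopologicalSpace M'] [ChartedSpace H' M']
  {F : Type*} [NormedAddCommGroup F] [NormedSpace ℝ F]
  {F' : Type*} [NormedAddCommGroup F'] [NormedSpace ℝ F']
  {F'' : Type*} [NormedAddCommGroup F''] [NormedSpace ℝ F'']
  {E₀ : Type*} [NormedAddCommGroup E₀] [NormedSpace ℝ E₀]
  {E₁ : Type*} [NormedAddCommGroup E₁] [NormedSpace ℝ E₁]
  {n : ℕ}

namespace DForm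

/-- The pull-back of a form along a map from a normed space. -/
def coordRep (f : E₀ → M) (η : DForm I M F n) : E₀ → E₀ [⋀^Fin n]→L[ℝ] F :=
  fun y => (η (f y)).compContinuousLinearMap (mfderiv 𝓘(ℝ, E₀) I f y)

theorem inChart_eq_coordRep (η : DForm I M F n) (x : M) :
    η.inChart x = coordRep (extChartAt I x).symm η := rfl

theorem coordRep_apply (f : E₀ → M) (η : DForm I M F n) (y : E₀) (v : Fin n → E₀) :
    coordRep f η y v = η (f y) (fun i => mfderiv 𝓘(ℝ, E₀) I f y (v i)) := rfl

theorem coordRep_congr {f g : E₀ → M} (η : DForm I M F n) {y : E₀} (h : f =ᶠ[𝓝 y] g) :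
    coordRep f η =ᶠ[𝓝 y] coordRep g η := by
  filter_upwards [h.eventuallyEq_nhds] with z hz
  ext v
  rw [coordRep_apply, coordRep_apply, hz.mfderiv_eq, hz.self_of_nhds]

theorem coordRep_comp {f : E₀ → M} {g : E₁ → E₀} (η : DForm I M F n) {y : E₁}
    (hf : MDifferentiableAt 𝓘(ℝ, E₀) I f (g y)) (hg : DifferentiableAt ℝ g y) :
    coordRep (f ∘ g) η y = (coordRep f η (g y)).compContinuousLinearMap (fderiv ℝ g y) := by
  ext v
  rw [coordRep_apply, mfderiv_comp y hf hg.mdifferentiableAt, mfderiv_eq_fderiv]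
  rfl

theorem coordRep_pullback {f : E₀ → M} {h : M → M'} (η : DForm I' M' F n) {y : E₀}
    (hh : MDifferentiableAt I I' h (f y)) (hf : MDifferentiableAt 𝓘(ℝ, E₀) I f y) :
    coordRep f (pullback I I' h η) y = coordRep (h ∘ f) η y := by
  ext v
  rw [coordRep_apply, coordRep_apply, mfderiv_comp y hh hf]
  rfl

section
variable [I.Boundaryless] [IsManifold I ∞ M]

theorem contMDiffAt_extChartAt_symm {x : M} {y : E} (hy : y ∈ (extChartAt I x).target) :
    ContMDiffAt 𝓘(ℝ, E) I ∞ (extChartAt I x).symm y :=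
  (contMDiffOn_extChartAt_symm x).contMDiffAt ((isOpen_extChartAt_target x).mem_nhds hy)

theorem mdifferentiableAt_extChartAt_symm {x : M} {y : E} (hy : y ∈ (extChartAt I x).target) :
    MDifferentiableAt 𝓘(ℝ, E) I (extChartAt I x).symm y :=
  (contMDiffAt_extChartAt_symm hy).mdifferentiableAt (by simp)

theorem Smooth.contDiffAt_inChart {η : DForm I M F n} (h : η.Smooth) {x : M} {y : E}
    (hy : y ∈ (extChartAt I x).target) : ContDiffAt ℝ ∞ (η.inChart x) y :=
  (h x).contDiffAt ((isOpen_extChartAt_target x).mem_nhds hy)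

/-- Locally, a map from a normed space factors through a chart. -/
theorem eventuallyEq_extChartAt_comp {f : E₀ → M} {y : E₀} (hf : ContinuousAt f y) :
    (extChartAt I (f y)).symm ∘ (extChartAt I (f y) ∘ f) =ᶠ[𝓝 y] f := by
  filter_upwards [hf.preimage_mem_nhds (extChartAt_source_mem_nhds (I := I) (f y))] with z hz
  exact (extChartAt I (f y)).left_inv hz

theorem contDiffAt_extChartAt_comp {f : E₀ → M} {y : E₀} (hf : ContMDiffAt 𝓘(ℝ, E₀) I ∞ f y) :
    ContDiffAt ℝ ∞ (extChartAt I (f y) ∘ f) y :=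
  ((contMDiffAt_extChartAt (n := ∞)).comp y hf).contDiffAt

/-- Near `y` the map `f` factors through the chart at `f y`. A form along `f` thus becomes a
pull-back between normed spaces, where ordinary calculus applies. -/
theorem coordRep_eventuallyEq {f : E₀ → M} {y : E₀} (hf : ContMDiffAt 𝓘(ℝ, E₀) I ∞ f y)
    (η : DForm I M F n) :
    coordRep f η =ᶠ[𝓝 y] fun z =>
      (η.inChart (f y) ((extChartAt I (f y) ∘ f) z)).compContinuousLinearMap
        (fderiv ℝ (extChartAt I (f y) ∘ f) z) := by
  have hg := contDiffAt_extChartAt_comp hf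
  have h1 := coordRep_congr η (eventuallyEq_extChartAt_comp (I := I) hf.continuousAt)
  have h2 : ∀ᶠ z in 𝓝 y, (extChartAt I (f y) ∘ f) z ∈ (extChartAt I (f y)).target :=
    hg.continuousAt.preimage_mem_nhds
      ((isOpen_extChartAt_target (f y)).mem_nhds (mem_extChartAt_target (f y)))
  have h3 : ∀ᶠ z in 𝓝 y, DifferentiableAt ℝ (extChartAt I (f y) ∘ f) z := by
    filter_upwards [(hg.of_le (m := 1) (by simp)).eventually (by simp)] with z hz
    exact hz.differentiableAt (by simp)
  filter_upwards [h1, h2, h3] with z hz1 hz2 hz3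
  rw [← hz1, coordRep_comp η (mdifferentiableAt_extChartAt_symm hz2) hz3]
  rfl

theorem Smooth.contDiffAt_coordRep {η : DForm I M F n} (h : η.Smooth) {f : E₀ → M} {y : E₀}
    (hf : ContMDiffAt 𝓘(ℝ, E₀) I ∞ f y) : ContDiffAt ℝ ∞ (coordRep f η) y := by
  have hg := contDiffAt_extChartAt_comp hf
  refine ContDiffAt.congr_of_eventuallyEq ?_ (coordRep_eventuallyEq hf η)
  refine ContDiffAt.continuousAlternatingMap_compContinuousLinearMap ?_ ?_
  · exact ContDiffAt.comp y (h.contDiffAt_inChart (mem_extChartAt_target (f y))) hg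
  · exact hg.fderiv_right (by simp)

/-- `d` is defined with a different chart at every point; this shows that any smooth parametrisation
computes it. The reason is the naturality of `extDeriv` under the local expression of `f` in the
chart at `f y`. -/
theorem Smooth.extDeriv_coordRep {η : DForm I M F n} (h : η.Smooth) {f : E₀ → M} {y : E₀}
    (hf : ContMDiffAt 𝓘(ℝ, E₀) I ∞ f y) :
    extDeriv (coordRep f η) y =
      (η.d (f y)).compContinuousLinearMap (mfderiv 𝓘(ℝ, E₀) I f y) := by
  have hg := contDiffAt_extChartAt_comp hf
  rw [(coordRep_eventuallyEq hf η).extDeriv_eq]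
  rw [extDeriv_pullback (r := ∞) (f := extChartAt I (f y) ∘ f)
    ((h.contDiffAt_inChart (mem_extChartAt_target (f y))).differentiableAt (by simp)) hg
    (by rw [minSmoothness_of_isRCLikeNormedField]; exact WithTop.coe_le_coe.2 le_top)]
  ext v
  have e : fderiv ℝ (extChartAt I (f y) ∘ f) y
      = (mfderiv I 𝓘(ℝ, E) (extChartAt I (f y)) (f y)).comp (mfderiv 𝓘(ℝ, E₀) I f y) := by
    rw [← mfderiv_eq_fderiv, mfderiv_comp y (mdifferentiableAt_extChartAt (mem_chart_source H _))
      (hf.mdifferentiableAt (by simp))]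
  rw [e]
  rfl

theorem mfderiv_extChartAt_symm_comp {x : M} :
    (mfderiv 𝓘(ℝ, E) I (extChartAt I x).symm (extChartAt I x x)).comp
      (mfderiv I 𝓘(ℝ, E) (extChartAt I x) x) = ContinuousLinearMap.id ℝ (TangentSpace I x) := by
  have h := mfderiv_comp x (I' := 𝓘(ℝ, E))
    (mdifferentiableAt_extChartAt_symm (mem_extChartAt_target x))
    (mdifferentiableAt_extChartAt (I := I) (mem_chart_source H x))
  rw [← h]
  have e : (extChartAt I x).symm ∘ extChartAt I x =ᶠ[𝓝 x] id := by
    filter_upwards [extChartAt_source_mem_nhds (I := I) x] with z hz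
    exact (extChartAt I x).left_inv hz
  rw [e.mfderiv_eq, mfderiv_id]

end

theorem smooth_of_contDiffAt [I.Boundaryless] {η : DForm I M F n}
    (h : ∀ (x : M), ∀ y ∈ (extChartAt I x).target, ContDiffAt ℝ ∞ (coordRep (extChartAt I x).symm η) y) :
    η.Smooth := fun x y hy => (h x y hy).contDiffWithinAt

end DForm
end Forms

/-- The Leibniz rule $d(T\eta)=dT\wedge\eta+T\,d\eta$, from the derivative of the bilinear
evaluation followed by alternatization. -/
theorem extDeriv_clm_apply {E F F' : Type*} [NormedAddCommGroup E] [NormedSpace ℝ E]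
    [NormedAddCommGroup F] [NormedSpace ℝ F] [NormedAddCommGroup F'] [NormedSpace ℝ F']
    {T : E → F →L[ℝ] F'} {η : E → E [⋀^Fin 1]→L[ℝ] F} {y : E} (hT : DifferentiableAt ℝ T y)
    (hη : DifferentiableAt ℝ η y) (v w : E) :
    extDeriv (fun z => ContinuousLinearMap.compContinuousAlternatingMapCLM
      ℝ E F F' (Fin 1) (T z) (η z)) y ![v, w] =
      fderiv ℝ T y v (η y fun _ => w) - fderiv ℝ T y w (η y fun _ => v)
      + T y (extDeriv η y ![v, w]) := by
  have h := ((ContinuousLinearMap.compContinuousAlternatingMapCLM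
    ℝ E F F' (Fin 1)).hasFDerivAt_of_bilinear hT.hasFDerivAt hη.hasFDerivAt).fderiv
  have e0 : Fin.removeNth 0 ![v, w] = fun _ => w := by funext i; fin_cases i; rfl
  have e1 : Fin.removeNth 1 ![v, w] = fun _ => v := by funext i; fin_cases i; rfl
  rw [extDeriv, extDeriv, h, ContinuousAlternatingMap.alternatizeUncurryFin_apply,
    ContinuousAlternatingMap.alternatizeUncurryFin_apply, Fin.sum_univ_two, Fin.sum_univ_two]
  simp only [e0, e1]
  simp
  abel

/-! ### Calculus of forms: smoothness, naturality of `d`, operator coefficients -/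

section Forms

variable {E H : Type*} [NormedAddCommGroup E] [NormedSpace ℝ E] [TopologicalSpace H]
  {I : ModelWithCorners ℝ E H}
  {E' H' : Type*} [NormedAddCommGroup E'] [NormedSpace ℝ E'] [TopologicalSpace H']
  {I' : ModelWithCorners ℝ E' H'}
  {M : Type*} [TopologicalSpace M] [ChartedSpace H M]
  {M' : Type*} [TopologicalSpace M'] [ChartedSpace H' M']
  {F : Type*} [NormedAddCommGroup F] [NormedSpace ℝ F]
  {F' : Type*} [NormedAddCommGroup F'] [NormedSpace ℝ F']
  {F'' : Type*} [NormedAddCommGroup F''] [NormedSpace ℝ F'']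
  {E₀ : Type*} [NormedAddCommGroup E₀] [NormedSpace ℝ E₀]
  {E₁ : Type*} [NormedAddCommGroup E₁] [NormedSpace ℝ E₁]
  {n : ℕ}

namespace DForm

theorem ext_pair {η η' : DForm I M F 2} (h : ∀ (x : M) (v w : TangentSpace I x),
    η x ![v, w] = η' x ![v, w]) : η = η' := by
  funext x
  ext v
  have e : v = ![v 0, v 1] := by funext i; fin_cases i <;> rfl
  rw [e]
  exact h x _ _

theorem ext_toCLM {η η' : DForm I M F 1} (h : ∀ (x : M) (v : TangentSpace I x),
    η.toCLM x v = η'.toCLM x v) : η = η' := by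
  funext x
  ext v
  have e : v = fun _ => v 0 := by funext i; fin_cases i; rfl
  rw [e]
  exact h x _

theorem toCLM_pullback (f : M → M') (η : DForm I' M' F 1) (x : M) (v : TangentSpace I x) :
    (pullback I I' f η).toCLM x v = η.toCLM (f x) (mfderiv I I' f x v) := rfl

theorem pullback_apply (f : M → M') (η : DForm I' M' F 2) (x : M) (v w : TangentSpace I x) :
    pullback I I' f η x ![v, w] = η (f x) ![mfderiv I I' f x v, mfderiv I I' f x w] := by
  change η (f x) _ = _
  congr 1
  funext i
  fin_cases i <;> rfl

theorem toCLM_mapVal (T : F →L[ℝ] F') (η : DForm I M F 1) (x : M) (v : TangentSpace I x) :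
    (mapVal T η).toCLM x v = T (η.toCLM x v) := rfl

theorem mapVal_apply (T : F →L[ℝ] F') (η : DForm I M F n) (x : M) (v : Fin n → TangentSpace I x) :
    mapVal T η x v = T (η x v) := rfl

/-- An operator valued function applied to a form. -/
def opApply (T : M → F →L[ℝ] F') (η : DForm I M F n) : DForm I M F' n :=
  fun x => (T x).compContinuousAlternatingMap (η x)

/-- The differential of a vector valued function. -/
def fnDeriv (T : M → F) (x : M) : TangentSpace I x →L[ℝ] F := mfderiv I 𝓘(ℝ, F) T x

theorem coordRep_opApply (T : M → F →L[ℝ] F') (η : DForm I M F n) (f : E₀ → M) :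
    coordRep f (opApply T η) = fun y => ContinuousLinearMap.compContinuousAlternatingMapCLM
      ℝ E₀ F F' (Fin n) (T (f y)) (coordRep f η y) := rfl

theorem pullback_comp {M'' : Type*} {E'' H'' : Type*} [NormedAddCommGroup E''] [NormedSpace ℝ E'']
    [TopologicalSpace H''] {I'' : ModelWithCorners ℝ E'' H''} [TopologicalSpace M'']
    [ChartedSpace H'' M''] {g : M' → M''} {f : M → M'} (hg : MDifferentiable I' I'' g)
    (hf : MDifferentiable I I' f) (η : DForm I'' M'' F n) :
    pullback I I' f (pullback I' I'' g η) = pullback I I'' (g ∘ f) η := by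
  funext x
  ext v
  change _ = η _ (fun i => mfderiv I I'' (g ∘ f) x (v i))
  rw [mfderiv_comp x (hg _) (hf _)]
  rfl

theorem Smooth.add {η η' : DForm I M F n} (h : η.Smooth) (h' : η'.Smooth) : (η + η').Smooth :=
  fun x => (h x).add (h' x)

theorem Smooth.sub {η η' : DForm I M F n} (h : η.Smooth) (h' : η'.Smooth) : (η - η').Smooth :=
  fun x => (h x).sub (h' x)

theorem Smooth.neg {η : DForm I M F n} (h : η.Smooth) : (-η).Smooth :=
  fun x => (h x).neg

theorem Smooth.smul (c : ℝ) {η : DForm I M F n} (h : η.Smooth) : (c • η).Smooth :=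
  fun x => (h x).const_smul c

theorem Smooth.opApply [IsManifold I ∞ M] {T : M → F →L[ℝ] F'}
    (hT : ContMDiff I 𝓘(ℝ, F →L[ℝ] F') ∞ T) {η : DForm I M F n} (h : η.Smooth) :
    (opApply T η).Smooth := by
  intro x
  rw [inChart_eq_coordRep, coordRep_opApply]
  have h1 : ContDiffOn ℝ ∞ (fun y => T ((extChartAt I x).symm y)) (extChartAt I x).target :=
    contMDiffOn_iff_contDiffOn.1 (hT.comp_contMDiffOn (contMDiffOn_extChartAt_symm x))
  exact ((ContinuousLinearMap.compContinuousAlternatingMapCLM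
    ℝ E F F' (Fin n)).contDiff.comp_contDiffOn h1).clm_apply (h x)

theorem Smooth.mapVal (T : F →L[ℝ] F') {η : DForm I M F n} (h : η.Smooth) :
    (mapVal T η).Smooth := fun x =>
  (ContinuousLinearMap.compContinuousAlternatingMapCLM
    ℝ E F F' (Fin n) T).contDiff.comp_contDiffOn (h x)

/-- The wedge is the alternatization of $v\mapsto(w\mapsto\beta(\alpha v,\alpha' w))$. Written with
continuous linear operations and compositions only, its smoothness can be read off. -/
theorem inChart_wedge (β : F →L[ℝ] F' →L[ℝ] F'') (α : DForm I M F 1) (α' : DForm I M F' 1)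
    (x : M) :
    (wedge β α α').inChart x = fun y => ContinuousAlternatingMap.alternatizeUncurryFinCLM ℝ E F''
      (((ContinuousAlternatingMap.ofSubsingletonLIE (𝕜 := ℝ) (E := E) (F := F'') (0 : Fin 1) :
        (E →L[ℝ] F'') →L[ℝ] _)).comp
        (((ContinuousLinearMap.compL ℝ E F' F'').flip
          ((ContinuousAlternatingMap.ofSubsingletonLIE (𝕜 := ℝ) (0 : Fin 1)).symm
            (α'.inChart x y))).comp (β.comp
          ((ContinuousAlternatingMap.ofSubsingletonLIE (𝕜 := ℝ) (0 : Fin 1)).symm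
            (α.inChart x y))))) := by
  funext y
  ext v
  change _ = ContinuousAlternatingMap.alternatizeUncurryFin _ v
  rw [ContinuousAlternatingMap.alternatizeUncurryFin_apply, Fin.sum_univ_two]
  have e0 : Fin.tail v 0 = v 1 := rfl
  have e1 : Fin.removeNth 1 v 0 = v 0 := rfl
  simp [e0, e1]
  rw [← sub_eq_add_neg]
  rfl

theorem Smooth.wedge (β : F →L[ℝ] F' →L[ℝ] F'') {α : DForm I M F 1} {α' : DForm I M F' 1}
    (h : α.Smooth) (h' : α'.Smooth) : (wedge β α α').Smooth := by
  intro x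
  rw [inChart_wedge]
  have hc : ContDiff ℝ ∞ (fun f : E →L[ℝ] E [⋀^Fin 1]→L[ℝ] F'' =>
      ContinuousAlternatingMap.alternatizeUncurryFinCLM ℝ E F'' f) :=
    ContinuousLinearMap.contDiff _
  refine hc.comp_contDiffOn ?_
  refine contDiffOn_const.clm_comp (ContDiffOn.clm_comp ?_ (contDiffOn_const.clm_comp ?_))
  · have hc' : ContDiff ℝ ∞ (fun f : E →L[ℝ] F' => (ContinuousLinearMap.compL ℝ E F' F'').flip f) :=
      ContinuousLinearMap.contDiff _
    exact hc'.comp_contDiffOn ((LinearIsometryEquiv.contDiff _).comp_contDiffOn (h' x))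
  · exact (LinearIsometryEquiv.contDiff _).comp_contDiffOn (h x)

section
variable [I.Boundaryless] [IsManifold I ∞ M] [I'.Boundaryless] [IsManifold I' ∞ M']

theorem Smooth.d {η : DForm I M F n} (h : η.Smooth) : η.d.Smooth := by
  refine smooth_of_contDiffAt fun x y hy => ?_
  -- Although `η.d` uses a new chart at each point, on the domain of one chart it is the exterior
  -- derivative of a single expression.
  have e : coordRep (extChartAt I x).symm η.d =ᶠ[𝓝 y]
      extDeriv (coordRep (extChartAt I x).symm η) := by
    filter_upwards [(isOpen_extChartAt_target x).mem_nhds hy] with z hz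
    exact (h.extDeriv_coordRep (contMDiffAt_extChartAt_symm hz)).symm
  refine ContDiffAt.congr_of_eventuallyEq ?_ e
  exact (ContinuousAlternatingMap.alternatizeUncurryFinCLM ℝ E F).contDiff.contDiffAt.comp y
    ((h.contDiffAt_inChart hy).fderiv_right (m := ∞) (by simp))

theorem Smooth.pullback {η : DForm I' M' F n} (h : η.Smooth) {f : M → M'}
    (hf : ContMDiff I I' ∞ f) : (pullback I I' f η).Smooth := by
  refine smooth_of_contDiffAt fun x y hy => ?_
  have e : coordRep (extChartAt I x).symm (DForm.pullback I I' f η) =ᶠ[𝓝 y]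
      coordRep (f ∘ (extChartAt I x).symm) η := by
    filter_upwards [(isOpen_extChartAt_target x).mem_nhds hy] with z hz
    exact coordRep_pullback η (hf.mdifferentiable (by simp) _) (mdifferentiableAt_extChartAt_symm hz)
  exact (h.contDiffAt_coordRep ((hf _).comp y (contMDiffAt_extChartAt_symm hy))).congr_of_eventuallyEq e

/-- In the chart at `x` the pulled back form is `η` along `f ∘ (extChartAt I x).symm`, and
`extDeriv_coordRep` computes its exterior derivative from `η.d`. -/
theorem Smooth.d_pullback {η : DForm I' M' F n} (h : η.Smooth) {f : M → M'}
    (hf : ContMDiff I I' ∞ f) : (DForm.pullback I I' f η).d = DForm.pullback I I' f η.d := by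
  funext x
  have hy := mem_extChartAt_target (I := I) x
  have e : coordRep (extChartAt I x).symm (DForm.pullback I I' f η) =ᶠ[𝓝 (extChartAt I x x)]
      coordRep (f ∘ (extChartAt I x).symm) η := by
    filter_upwards [(isOpen_extChartAt_target x).mem_nhds hy] with z hz
    exact coordRep_pullback η (hf.mdifferentiable (by simp) _) (mdifferentiableAt_extChartAt_symm hz)
  have h1 : extDeriv ((DForm.pullback I I' f η).inChart x) (extChartAt I x x) = _ :=
    e.extDeriv_eq.trans
      (h.extDeriv_coordRep ((hf _).comp _ (contMDiffAt_extChartAt_symm hy)))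
  ext v
  change extDeriv ((DForm.pullback I I' f η).inChart x) (extChartAt I x x)
    (fun i => mfderiv I 𝓘(ℝ, E) (extChartAt I x) x (v i)) = _
  rw [h1, mfderiv_comp _ (hf.mdifferentiable (by simp) _) (mdifferentiableAt_extChartAt_symm hy)]
  have h2 : ∀ u : TangentSpace I x, mfderiv 𝓘(ℝ, E) I (extChartAt I x).symm (extChartAt I x x)
      (mfderiv I 𝓘(ℝ, E) (extChartAt I x) x u) = u := fun u =>
    congrArg (fun T : TangentSpace I x →L[ℝ] TangentSpace I x => T u) mfderiv_extChartAt_symm_comp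
  have h3 : (extChartAt I x).symm (extChartAt I x x) = x := extChartAt_to_inv x
  change η.d (f ((extChartAt I x).symm (extChartAt I x x))) (fun i => mfderiv I I' f
    ((extChartAt I x).symm (extChartAt I x x)) (mfderiv 𝓘(ℝ, E) I (extChartAt I x).symm
      (extChartAt I x x) (mfderiv I 𝓘(ℝ, E) (extChartAt I x) x (v i)))) = 
        η.d (f x) (fun i => mfderiv I I' f x (v i))
  simp only [h2]
  rw [h3]

theorem Smooth.d_add {η η' : DForm I M F n} (h : η.Smooth) (h' : η'.Smooth) :
    (η + η').d = η.d + η'.d := by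
  funext x
  have hy := mem_extChartAt_target (I := I) x
  have := extDeriv_add ((h.contDiffAt_inChart hy).differentiableAt (by simp))
    ((h'.contDiffAt_inChart hy).differentiableAt (by simp))
  change (extDeriv (η.inChart x + η'.inChart x) _).compContinuousLinearMap _ = _
  rw [this]
  rfl

theorem Smooth.d_mapVal (T : F →L[ℝ] F') {η : DForm I M F n} (h : η.Smooth) :
    (DForm.mapVal T η).d = DForm.mapVal T η.d := by
  funext x
  have hy := mem_extChartAt_target (I := I) x
  have h1 := ((h.contDiffAt_inChart hy).differentiableAt (by simp)).hasFDerivAt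
  have h2 := ((ContinuousLinearMap.compContinuousAlternatingMapCLM
    ℝ E F F' (Fin n) T).hasFDerivAt.comp _ h1).fderiv
  ext v
  change ContinuousAlternatingMap.alternatizeUncurryFin (fderiv ℝ
    ((ContinuousLinearMap.compContinuousAlternatingMapCLM ℝ E F F' (Fin n) T) ∘ η.inChart x) _) _
    = T (ContinuousAlternatingMap.alternatizeUncurryFin _ _)
  rw [h2]
  simp [ContinuousAlternatingMap.alternatizeUncurryFin_apply]

theorem Smooth.d_neg {η : DForm I M F n} (h : η.Smooth) : (-η).d = -η.d := by
  have e : ∀ {m : ℕ} (η : DForm I M F m), -η = DForm.mapVal (-ContinuousLinearMap.id ℝ F) η :=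
    fun _ => rfl
  rw [e, h.d_mapVal, e]

theorem Smooth.d_sub {η η' : DForm I M F n} (h : η.Smooth) (h' : η'.Smooth) :
    (η - η').d = η.d - η'.d := by
  rw [sub_eq_add_neg, h.d_add h'.neg, h'.d_neg, ← sub_eq_add_neg]

theorem d_apply_pair (η : DForm I M F 1) (x : M) (v w : TangentSpace I x) :
    η.d x ![v, w] = extDeriv (η.inChart x) (extChartAt I x x)
      ![mfderiv I 𝓘(ℝ, E) (extChartAt I x) x v, mfderiv I 𝓘(ℝ, E) (extChartAt I x) x w] := by
  change extDeriv (η.inChart x) (extChartAt I x x)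
    (fun i => mfderiv I 𝓘(ℝ, E) (extChartAt I x) x (![v, w] i)) = _
  congr 1
  funext i
  fin_cases i <;> rfl

/-- This is `extDeriv_clm_apply` in the chart at `x`; the derivatives of the chart and of its
inverse cancel on tangent vectors at `x`. -/
theorem Smooth.d_opApply {T : M → F →L[ℝ] F'} (hT : ContMDiff I 𝓘(ℝ, F →L[ℝ] F') ∞ T)
    {α : DForm I M F 1} (h : α.Smooth) (x : M) (v w : TangentSpace I x) :
    (DForm.opApply T α).d x ![v, w] =
      fnDeriv T x v (α.toCLM x w) - fnDeriv T x w (α.toCLM x v)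
      + T x (α.d x ![v, w]) := by
  have hy := mem_extChartAt_target (I := I) x
  set y := extChartAt I x x with hy_def
  have h1 := ((h.contDiffAt_inChart hy).differentiableAt (by simp)).hasFDerivAt
  have hTy : MDifferentiableAt I 𝓘(ℝ, F →L[ℝ] F') T ((extChartAt I x).symm y) :=
    hT.mdifferentiable (by simp) _
  have h2 : HasFDerivAt (fun z => T ((extChartAt I x).symm z)) (_ : E →L[ℝ] (F →L[ℝ] F')) y :=
    (hTy.hasMFDerivAt.comp y (mdifferentiableAt_extChartAt_symm hy).hasMFDerivAt).hasFDerivAt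
  have h3 := extDeriv_clm_apply h2.differentiableAt h1.differentiableAt
    (mfderiv I 𝓘(ℝ, E) (extChartAt I x) x v) (mfderiv I 𝓘(ℝ, E) (extChartAt I x) x w)
  have h4 : ∀ u : TangentSpace I x, mfderiv 𝓘(ℝ, E) I (extChartAt I x).symm y
      (mfderiv I 𝓘(ℝ, E) (extChartAt I x) x u) = u := fun u =>
    congrArg (fun T : TangentSpace I x →L[ℝ] TangentSpace I x => T u) mfderiv_extChartAt_symm_comp
  have h5 : (extChartAt I x).symm y = x := extChartAt_to_inv x
  have h6 : ∀ u : TangentSpace I x, fderiv ℝ (fun z => T ((extChartAt I x).symm z)) y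
      (mfderiv I 𝓘(ℝ, E) (extChartAt I x) x u) = fnDeriv T x u := by
    intro u
    rw [h2.fderiv]
    change mfderiv I 𝓘(ℝ, F →L[ℝ] F') T ((extChartAt I x).symm y)
      (mfderiv 𝓘(ℝ, E) I (extChartAt I x).symm y (mfderiv I 𝓘(ℝ, E) (extChartAt I x) x u)) = _
    rw [h4, h5]
    rfl
  have h7 : ∀ u : TangentSpace I x, α.inChart x y (fun _ => mfderiv I 𝓘(ℝ, E) (extChartAt I x) x u)
      = α.toCLM x u := by
    intro u
    change α ((extChartAt I x).symm y) (fun _ => mfderiv 𝓘(ℝ, E) I (extChartAt I x).symm y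
      (mfderiv I 𝓘(ℝ, E) (extChartAt I x) x u)) = _
    rw [h4, h5]
    rfl
  rw [h6, h6, h7, h7, h5] at h3
  rw [d_apply_pair, d_apply_pair]
  exact h3
end

end DForm
end Forms

/-! ### The Maurer-Cartan form: invariance, smoothness, structure equation at the identity -/

section MaurerCartan

variable {E H : Type*} [NormedAddCommGroup E] [NormedSpace ℝ E] [CompleteSpace E]
  [TopologicalSpace H] {I : ModelWithCorners ℝ E H} [I.Boundaryless]
  {G : Type*} [TopologicalSpace G] [ChartedSpace H G] [Group G] [LieGroup I ∞ G]
  {EM HM : Type*} [NormedAddCommGroup EM] [NormedSpace ℝ EM] [TopologicalSpace HM]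
  {J : ModelWithCorners ℝ EM HM}
  {M : Type*} [TopologicalSpace M] [ChartedSpace HM M]

theorem mdifferentiable_mulLeft (I : ModelWithCorners ℝ E H) {G : Type*} [TopologicalSpace G]
    [ChartedSpace H G] [Group G] [LieGroup I ∞ G] (g : G) :
    MDifferentiable I I (fun h : G => g * h) :=
  (contMDiff_mul_left (I := I) (n := ∞)).mdifferentiable (by simp)

theorem mdifferentiable_mulRight (I : ModelWithCorners ℝ E H) {G : Type*} [TopologicalSpace G]
    [ChartedSpace H G] [Group G] [LieGroup I ∞ G] (g : G) :
    MDifferentiable I I (fun h : G => h * g) :=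
  (contMDiff_mul_right (I := I) (n := ∞)).mdifferentiable (by simp)

theorem toCLM_maurerCartan (g : G) (v : TangentSpace I g) :
    (maurerCartan I G).toCLM g v = mfderiv I I (fun h : G => g⁻¹ * h) g v := rfl

theorem maurerCartan_one (v : TangentSpace I (1 : G)) : (maurerCartan I G).toCLM 1 v = v := by
  have e : (fun h : G => (1 : G)⁻¹ * h) = id := by funext h; simp
  rw [toCLM_maurerCartan, e, mfderiv_id]
  rfl

/-- The Maurer-Cartan form on the velocity of a composition. -/
theorem maurerCartan_mfderiv {f : M → G} {x : M} (hf : MDifferentiableAt J I f x)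
    (v : TangentSpace J x) : (maurerCartan I G).toCLM (f x) (mfderiv J I f x v)
      = mfderiv J I (fun y => (f x)⁻¹ * f y) x v := by
  have h := mfderiv_comp x (mdifferentiable_mulLeft I (f x)⁻¹ (f x)) hf
  exact (congrArg (fun T : TangentSpace J x →L[ℝ] E => T v) h).symm

theorem maurerCartan_mulLeft (g : G) :
    DForm.pullback I I (fun h : G => g * h) (maurerCartan I G) = maurerCartan I G := by
  refine DForm.ext_toCLM fun x v => ?_
  rw [DForm.toCLM_pullback]
  refine (maurerCartan_mfderiv (mdifferentiable_mulLeft I g x) v).trans ?_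
  have e : (fun y : G => (g * x)⁻¹ * (g * y)) = fun y => x⁻¹ * y := by funext y; group
  rw [toCLM_maurerCartan, ← e]
  rfl

theorem maurerCartan_mulInvariant (g : G) (v : TangentSpace I (1 : G)) :
    (maurerCartan I G).toCLM g (mfderiv I I (fun h : G => g * h) 1 v) = v := by
  have h := congrArg (fun η : DForm I G E 1 => η.toCLM 1 v) (maurerCartan_mulLeft (I := I) g)
  simp only [maurerCartan_one] at h
  rw [DForm.toCLM_pullback] at h
  have e : g * 1 = g := mul_one g
  rw [e] at h
  exact h

/-- Translating by the frozen value $f(y)^{-1}$ brings the velocity to the identity, where the chart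
at `1` has identity derivative. The form becomes a derivative of a map into the fixed space `E`,
which makes its dependence on `y` accessible. -/
theorem coordRep_maurerCartan_eq {f : EM → G} {y : EM} (hf : MDifferentiableAt 𝓘(ℝ, EM) I f y) :
    DForm.coordRep f (maurerCartan I G) y =
      ContinuousAlternatingMap.ofSubsingletonLIE (𝕜 := ℝ) (0 : Fin 1)
        (fderiv ℝ (fun z => extChartAt I (1 : G) ((f y)⁻¹ * f z)) y) := by
  ext v
  change (maurerCartan I G).toCLM (f y) (mfderiv 𝓘(ℝ, EM) I f y (v 0)) = fderiv ℝ _ y (v 0)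
  refine (maurerCartan_mfderiv hf _).trans ?_
  rw [← mfderiv_eq_fderiv]
  have h1 : (f y)⁻¹ * f y = 1 := inv_mul_cancel _
  have h2 : MDifferentiableAt I 𝓘(ℝ, E) (extChartAt I (1 : G)) ((f y)⁻¹ * f y) := by
    rw [h1]; exact mdifferentiableAt_extChartAt (mem_chart_source H _)
  have h3 : MDifferentiableAt 𝓘(ℝ, EM) I (fun z => (f y)⁻¹ * f z) y :=
    (mdifferentiable_mulLeft I (f y)⁻¹ (f y)).comp y hf
  have h4 := mfderiv_comp y h2 h3
  have h5 : ∀ g : G, g = 1 → ∀ u : E, (mfderiv I 𝓘(ℝ, E) (extChartAt I (1 : G)) g : E →L[ℝ] E) u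
      = u := by
    rintro g rfl u
    have : IsManifold I 1 G := IsManifold.of_le (n := ∞) (by simp)
    rw [mfderiv_extChartAt_self]
    rfl
  have h6 := congrArg (fun T : EM →L[ℝ] E => T (v 0)) h4
  exact ((h5 _ h1 _).symm.trans h6.symm)

theorem smooth_maurerCartan : (maurerCartan I G).Smooth := by
  refine DForm.smooth_of_contDiffAt fun x y hy => ?_
  set s := (extChartAt I x).symm
  have e : DForm.coordRep s (maurerCartan I G) =ᶠ[𝓝 y] fun y =>
      ContinuousAlternatingMap.ofSubsingletonLIE (𝕜 := ℝ) (0 : Fin 1)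
        (fderiv ℝ (fun z => extChartAt I (1 : G) ((s y)⁻¹ * s z)) y) := by
    filter_upwards [(isOpen_extChartAt_target x).mem_nhds hy] with z hz
    exact coordRep_maurerCartan_eq (DForm.mdifferentiableAt_extChartAt_symm hz)
  refine ContDiffAt.congr_of_eventuallyEq ?_ e
  refine (LinearIsometryEquiv.contDiff _).contDiffAt.comp y ?_
  refine ContDiffAt.fderiv (n := ∞) ?_ contDiffAt_id (by simp)
  have hs : ContMDiffAt 𝓘(ℝ, E) I ∞ s y := DForm.contMDiffAt_extChartAt_symm hy
  -- The frozen point and the differentiated point are separate variables; joint smoothness on the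
  -- diagonal suffices to differentiate in the second one with smooth dependence on the first.
  have h1 : ContMDiffAt (𝓘(ℝ, E).prod 𝓘(ℝ, E)) I ∞ (fun p : E × E => (s p.1)⁻¹ * s p.2) (y, y) :=
    (ContMDiffAt.comp (y, y) (f := Prod.fst) hs contMDiffAt_fst).inv.mul
      (ContMDiffAt.comp (y, y) (f := Prod.snd) hs contMDiffAt_snd)
  have h2 : ContMDiffAt I 𝓘(ℝ, E) ∞ (extChartAt I (1 : G)) ((s y)⁻¹ * s y) := by
    rw [inv_mul_cancel]; exact contMDiffAt_extChartAt
  have h3 := ContMDiffAt.comp (y, y) (f := fun p : E × E => (s p.1)⁻¹ * s p.2) h2 h1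
  rw [← modelWithCornersSelf_prod, chartedSpaceSelf_prod] at h3
  exact h3.contDiffAt

-- `maurerCartan` is constant on left invariant vector fields, so in
-- $d\mu(V,W)=V\mu(W)-W\mu(V)-\mu([V,W])$ only the bracket term survives.
open VectorField in
theorem d_maurerCartan_one (X Y : E) :
    (maurerCartan I G).d 1 ![X, Y] = - lieBr I G X Y := by
  have : IsManifold I 1 G := IsManifold.of_le (n := ∞) (by simp)
  have := lieGroup3 I G
  let x0 : E := extChartAt I (1 : G) 1
  let S : E → G := (extChartAt I (1 : G)).symm
  -- `A y v` is the left invariant vector field with value `v` at the identity, read in the chart at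
  -- `1`.
  let A : E → (E →L[ℝ] E) := fun y =>
    ((mfderiv[Set.range I] S y).inverse : E →L[ℝ] E).comp
      (mfderiv I I (fun h : G => S y * h) (1 : G) : E →L[ℝ] E)
  have hid : ∀ T : E →L[ℝ] E, T = ContinuousLinearMap.id ℝ E → ∀ u : E, T.inverse u = u := by
    rintro T rfl u
    rw [ContinuousLinearMap.inverse_id]
    rfl
  have hS0 : S x0 = 1 := extChartAt_to_inv 1
  have hdiff : ∀ v : E, DifferentiableAt ℝ (fun y => A y v) x0 := by
    intro v
    have h1 : MDifferentiableWithinAt I I.tangent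
        (fun g : G => (mulInvariantVectorField (I := I) (v : GroupLieAlgebra I G) g :
          TangentBundle I G)) Set.univ 1 :=
      (mdifferentiableAt_mulInvariantVectorField (I := I) (G := G) v).mdifferentiableWithinAt
    have h2 := h1.differentiableWithinAt_mpullbackWithin_vectorField
    have h3 : (extChartAt I (1 : G)).symm ⁻¹' Set.univ ∩ Set.range I = Set.univ := by
      simp [I.range_eq_univ]
    rw [h3] at h2
    have h4 : DifferentiableWithinAt ℝ (fun y => A y v) Set.univ x0 := h2
    exact differentiableWithinAt_univ.1 h4
  have hbr : lieBr I G X Y = lieBracket ℝ (fun y => A y X) (fun y => A y Y) x0 := by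
    have h3 : (extChartAt I (1 : G)).symm ⁻¹' Set.univ ∩ Set.range I = Set.univ := by
      simp [I.range_eq_univ]
    have e1 : lieBr I G X Y =
      ((mfderiv I 𝓘(ℝ, E) (extChartAt I (1 : G)) (1 : G)).inverse : E →L[ℝ] E)
        (lieBracketWithin ℝ (E := E) (fun y => A y X) (fun y => A y Y)
        ((extChartAt I (1 : G)).symm ⁻¹' Set.univ ∩ Set.range I) x0) := rfl
    rw [e1, h3, lieBracketWithin_univ]
    exact hid _ mfderiv_extChartAt_self _
  have hA : ∀ y ∈ (extChartAt I (1 : G)).target, ∀ v : E,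
      (maurerCartan I G).inChart 1 y (fun _ => A y v) = v := by
    intro y hy v
    have hinv := isInvertible_mfderivWithin_extChartAt_symm (I := I) hy
    have e1 : mfderiv 𝓘(ℝ, E) I S y (A y v) = mfderiv I I (fun h : G => S y * h) (1 : G) v := by
      rw [← mfderivWithin_univ, ← I.range_eq_univ]
      exact hinv.self_apply_inverse _
    change (maurerCartan I G).toCLM (S y) (mfderiv 𝓘(ℝ, E) I S y (A y v)) = v
    rw [e1]
    exact maurerCartan_mulInvariant (S y) v
  have hA0 : ∀ v : E, A x0 v = v := by
    intro v
    have e : (fun h : G => S x0 * h) = id := by funext h; rw [hS0, one_mul]; rfl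
    change ((mfderiv[Set.range I] (extChartAt I (1 : G)).symm (extChartAt I (1 : G) 1)).inverse : E →L[ℝ] E)
      ((mfderiv I I (fun h : G => S x0 * h) (1 : G) : E →L[ℝ] E) v) = v
    rw [e, mfderiv_id]
    exact hid _ mfderivWithin_range_extChartAt_symm _
  have hy := mem_extChartAt_target (I := I) (1 : G)
  have hd : ∀ (u v : E), fderiv ℝ (fun y => (maurerCartan I G).inChart 1 y (fun _ => A y u)) x0 v
      = 0 := by
    intro u v
    have : (fun y => (maurerCartan I G).inChart 1 y (fun _ => A y u)) =ᶠ[𝓝 x0] fun _ => u := by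
      filter_upwards [(isOpen_extChartAt_target (1 : G)).mem_nhds hy] with z hz
      exact hA z hz u
    rw [this.fderiv_eq]
    simp
  have hm := ((smooth_maurerCartan (I := I) (G := G)).contDiffAt_inChart hy).differentiableAt
    (by simp)
  have key := extDeriv_apply_vectorField (V := ![fun y => A y X, fun y => A y Y]) hm
    (by intro i; fin_cases i <;> exact hdiff _)
  have e2 : (fun i => (![fun y => A y X, fun y => A y Y] : Fin 2 → E → E) i x0) = ![X, Y] := by
    funext i
    fin_cases i
    · exact hA0 X
    · exact hA0 Y
  have eX : ∀ u : E, (mfderiv I 𝓘(ℝ, E) (extChartAt I (1 : G)) (1 : G) : E →L[ℝ] E) u = u :=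
    fun u => congrArg (fun T : E →L[ℝ] E => T u) mfderiv_extChartAt_self
  have h0 : (maurerCartan I G).d 1 ![X, Y] = extDeriv ((maurerCartan I G).inChart 1) x0
      ![(mfderiv I 𝓘(ℝ, E) (extChartAt I (1 : G)) (1 : G) : E →L[ℝ] E) X,
        (mfderiv I 𝓘(ℝ, E) (extChartAt I (1 : G)) (1 : G) : E →L[ℝ] E) Y] :=
    DForm.d_apply_pair _ _ _ _
  rw [h0, eX, eX, ← e2]
  refine key.trans ?_
  rw [hbr]
  have e3 : ∀ w : E, (maurerCartan I G).inChart 1 x0 (fun _ => w) = w := by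
    intro w
    have := hA x0 hy w
    rwa [hA0] at this
  have e4 : ∀ (i : Fin 2) (w : E), fderiv ℝ (fun x => (maurerCartan I G).inChart 1 x (i.removeNth
      fun j => (![fun y => A y X, fun y => A y Y] : Fin 2 → E → E) j x)) x0 w = 0 := by
    intro i w
    fin_cases i
    · refine Eq.trans ?_ (hd Y w)
      congr 2
    · refine Eq.trans ?_ (hd X w)
      congr 2
  -- The derivative terms vanish by `e4`; the double sum of bracket terms has a single summand in
  -- degree one.
  rw [Finset.sum_eq_zero (fun i _ => by rw [e4, smul_zero]), zero_sub, neg_inj,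
    Fin.sum_univ_one]
  refine Eq.trans ?_ (e3 _)
  refine (Finset.sum_eq_single (0 : Fin 1) (fun b _ hb => (hb (Subsingleton.elim _ _)).elim)
    (fun h => (h (by simp)).elim)).trans ?_
  refine (one_smul ℤ _).trans ?_
  congr 1
  funext j
  fin_cases j
  rfl

end MaurerCartan

/-! ### The adjoint action, the structure equation everywhere, and the product rule -/

section Adjoint

variable {E H : Type*} [NormedAddCommGroup E] [NormedSpace ℝ E] [CompleteSpace E]
  [TopologicalSpace H] {I : ModelWithCorners ℝ E H} [I.Boundaryless]
  {G : Type*} [TopologicalSpace G] [ChartedSpace H G] [Group G] [LieGroup I ∞ G]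
  {EM HM : Type*} [NormedAddCommGroup EM] [NormedSpace ℝ EM] [TopologicalSpace HM]
  {J : ModelWithCorners ℝ EM HM}
  {M : Type*} [TopologicalSpace M] [ChartedSpace HM M]

/-- Left translation by $g^{-1}$ preserves the form and moves `g` to the identity, where
`d_maurerCartan_one` applies. -/
theorem d_maurerCartan (g : G) (v w : TangentSpace I g) :
    (maurerCartan I G).d g ![v, w]
      = - lieBr I G ((maurerCartan I G).toCLM g v) ((maurerCartan I G).toCLM g w) := by
  have h1 : ∀ h : G, h = 1 → ∀ X Y : E, (maurerCartan I G).d h ![X, Y] = - lieBr I G X Y := by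
    rintro h rfl X Y
    exact d_maurerCartan_one X Y
  have h2 := smooth_maurerCartan (I := I) (G := G).d_pullback
    (contMDiff_mul_left (I := I) (n := ∞) (a := g⁻¹))
  rw [maurerCartan_mulLeft] at h2
  rw [h2, DForm.pullback_apply]
  exact h1 _ (inv_mul_cancel g) _ _

theorem contMDiff_conj (g : G) : ContMDiff I I ∞ (fun h : G => g * h * g⁻¹) :=
  (contMDiff_const.mul contMDiff_id).mul contMDiff_const

/-- The base point is a variable with an equation because chain rules produce points such as
$g^{-1}g$, which equal `1` without being syntactically `1`. The same device recurs below. -/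
theorem mfderiv_conj (g : G) {h : G} (e : h = 1) (X : E) :
    mfderiv I I (fun h : G => g * h * g⁻¹) h X = lieAd I G g X := by
  subst e
  rfl

theorem lieAd_mul (g h : G) (X : E) : lieAd I G (g * h) X = lieAd I G g (lieAd I G h X) := by
  have e : (fun k : G => g * h * k * (g * h)⁻¹) = (fun k => g * k * g⁻¹) ∘ fun k => h * k * h⁻¹ := by
    funext k
    simp [mul_assoc]
  have h1 := mfderiv_comp (1 : G) ((contMDiff_conj (I := I) g).mdifferentiable (by simp) (h * 1 * h⁻¹))
    ((contMDiff_conj (I := I) h).mdifferentiable (by simp) 1)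
  rw [← e] at h1
  refine (congrArg (fun T : E →L[ℝ] E => T X) h1).trans ?_
  exact mfderiv_conj g (by simp) _

theorem mfderiv_extChartAt_one {g : G} (e : g = 1) (X : E) :
    (mfderiv I 𝓘(ℝ, E) (extChartAt I (1 : G)) g : E →L[ℝ] E) X = X := by
  subst e
  have : IsManifold I 1 G := IsManifold.of_le (n := ∞) (by simp)
  exact congrArg (fun T : E →L[ℝ] E => T X) mfderiv_extChartAt_self

/-- In the chart at `1`, $\mathrm{Ad}_g$ is the derivative at a fixed point of conjugation by `g`.
Conjugation is jointly smooth, so this derivative depends smoothly on `g` in operator norm. -/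
theorem contMDiff_lieAd : ContMDiff I 𝓘(ℝ, E →L[ℝ] E) ∞ (lieAd I G) := by
  have : IsManifold I 1 G := IsManifold.of_le (n := ∞) (by simp)
  set s := (extChartAt I (1 : G)).symm
  set x0 := extChartAt I (1 : G) 1 with hx0
  have hs0 : s x0 = 1 := extChartAt_to_inv 1
  have hs : ContMDiffAt 𝓘(ℝ, E) I ∞ s x0 :=
    DForm.contMDiffAt_extChartAt_symm (mem_extChartAt_target (1 : G))
  have e : lieAd I G = fun g => (fderiv ℝ (fun z => extChartAt I (1 : G) (g * s z * g⁻¹)) x0) := by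
    funext g
    ext X
    have h0 : g * s x0 * g⁻¹ = 1 := by rw [hs0]; group
    have h1 : MDifferentiableAt I 𝓘(ℝ, E) (extChartAt I (1 : G)) (g * s x0 * g⁻¹) := by
      rw [h0]; exact mdifferentiableAt_extChartAt (mem_chart_source H _)
    have h2 : MDifferentiableAt I I (fun h : G => g * h * g⁻¹) (s x0) :=
      (contMDiff_conj g).mdifferentiable (by simp) _
    have h3 : MDifferentiableAt 𝓘(ℝ, E) I s x0 := hs.mdifferentiableAt (by simp)
    have h4 := mfderiv_comp x0 h2 h3
    have h5 := mfderiv_comp x0 h1 (h2.comp x0 h3)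
    have h6 : (mfderiv 𝓘(ℝ, E) I s x0 : E →L[ℝ] E) X = X := by
      rw [← mfderivWithin_univ, ← I.range_eq_univ]
      exact congrArg (fun T : E →L[ℝ] E => T X) mfderivWithin_range_extChartAt_symm
    rw [← mfderiv_eq_fderiv]
    refine Eq.symm ?_
    refine (congrArg (fun T : E →L[ℝ] E => T X) h5).trans ?_
    refine (mfderiv_extChartAt_one h0 _).trans ?_
    refine (congrArg (fun T : E →L[ℝ] E => T X) h4).trans ?_
    refine (mfderiv_conj g hs0 _).trans ?_
    exact congrArg (lieAd I G g) h6
  rw [e]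
  intro g
  have h1 : ContMDiffAt (I.prod 𝓘(ℝ, E)) I ∞ (fun p : G × E => p.1 * s p.2 * p.1⁻¹) (g, x0) :=
    (contMDiffAt_fst.mul (ContMDiffAt.comp (g, x0) (f := Prod.snd) hs contMDiffAt_snd)).mul
      contMDiffAt_fst.inv
  have h2 : ContMDiffAt I 𝓘(ℝ, E) ∞ (extChartAt I (1 : G)) (g * s x0 * g⁻¹) := by
    have h0 : g * s x0 * g⁻¹ = 1 := by rw [hs0]; group
    rw [h0]; exact contMDiffAt_extChartAt
  have h3 := ContMDiffAt.mfderiv (m := ∞) (fun g z => extChartAt I (1 : G) (g * s z * g⁻¹))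
    (fun _ => x0) (ContMDiffAt.comp (g, x0) (f := fun p : G × E => p.1 * s p.2 * p.1⁻¹) h2 h1)
    contMDiffAt_const (by simp)
  simp only [mfderiv_eq_fderiv] at h3
  -- Source and target are vector spaces, so passing to tangent coordinates changes nothing.
  have h4 := inTangentCoordinates_model_space (I := 𝓘(ℝ, E)) (I' := 𝓘(ℝ, E)) (fun _ : G => x0)
    (fun g => extChartAt I (1 : G) (g * s x0 * g⁻¹))
    (fun g => fderiv ℝ (fun z => extChartAt I (1 : G) (g * s z * g⁻¹)) x0) g
  exact (congrArg (fun T => ContMDiffAt I 𝓘(ℝ, E →L[ℝ] E) ∞ T g) h4).mp h3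

theorem contMDiff_lieAd_inv : ContMDiff I 𝓘(ℝ, E →L[ℝ] E) ∞ (fun g : G => lieAd I G g⁻¹) :=
  contMDiff_lieAd.comp (contMDiff_inv I ∞)

/-- The derivative of multiplication is the sum of its two partial derivatives. Right translation by
$l$, once brought back to the identity, becomes conjugation by $l^{-1}$; left translation by $k$
disappears. -/
theorem maurerCartan_mul_apply {k l : M → G} {x : M} (hk : MDifferentiableAt J I k x)
    (hl : MDifferentiableAt J I l x) (v : TangentSpace J x) :
    (maurerCartan I G).toCLM (k x * l x) (mfderiv J I (fun y => k y * l y) x v)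
      = lieAd I G (l x)⁻¹ ((maurerCartan I G).toCLM (k x) (mfderiv J I k x v))
        + (maurerCartan I G).toCLM (l x) (mfderiv J I l x v) := by
  have hm : MDifferentiableAt (I.prod I) I (fun p : G × G => p.1 * p.2) (k x, l x) :=
    (contMDiff_mul I ∞).mdifferentiable (by simp) _
  have h1 := mfderiv_comp x hm (hk.prodMk hl)
  have h2 : mfderiv J I (fun y => k y * l y) x v =
      mfderiv I I (fun h : G => h * l x) (k x) (mfderiv J I k x v)
      + mfderiv I I (fun h : G => k x * h) (l x) (mfderiv J I l x v) := by
    refine (congrArg (fun T : TangentSpace J x →L[ℝ] E => T v) h1).trans ?_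
    rw [mfderiv_prodMk hk hl]
    exact mfderiv_prod_eq_add_apply hm
  rw [h2, map_add]
  congr 1
  · refine (maurerCartan_mfderiv (mdifferentiable_mulRight I (l x) (k x)) _).trans ?_
    have e : (fun y : G => (k x * l x)⁻¹ * (y * l x))
        = (fun h => (l x)⁻¹ * h * (l x)⁻¹⁻¹) ∘ fun y => (k x)⁻¹ * y := by
      funext y
      simp [mul_assoc]
    rw [e]
    refine (congrArg (fun T : E →L[ℝ] E => T _) (mfderiv_comp (k x)
      ((contMDiff_conj (I := I) (l x)⁻¹).mdifferentiable (by simp) _)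
      (mdifferentiable_mulLeft I (k x)⁻¹ (k x)))).trans ?_
    exact mfderiv_conj _ (inv_mul_cancel _) _
  · refine (maurerCartan_mfderiv (mdifferentiable_mulLeft I (k x) (l x)) _).trans ?_
    have e : (fun y : G => (k x * l x)⁻¹ * (k x * y)) = fun y => (l x)⁻¹ * y := by
      funext y
      group
    rw [e]
    rfl

theorem maurerCartan_mul {k l : M → G} (hk : MDifferentiable J I k) (hl : MDifferentiable J I l) :
    DForm.pullback J I (fun x => k x * l x) (maurerCartan I G)
      = DForm.opApply (fun x => lieAd I G (l x)⁻¹) (DForm.pullback J I k (maurerCartan I G))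
        + DForm.pullback J I l (maurerCartan I G) :=
  DForm.ext_toCLM fun x v => maurerCartan_mul_apply (hk x) (hl x) v

end Adjoint

/-! ### Smooth homomorphisms and Lie brackets -/

section Homomorphism

variable {E H : Type*} [NormedAddCommGroup E] [NormedSpace ℝ E] [CompleteSpace E]
  [TopologicalSpace H] {I : ModelWithCorners ℝ E H} [I.Boundaryless]
  {G : Type*} [TopologicalSpace G] [ChartedSpace H G] [Group G] [LieGroup I ∞ G]
  {E' H' : Type*} [NormedAddCommGroup E'] [NormedSpace ℝ E'] [CompleteSpace E']
  [TopologicalSpace H'] {I' : ModelWithCorners ℝ E' H'} [I'.Boundaryless]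
  {G' : Type*} [TopologicalSpace G'] [ChartedSpace H' G'] [Group G'] [LieGroup I' ∞ G']

/-- A homomorphism intertwines left translations, so its derivative at any point is the one at the
identity after translation. -/
theorem maurerCartan_hom (f : G →* G') (hf : ContMDiff I I' ∞ f) {f' : E →L[ℝ] E'}
    (hf' : f' = mfderiv I I' f 1) :
    DForm.pullback I I' f (maurerCartan I' G') = DForm.mapVal f' (maurerCartan I G) := by
  refine DForm.ext_toCLM fun g v => ?_
  rw [DForm.toCLM_pullback, DForm.toCLM_mapVal]
  refine (maurerCartan_mfderiv (hf.mdifferentiable (by simp) g) v).trans ?_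
  have e : (fun y => (f g)⁻¹ * f y) = f ∘ fun y => g⁻¹ * y := by
    funext y
    simp
  rw [e]
  refine (congrArg (fun T : E →L[ℝ] E' => T v) (mfderiv_comp g (hf.mdifferentiable (by simp) _)
    (mdifferentiable_mulLeft I g⁻¹ g))).trans ?_
  have h1 : ∀ h : G, h = 1 → ∀ X : E, (mfderiv I I' f h : E →L[ℝ] E') X
      = f' X := by
    rintro h rfl X
    rw [hf']
    rfl
  exact h1 _ (inv_mul_cancel g) _

/-- The differential of a smooth homomorphism is a homomorphism of Lie algebras. -/
theorem lieBr_hom (f : G →* G') (hf : ContMDiff I I' ∞ f) {f' : E →L[ℝ] E'}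
    (hf' : f' = mfderiv I I' f 1) (X Y : E) :
    f' (lieBr I G X Y) = lieBr I' G' (f' X) (f' Y) := by
  have h := maurerCartan_hom f hf hf'
  -- Taking `d` of $f^*\mu'=f'\circ\mu$ turns both sides into brackets by the Maurer-Cartan
  -- equation; evaluation at the identity gives the claim.
  have h1 := congrArg DForm.d h
  rw [smooth_maurerCartan.d_pullback hf, smooth_maurerCartan.d_mapVal] at h1
  let v : TangentSpace I (1 : G) := X
  let w : TangentSpace I (1 : G) := Y
  have h2 := congrArg (fun η : DForm I G E' 2 => η 1 ![v, w]) h1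
  have h3 : ∀ u : TangentSpace I (1 : G), (maurerCartan I' G').toCLM (f 1) (mfderiv I I' f 1 u)
      = f' u := by
    intro u
    have := congrArg (fun η : DForm I G E' 1 => η.toCLM 1 u) h
    refine this.trans ?_
    simp only [DForm.toCLM_mapVal, maurerCartan_one]
  simp only [DForm.pullback_apply, DForm.mapVal_apply, d_maurerCartan, maurerCartan_one] at h2
  rw [h3, h3, map_neg, neg_inj] at h2
  exact h2.symm

theorem lieAd_lieBr (g : G) (X Y : E) :
    lieAd I G g (lieBr I G X Y) = lieBr I G (lieAd I G g X) (lieAd I G g Y) :=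
  lieBr_hom (MulAut.conj g).toMonoidHom (contMDiff_conj g) rfl X Y

end Homomorphism

/-! ### The derivative of the adjoint action and gauge transformations of curvature -/

section Gauge

variable {E H : Type*} [NormedAddCommGroup E] [NormedSpace ℝ E] [CompleteSpace E]
  [TopologicalSpace H] {I : ModelWithCorners ℝ E H} [I.Boundaryless]
  {G : Type*} [TopologicalSpace G] [ChartedSpace H G] [Group G] [LieGroup I ∞ G]
  {EM HM : Type*} [NormedAddCommGroup EM] [NormedSpace ℝ EM] [TopologicalSpace HM]
  {J : ModelWithCorners ℝ EM HM}
  {M : Type*} [TopologicalSpace M] [ChartedSpace HM M]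

theorem DForm.fnDeriv_comp {F : Type*} [NormedAddCommGroup F] [NormedSpace ℝ F] {T : G → F}
    {k : M → G} {x : M} (hT : MDifferentiableAt I 𝓘(ℝ, F) T (k x))
    (hk : MDifferentiableAt J I k x) (v : TangentSpace J x) :
    DForm.fnDeriv (T ∘ k) x v = DForm.fnDeriv T (k x) (mfderiv J I k x v) :=
  congrArg (fun S : TangentSpace J x →L[ℝ] F => S v) (mfderiv_comp x hT hk)

theorem lieBr_zero_left (X : E) : lieBr I G 0 X = 0 := by
  rw [← lieBrCLM_apply]
  simp

theorem lieBr_zero_right (X : E) : lieBr I G X 0 = 0 := by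
  rw [← lieBrCLM_apply]
  simp

/-- The differential of `k ↦ Ad_{k⁻¹}`. -/
theorem fnDeriv_lieAd_inv (k : G) (W : TangentSpace I k) (X : E) :
    DForm.fnDeriv (fun g : G => lieAd I G g⁻¹) k W X
      = - lieBr I G ((maurerCartan I G).toCLM k W) (lieAd I G k⁻¹ X) := by
  have hsm := smooth_maurerCartan (I := I) (G := G)
  have hmul : ContMDiff (I.prod I) I ∞ (fun p : G × G => p.1 * p.2) := contMDiff_mul I ∞
  have hfst : ContMDiff (I.prod I) I ∞ (Prod.fst : G × G → G) := contMDiff_fst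
  have hsnd : ContMDiff (I.prod I) I ∞ (Prod.snd : G × G → G) := contMDiff_snd
  have hT : ContMDiff (I.prod I) 𝓘(ℝ, E →L[ℝ] E) ∞ (fun p : G × G => lieAd I G p.2⁻¹) :=
    contMDiff_lieAd_inv.comp hsnd
  -- The product rule on $G\times G$ contains $\mathrm{Ad}_{l^{-1}}$ as a coefficient, so applying
  -- `d` to it exposes the derivative of $\mathrm{Ad}$. It is isolated by evaluating at $(1,k)$ on
  -- $(X,0)$ and $(0,W)$.
  have h1 := congrArg DForm.d (maurerCartan_mul (I := I) (hfst.mdifferentiable (by simp))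
    (hsnd.mdifferentiable (by simp)))
  rw [hsm.d_pullback hmul, ((hsm.pullback hfst).opApply hT).d_add (hsm.pullback hsnd),
    hsm.d_pullback hsnd] at h1
  let p : G × G := (1, k)
  let v : TangentSpace (I.prod I) p := ((X, 0) : E × E)
  let w : TangentSpace (I.prod I) p := ((0, W) : E × E)
  have hfv : mfderiv (I.prod I) I (Prod.fst : G × G → G) p v = X := by rw [mfderiv_fst]; rfl
  have hfw : mfderiv (I.prod I) I (Prod.fst : G × G → G) p w = (0 : E) := by rw [mfderiv_fst]; rfl
  have hsv : mfderiv (I.prod I) I (Prod.snd : G × G → G) p v = (0 : E) := by rw [mfderiv_snd]; rfl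
  have hsw : mfderiv (I.prod I) I (Prod.snd : G × G → G) p w = W := by rw [mfderiv_snd]; rfl
  have h2 := congrArg (fun η : DForm (I.prod I) (G × G) E 2 => η p ![v, w]) h1
  have hmv := maurerCartan_mul_apply (hfst.mdifferentiable (by simp) p)
    (hsnd.mdifferentiable (by simp) p) v
  have hmw := maurerCartan_mul_apply (hfst.mdifferentiable (by simp) p)
    (hsnd.mdifferentiable (by simp) p) w
  have h3 : (DForm.pullback (I.prod I) I (fun p : G × G => p.1 * p.2) (maurerCartan I G).d) p ![v, w]
      = - lieBr I G (lieAd I G k⁻¹ X) ((maurerCartan I G).toCLM k W) := by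
    rw [DForm.pullback_apply, d_maurerCartan, hmv, hmw, hfv, hfw, hsv, hsw]
    have e1 : (maurerCartan I G).toCLM p.1 X = X := maurerCartan_one X
    have e2 : (maurerCartan I G).toCLM p.1 (0 : E) = 0 := map_zero _
    have e3 : (maurerCartan I G).toCLM p.2 (0 : E) = 0 := map_zero _
    rw [e1, e2, e3, map_zero, add_zero, zero_add]
  have h4 : (DForm.pullback (I.prod I) I (Prod.snd : G × G → G) (maurerCartan I G).d) p ![v, w]
      = 0 := by
    rw [DForm.pullback_apply, d_maurerCartan, hsv]
    have e3 : (maurerCartan I G).toCLM p.2 (0 : E) = 0 := map_zero _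
    rw [e3, lieBr_zero_left, neg_zero]
  have h5 : (DForm.pullback (I.prod I) I (Prod.fst : G × G → G) (maurerCartan I G)).d p ![v, w]
      = 0 := by
    rw [hsm.d_pullback hfst, DForm.pullback_apply, d_maurerCartan, hfw]
    have e3 : (maurerCartan I G).toCLM p.1 (0 : E) = 0 := map_zero _
    rw [e3, lieBr_zero_right, neg_zero]
  have h6 : (DForm.pullback (I.prod I) I (Prod.fst : G × G → G) (maurerCartan I G)).toCLM p v
      = X := by
    rw [DForm.toCLM_pullback, hfv]
    exact maurerCartan_one X
  have h7 : (DForm.pullback (I.prod I) I (Prod.fst : G × G → G) (maurerCartan I G)).toCLM p w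
      = 0 := by
    rw [DForm.toCLM_pullback, hfw]
    exact map_zero _
  have h8 : DForm.fnDeriv (fun p : G × G => lieAd I G p.2⁻¹) p w
      = DForm.fnDeriv (fun g : G => lieAd I G g⁻¹) k W := by
    have := DForm.fnDeriv_comp (T := fun g : G => lieAd I G g⁻¹) (k := (Prod.snd : G × G → G))
      (x := p) (contMDiff_lieAd_inv.mdifferentiable (by simp) _) (hsnd.mdifferentiable (by simp) p) w
    rw [hsw] at this
    exact this
  have h9 : (DForm.opApply (fun p : G × G => lieAd I G p.2⁻¹)
      (DForm.pullback (I.prod I) I (Prod.fst : G × G → G) (maurerCartan I G))).d p ![v, w]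
      = - DForm.fnDeriv (fun g : G => lieAd I G g⁻¹) k W X := by
    rw [DForm.Smooth.d_opApply hT (hsm.pullback hfst), h5, h6, h7, h8, map_zero, map_zero, zero_sub,
      add_zero]
  -- The left side is $-[\mathrm{Ad}_{k^{-1}}X,\mu(W)]$; on the right only minus the derivative of
  -- $\mathrm{Ad}_{k^{-1}}$ along $W$, applied to $X$, survives.
  have h10 := h3.symm.trans (h2.trans (congrArg₂ (· + ·) h9 h4))
  rw [lieBr_swap I G ((maurerCartan I G).toCLM k W), neg_neg]
  have h11 := neg_inj.1 (h10.trans (add_zero _))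
  exact h11.symm

/-- Gauge transformation of the curvature: if `Θ = k^* μ + Ad_{k⁻¹} β`, then
`dΘ + ½[Θ, Θ] = Ad_{k⁻¹} (dβ + ½[β, β])`. -/
theorem gauge_curvature [J.Boundaryless] [IsManifold J ∞ M] {k : M → G} (hk : ContMDiff J I ∞ k)
    {β Θ : DForm J M E 1} (hβ : β.Smooth)
    (hΘ : Θ = DForm.pullback J I k (maurerCartan I G)
      + DForm.opApply (fun x => lieAd I G (k x)⁻¹) β) (x : M) (v w : TangentSpace J x) :
    Θ.d x ![v, w] + lieBr I G (Θ.toCLM x v) (Θ.toCLM x w)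
      = lieAd I G (k x)⁻¹ (β.d x ![v, w] + lieBr I G (β.toCLM x v) (β.toCLM x w)) := by
  have hsm := smooth_maurerCartan (I := I) (G := G)
  have hT : ContMDiff J 𝓘(ℝ, E →L[ℝ] E) ∞ (fun x => lieAd I G (k x)⁻¹) :=
    contMDiff_lieAd_inv.comp hk
  have hd : ∀ u : TangentSpace J x, ∀ X : E, DForm.fnDeriv (fun x => lieAd I G (k x)⁻¹) x u X
      = - lieBr I G ((maurerCartan I G).toCLM (k x) (mfderiv J I k x u)) (lieAd I G (k x)⁻¹ X) := by
    intro u X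
    have := DForm.fnDeriv_comp (T := fun g : G => lieAd I G g⁻¹) (k := k)
      (x := x) (contMDiff_lieAd_inv.mdifferentiable (by simp) _) (hk.mdifferentiable (by simp) x) u
    rw [← fnDeriv_lieAd_inv, ← this]
    rfl
  have hv : ∀ u : TangentSpace J x, Θ.toCLM x u
      = (maurerCartan I G).toCLM (k x) (mfderiv J I k x u) + lieAd I G (k x)⁻¹ (β.toCLM x u) := by
    intro u
    rw [hΘ]
    rfl
  have h1 : Θ.d x ![v, w] = (maurerCartan I G).d (k x) ![mfderiv J I k x v, mfderiv J I k x w]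
      + (DForm.opApply (fun x => lieAd I G (k x)⁻¹) β).d x ![v, w] := by
    rw [hΘ, (hsm.pullback hk).d_add (hβ.opApply hT), hsm.d_pullback hk, ← DForm.pullback_apply]
    rfl
  rw [h1, DForm.Smooth.d_opApply hT hβ, d_maurerCartan, hv, hv, hd, hd, map_add, lieAd_lieBr]
  simp only [← lieBrCLM_apply, map_add, add_apply]
  have h2 : ∀ X Y : E, lieBrCLM I G X Y = - lieBrCLM I G Y X := fun X Y => lieBr_swap I G X Y
  -- With this bracket reversed, everything involving $\mu$ cancels: $d\mu$ against $[\mu,\mu]$, and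
  -- the derivative of $\mathrm{Ad}$ against the mixed terms of $[\Theta,\Theta]$.
  rw [h2 (lieAd I G (k x)⁻¹ (β.toCLM x v))
    ((maurerCartan I G).toCLM (k x) (mfderiv J I k x w))]
  abel

end Gauge

/-! ### The Lie algebra of a central extension -/

section CentralExtensionFacts

variable {EG HG : Type*} [NormedAddCommGroup EG] [NormedSpace ℝ EG] [CompleteSpace EG]
  [TopologicalSpace HG] {IG : ModelWithCorners ℝ EG HG} [IG.Boundaryless]
  {G : Type*} [TopologicalSpace G] [ChartedSpace HG G] [Group G] [LieGroup IG ∞ G]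
  {EK HK : Type*} [NormedAddCommGroup EK] [NormedSpace ℝ EK] [CompleteSpace EK]
  [TopologicalSpace HK] {IK : ModelWithCorners ℝ EK HK} [IK.Boundaryless]
  {K : Type*} [TopologicalSpace K] [ChartedSpace HK K] [Group K] [LieGroup IK ∞ K]

namespace CentralExtension

variable (C : CentralExtension IG G IK K)

theorem contMDiff_q : ContMDiff IK IG ∞ C.q := C.isPrincipalBundle.contMDiff_proj

theorem mdifferentiable_q : MDifferentiable IK IG C.q := C.contMDiff_q.mdifferentiable (by simp)

theorem q_incl (u : Circle) : C.q (C.incl u) = 1 := by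
  have : C.incl u ∈ C.q.ker := by rw [C.exact]; exact ⟨u, rfl⟩
  exact this

theorem contMDiff_mul_incl (k : K) :
    ContMDiff 𝓘(ℝ, ℝ) IK ∞ (fun s : ℝ => k * C.incl (Circle.exp s)) :=
  C.isPrincipalBundle.contMDiff_act.comp (contMDiff_const.prodMk contMDiff_circleExp)

theorem contMDiff_incl_exp : ContMDiff 𝓘(ℝ, ℝ) IK ∞ (fun s : ℝ => C.incl (Circle.exp s)) := by
  simpa using C.contMDiff_mul_incl 1

theorem incl_exp_zero : C.incl (Circle.exp 0) = 1 := by simp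

theorem inclStar_eq (t : ℝ) : C.inclStar t = t • C.inclStar 1 := by
  rw [← map_smul]; simp

/-- Conjugation fixes the central curve $s\mapsto\exp(is)$ pointwise, hence its velocity. -/
theorem lieAd_inclStar (k : K) (t : ℝ) : lieAd IK K k (C.inclStar t) = C.inclStar t := by
  have e : (fun h : K => k * h * k⁻¹) ∘ (fun s : ℝ => C.incl (Circle.exp s))
      = fun s : ℝ => C.incl (Circle.exp s) := by
    funext s
    change k * C.incl (Circle.exp s) * k⁻¹ = _
    rw [← C.central, mul_inv_cancel_right]
  have h := mfderiv_comp (0 : ℝ) ((contMDiff_conj (I := IK) k).mdifferentiable (by simp) _)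
    (C.contMDiff_incl_exp.mdifferentiable (by simp) 0)
  rw [e] at h
  refine Eq.trans ?_ (congrArg (fun T : ℝ →L[ℝ] EK => T t) h).symm
  exact (mfderiv_conj k C.incl_exp_zero _).symm

theorem lieAd_incl (u : Circle) (X : EK) : lieAd IK K (C.incl u) X = X := by
  have e : (fun h : K => C.incl u * h * (C.incl u)⁻¹) = id := by
    funext h
    rw [C.central, mul_inv_cancel_right]
    rfl
  unfold lieAd
  rw [e, mfderiv_id]
  rfl

/-- The function $g\mapsto\mathrm{Ad}_{g^{-1}}$ applied to a central vector is constant, while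
`fnDeriv_lieAd_inv` gives minus this bracket as its derivative at the identity. -/
theorem lieBr_inclStar (t : ℝ) (Y : EK) : lieBr IK K Y (C.inclStar t) = 0 := by
  have hT : MDifferentiableAt IK 𝓘(ℝ, EK →L[ℝ] EK) (fun g : K => lieAd IK K g⁻¹) (1 : K) :=
    contMDiff_lieAd_inv.mdifferentiable (by simp) _
  have h1 := fnDeriv_lieAd_inv (I := IK) (1 : K) Y (C.inclStar t)
  have h0 : (maurerCartan IK K).toCLM 1 Y = Y := maurerCartan_one Y
  rw [h0, C.lieAd_inclStar] at h1
  have hL : MDifferentiableAt 𝓘(ℝ, EK →L[ℝ] EK) 𝓘(ℝ, EK)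
      (ContinuousLinearMap.apply ℝ EK (C.inclStar t)) (lieAd IK K (1 : K)⁻¹) :=
    (ContinuousLinearMap.apply ℝ EK (C.inclStar t)).differentiableAt.mdifferentiableAt
  have h2 := mfderiv_comp (f := fun g : K => lieAd IK K g⁻¹) (1 : K) hL hT
  have e : (ContinuousLinearMap.apply ℝ EK (C.inclStar t)) ∘ (fun g : K => lieAd IK K g⁻¹)
      = fun _ => C.inclStar t := by
    funext g
    exact C.lieAd_inclStar g⁻¹ t
  rw [e, mfderiv_const, mfderiv_eq_fderiv, ContinuousLinearMap.fderiv] at h2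
  have h3 := congrArg (fun T : EK →L[ℝ] EK => T Y) h2
  have h4 : (0 : EK) = DForm.fnDeriv (fun g : K => lieAd IK K g⁻¹) (1 : K) Y (C.inclStar t) := h3
  rw [← h4] at h1
  exact (neg_eq_zero.1 h1.symm)

theorem qStar_inclStar (t : ℝ) : C.qStar (C.inclStar t) = 0 := by
  have e : C.q ∘ (fun s : ℝ => C.incl (Circle.exp s)) = fun _ => 1 := by
    funext s
    exact C.q_incl _
  have h := mfderiv_comp (0 : ℝ) (C.mdifferentiable_q _)
    (C.contMDiff_incl_exp.mdifferentiable (by simp) 0)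
  rw [e, mfderiv_const] at h
  have h1 : ∀ k : K, k = 1 → ∀ X : EK, (mfderiv IK IG C.q k : EK →L[ℝ] EG) X = C.qStar X := by
    rintro k rfl X
    rfl
  exact (h1 _ C.incl_exp_zero _).symm.trans (congrArg (fun T : ℝ →L[ℝ] EG => T t) h).symm

/-- Exactness at `Lie K` of the sequence `iℝ → Lie K → Lie G`. -/
theorem exists_inclStar_eq {X : EK} (hX : C.qStar X = 0) : ∃ t : ℝ, C.inclStar t = X := by
  obtain ⟨U, φ, -, hxU, hsrc, -, hφ, hφs, hp, -⟩ := C.isPrincipalBundle.locally_trivial (C.q 1)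
  have h1 : (1 : K) ∈ φ.source := by rw [hsrc]; exact hxU
  have hφ1 : MDifferentiableAt IK (IG.prod (𝓡 1)) φ 1 :=
    (hφ.contMDiffAt (φ.open_source.mem_nhds h1)).mdifferentiableAt (by simp)
  have hφ2 : MDifferentiableAt (IG.prod (𝓡 1)) IK φ.symm (φ 1) :=
    (hφs.contMDiffAt (φ.open_target.mem_nhds (φ.map_source h1))).mdifferentiableAt (by simp)
  let D : EK →L[ℝ] (EG × EuclideanSpace ℝ (Fin 1)) := mfderiv IK (IG.prod (𝓡 1)) φ 1
  have hinj : Function.Injective D := by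
    have h2 := mfderiv_comp (1 : K) hφ2 hφ1
    have e : φ.symm ∘ φ =ᶠ[𝓝 1] id := by
      filter_upwards [φ.open_source.mem_nhds h1] with k hk
      exact φ.left_inv hk
    rw [e.mfderiv_eq, mfderiv_id] at h2
    intro Y Z hYZ
    have h3 : ∀ W : EK, W = (mfderiv (IG.prod (𝓡 1)) IK φ.symm (φ 1) :
        (EG × EuclideanSpace ℝ (Fin 1)) →L[ℝ] EK) (D W) := fun W =>
      congrArg (fun T : EK →L[ℝ] EK => T W) h2
    rw [h3 Y, h3 Z, hYZ]
  have hfst : ∀ Y : EK, (D Y).1 = C.qStar Y := by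
    intro Y
    have h2 := mfderiv_comp (1 : K) (mdifferentiableAt_fst (I := IG) (I' := 𝓡 1) (x := φ 1)) hφ1
    have e : Prod.fst ∘ φ =ᶠ[𝓝 1] C.q := by
      filter_upwards [φ.open_source.mem_nhds h1] with k hk
      exact hp k hk
    rw [e.mfderiv_eq, mfderiv_fst] at h2
    exact (congrArg (fun T : EK →L[ℝ] EG => T Y) h2).symm
  -- In a local trivialisation `D` is injective with first component `qStar`. So the kernel of
  -- `qStar` embeds in the one-dimensional tangent space of the circle, and a nonzero image of
  -- `inclStar 1` spans it.
  have hne : (D (C.inclStar 1)).2 ≠ 0 := by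
    intro h0
    apply C.inclStar_ne_zero
    apply hinj
    rw [map_zero]
    exact Prod.ext ((hfst _).trans (C.qStar_inclStar 1)) h0
  obtain ⟨r, hr⟩ := exists_smul_eq_of_finrank_eq_one (K := ℝ)
    (finrank_euclideanSpace_fin (𝕜 := ℝ) (n := 1)) hne (D X).2
  refine ⟨r, hinj ?_⟩
  rw [C.inclStar_eq, map_smul]
  refine Prod.ext ?_ hr
  rw [hfst, hX]
  change r • (D (C.inclStar 1)).1 = 0
  rw [hfst, C.qStar_inclStar, smul_zero]

/-- `centralCoord` is an arbitrary extension off the central line; exactness makes it the true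
inverse of `inclStar` on the kernel of `qStar`. -/
theorem inclStar_centralCoord {X : EK} (hX : C.qStar X = 0) :
    C.inclStar (C.centralCoord X) = X := by
  obtain ⟨t, rfl⟩ := C.exists_inclStar_eq hX
  rw [C.centralCoord_inclStar]

theorem qStar_lieBr (X Y : EK) :
    C.qStar (lieBr IK K X Y) = lieBr IG G (C.qStar X) (C.qStar Y) :=
  lieBr_hom C.q C.contMDiff_q rfl X Y

theorem qStar_maurerCartan :
    DForm.pullback IK IG C.q (maurerCartan IG G) = DForm.mapVal C.qStar (maurerCartan IK K) :=
  maurerCartan_hom C.q C.contMDiff_q rfl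

theorem qStar_lieAd (k : K) (X : EK) : C.qStar (lieAd IK K k X) = lieAd IG G (C.q k) (C.qStar X) := by
  have e : C.q ∘ (fun h : K => k * h * k⁻¹) = (fun g : G => C.q k * g * (C.q k)⁻¹) ∘ C.q := by
    funext h
    simp
  have h1 := mfderiv_comp (1 : K) (C.mdifferentiable_q _)
    ((contMDiff_conj (I := IK) k).mdifferentiable (by simp) 1)
  have h2 := mfderiv_comp (1 : K) ((contMDiff_conj (I := IG) (C.q k)).mdifferentiable (by simp) _)
    (C.mdifferentiable_q 1)
  rw [e] at h1
  have h3 : ∀ h : K, h = 1 → ∀ X : EK, (mfderiv IK IG C.q h : EK →L[ℝ] EG) X = C.qStar X := by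
    rintro h rfl X
    rfl
  have h4 := congrArg (fun T : EK →L[ℝ] EG => T X) (h1.symm.trans h2)
  refine ((h3 (k * 1 * k⁻¹) (by group) _).symm.trans h4).trans ?_
  exact mfderiv_conj _ (map_one _) _

/-- Two lifts of one element of `G` differ by an element of the circle, which acts trivially. This
frees `lieAdHat` from the chosen lift. -/
theorem lieAd_eq_of_q_eq {k k' : K} (h : C.q k = C.q k') (X : EK) :
    lieAd IK K k X = lieAd IK K k' X := by
  have h1 : k'⁻¹ * k ∈ C.q.ker := by
    rw [MonoidHom.mem_ker, map_mul, map_inv, h, inv_mul_cancel]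
  rw [C.exact] at h1
  obtain ⟨u, hu⟩ := h1
  have h2 : k = k' * C.incl u := by rw [hu]; group
  rw [h2, lieAd_mul, C.lieAd_incl]

theorem lieAdHat_q (k : K) : C.lieAdHat (C.q k) = lieAd IK K k := by
  ext X
  exact C.lieAd_eq_of_q_eq (Function.surjInv_eq C.q_surjective _) X

theorem lieAdHat_q_inv (k : K) : C.lieAdHat (C.q k)⁻¹ = lieAd IK K k⁻¹ := by
  rw [← map_inv, C.lieAdHat_q]

theorem groupCocycle_q_inv (σ : C.Split) (k : K) (Y : EG) :
    C.groupCocycle σ (C.q k)⁻¹ Y = C.centralCoord (lieAd IK K k⁻¹ (σ.toCLM Y)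
      - σ.toCLM (lieAd IG G (C.q k)⁻¹ Y)) := by
  rw [← C.lieAdHat_q_inv]
  rfl

theorem qStar_cocycle (σ : C.Split) (k : K) (Y : EG) :
    C.qStar (lieAd IK K k⁻¹ (σ.toCLM Y) - σ.toCLM (lieAd IG G (C.q k)⁻¹ Y)) = 0 := by
  rw [map_sub, C.qStar_lieAd, σ.qStar_toCLM, σ.qStar_toCLM, map_inv, sub_self]

theorem inclStar_lieCocycle (σ : C.Split) (Y Z : EG) : C.inclStar (C.lieCocycle σ Y Z)
    = lieBr IK K (σ.toCLM Y) (σ.toCLM Z) - σ.toCLM (lieBr IG G Y Z) := by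
  rw [C.lieCocycle_apply]
  refine C.inclStar_centralCoord ?_
  rw [map_sub, C.qStar_lieBr, σ.qStar_toCLM, σ.qStar_toCLM, σ.qStar_toCLM, sub_self]

end CentralExtension
end CentralExtensionFacts

/-! ### Manifold structures transported along a homeomorphism -/

section TransportFacts

variable {E H : Type*} [NormedAddCommGroup E] [NormedSpace ℝ E] [TopologicalSpace H]
  {I : ModelWithCorners ℝ E H} {S M : Type*} [TopologicalSpace S] [TopologicalSpace M]
  [ChartedSpace H M]

/-- The homeomorphism cancels in every change of charts, leaving the changes of charts of `M`. -/
theorem Homeomorph.isManifold_transportCharts [IsManifold I ∞ M] (e : S ≃ₜ M) :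
    letI : ChartedSpace H S := e.transportCharts
    IsManifold I ∞ S := by
  let _ : ChartedSpace H S := e.transportCharts
  have h : HasGroupoid S (contDiffGroupoid ∞ I) := by
    refine ⟨?_⟩
    rintro _ _ ⟨c, hc, rfl⟩ ⟨c', hc', rfl⟩
    have e1 : (e.toOpenPartialHomeomorph ≫ₕ c).symm ≫ₕ (e.toOpenPartialHomeomorph ≫ₕ c')
        = c.symm ≫ₕ c' := by
      rw [OpenPartialHomeomorph.trans_symm_eq_symm_trans_symm, OpenPartialHomeomorph.trans_assoc,
        ← OpenPartialHomeomorph.trans_assoc e.toOpenPartialHomeomorph.symm,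
        ← Homeomorph.symm_toOpenPartialHomeomorph, ← Homeomorph.trans_toOpenPartialHomeomorph]
      simp
    rw [e1]
    exact HasGroupoid.compatible hc hc'
  exact ⟨⟩

/-- In the transported charts the coordinate expression of `e` is the identity near the point
considered. -/
theorem Homeomorph.contMDiff_transportCharts [IsManifold I ∞ M] (e : S ≃ₜ M) :
    letI : ChartedSpace H S := e.transportCharts
    ContMDiff I I ∞ e := by
  let _ : ChartedSpace H S := e.transportCharts
  intro s
  rw [contMDiffAt_iff]
  refine ⟨e.continuous.continuousAt, ?_⟩
  refine (contDiffWithinAt_id (𝕜 := ℝ)).congr_of_eventuallyEq (f := id) ?_ ?_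
  · filter_upwards [extChartAt_target_mem_nhdsWithin (I := I) (e s)] with y hy
    change extChartAt I (e s) (e (e.symm ((extChartAt I (e s)).symm y))) = y
    rw [e.apply_symm_apply, (extChartAt I (e s)).right_inv hy]
  · change extChartAt I (e s) (e (e.symm ((extChartAt I (e s)).symm (extChartAt I (e s) (e s))))) = _
    rw [e.apply_symm_apply, extChartAt_to_inv]
    rfl

theorem Homeomorph.contMDiff_symm_transportCharts [IsManifold I ∞ M] (e : S ≃ₜ M) :
    letI : ChartedSpace H S := e.transportCharts
    ContMDiff I I ∞ e.symm := by
  let _ : ChartedSpace H S := e.transportCharts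
  intro m
  obtain ⟨s, rfl⟩ := e.surjective m
  rw [contMDiffAt_iff]
  refine ⟨e.symm.continuous.continuousAt, ?_⟩
  rw [e.symm_apply_apply]
  refine (contDiffWithinAt_id (𝕜 := ℝ)).congr_of_eventuallyEq (f := id) ?_ ?_
  · filter_upwards [extChartAt_target_mem_nhdsWithin (I := I) (e s)] with y hy
    change extChartAt I (e s) (e (e.symm ((extChartAt I (e s)).symm y))) = y
    rw [e.apply_symm_apply, (extChartAt I (e s)).right_inv hy]
  · change extChartAt I (e s) (e (e.symm ((extChartAt I (e s)).symm (extChartAt I (e s) (e s))))) = _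
    rw [e.apply_symm_apply, extChartAt_to_inv]
    rfl

end TransportFacts

/-! ### Smoothness of the structure maps of the lifting gerbe -/

section GerbeManifolds

variable {EG HG : Type*} [NormedAddCommGroup EG] [NormedSpace ℝ EG] [CompleteSpace EG]
  [TopologicalSpace HG] {IG : ModelWithCorners ℝ EG HG} [IG.Boundaryless]
  {G : Type*} [TopologicalSpace G] [ChartedSpace HG G] [Group G] [LieGroup IG ∞ G]
  {EK HK : Type*} [NormedAddCommGroup EK] [NormedSpace ℝ EK] [CompleteSpace EK]
  [TopologicalSpace HK] {IK : ModelWithCorners ℝ EK HK} [IK.Boundaryless]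
  {K : Type*} [TopologicalSpace K] [ChartedSpace HK K] [Group K] [LieGroup IK ∞ K]
  {EX HX : Type*} [NormedAddCommGroup EX] [NormedSpace ℝ EX]
  [TopologicalSpace HX] {IX : ModelWithCorners ℝ EX HX}
  {X : Type*} [TopologicalSpace X] [ChartedSpace HX X]
  {EB HB : Type*} [NormedAddCommGroup EB] [NormedSpace ℝ EB]
  [TopologicalSpace HB] {IB : ModelWithCorners ℝ EB HB} [IB.Boundaryless]
  {B : Type*} [TopologicalSpace B] [ChartedSpace HB B] [IsManifold IB ∞ B]

namespace PrincipalBundle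

variable (P : PrincipalBundle IG G IB B IX X)

theorem contMDiff_pr1 : ContMDiff (IB.prod IG) IB ∞ P.pr1 :=
  (P.fibreSqHomeo.contMDiff_transportCharts (I := IB.prod IG)).fst

theorem contMDiff_zeta : ContMDiff (IB.prod IG) IG ∞ P.zeta :=
  (P.fibreSqHomeo.contMDiff_transportCharts (I := IB.prod IG)).snd

theorem contMDiff_mkSq : ContMDiff (IB.prod IG) (IB.prod IG) ∞ (fun p : B × G => P.mkSq p.1 p.2) :=
  P.fibreSqHomeo.contMDiff_symm_transportCharts (I := IB.prod IG)

theorem contMDiff_pr2 : ContMDiff (IB.prod IG) IB ∞ P.pr2 := by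
  have e : P.pr2 = (fun p : B × G => P.act p.1 p.2) ∘ fun p => (P.pr1 p, P.zeta p) := by
    funext p
    exact (P.act_zeta p).symm
  rw [e]
  exact P.isPrincipalBundle.contMDiff_act.comp (P.contMDiff_pr1.prodMk P.contMDiff_zeta)

end PrincipalBundle

namespace LiftingGerbe

variable (P : PrincipalBundle IG G IB B IX X) (C : CentralExtension IG G IK K)

instance : IsManifold (IB.prod IK) ∞ (LiftingGerbe P C) :=
  (homeo P C).isManifold_transportCharts

theorem contMDiff_pr1_rho :
    ContMDiff (IB.prod IK) IB ∞ (fun j : LiftingGerbe P C => P.pr1 j.rho) :=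
  ((homeo P C).contMDiff_transportCharts (I := IB.prod IK)).fst

theorem contMDiff_hat : ContMDiff (IB.prod IK) IK ∞ (hat : LiftingGerbe P C → K) :=
  ((homeo P C).contMDiff_transportCharts (I := IB.prod IK)).snd

theorem contMDiff_mk : ContMDiff (IB.prod IK) (IB.prod IK) ∞ (fun p : B × K => mk P C p.1 p.2) :=
  (homeo P C).contMDiff_symm_transportCharts (I := IB.prod IK)

variable {P C} in
theorem zeta_rho (j : LiftingGerbe P C) : P.zeta j.rho = C.q j.hat := j.2

theorem contMDiff_rho : ContMDiff (IB.prod IK) (IB.prod IG) ∞ (rho : LiftingGerbe P C → P.FibreSq) := by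
  have e : (rho : LiftingGerbe P C → P.FibreSq) = (fun p : B × G => P.mkSq p.1 p.2) ∘
      fun j => (P.pr1 j.rho, C.q j.hat) := by
    funext j
    rw [Function.comp_apply, ← zeta_rho]
    exact (P.fibreSqHomeo.symm_apply_apply j.rho).symm
  rw [e]
  exact P.contMDiff_mkSq.comp ((contMDiff_pr1_rho P C).prodMk
    (C.contMDiff_q.comp (contMDiff_hat P C)))

theorem contMDiff_pairs_coords : ContMDiff (IB.prod (IK.prod IK)) (IB.prod (IK.prod IK)) ∞
    (fun p : Pairs P C => (P.pr1 p.fst.rho, p.fst.hat, p.snd.hat)) :=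
  (Pairs.homeo P C).contMDiff_transportCharts (I := IB.prod (IK.prod IK))

theorem mk_pr1_hat (j : LiftingGerbe P C) : mk P C (P.pr1 j.rho) j.hat = j :=
  ext_of_pr1_hat rfl rfl

/-- The pair $(b_1,k)$ is a global diffeomorphism of $J_B$ with $B\times K$, so a map into $J_B$ is
tested on these two components. -/
theorem contMDiff_of_pr1_hat {E H : Type*} [NormedAddCommGroup E] [NormedSpace ℝ E]
    [TopologicalSpace H] {I : ModelWithCorners ℝ E H} {M : Type*} [TopologicalSpace M]
    [ChartedSpace H M] {f : M → LiftingGerbe P C}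
    (h1 : ContMDiff I IB ∞ fun x => P.pr1 (f x).rho) (h2 : ContMDiff I IK ∞ fun x => (f x).hat) :
    ContMDiff I (IB.prod IK) ∞ f := by
  have e : f = (fun p : B × K => mk P C p.1 p.2) ∘ fun x => (P.pr1 (f x).rho, (f x).hat) := by
    funext x
    exact (mk_pr1_hat P C (f x)).symm
  rw [e]
  exact (contMDiff_mk P C).comp (h1.prodMk h2)

theorem contMDiff_pairs_fst :
    ContMDiff (IB.prod (IK.prod IK)) (IB.prod IK) ∞ (Pairs.fst : Pairs P C → _) := by
  have h := contMDiff_pairs_coords P C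
  have h1 : ContMDiff (IB.prod (IK.prod IK)) IB ∞ (fun p : Pairs P C => P.pr1 p.fst.rho) :=
    h.fst
  have h2 : ContMDiff (IB.prod (IK.prod IK)) IK ∞ (fun p : Pairs P C => p.fst.hat) :=
    h.snd.fst
  exact contMDiff_of_pr1_hat P C h1 h2

theorem contMDiff_pr2_rho :
    ContMDiff (IB.prod IK) IB ∞ (fun j : LiftingGerbe P C => P.pr2 j.rho) :=
  P.contMDiff_pr2.comp (contMDiff_rho P C)

theorem contMDiff_pairs_snd :
    ContMDiff (IB.prod (IK.prod IK)) (IB.prod IK) ∞ (Pairs.snd : Pairs P C → _) := by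
  have h2 : ContMDiff (IB.prod (IK.prod IK)) IK ∞ (fun p : Pairs P C => p.snd.hat) :=
    (contMDiff_pairs_coords P C).snd.snd
  -- The coordinates of a composable pair are $(b_1,k_1,k_2)$; the middle point $b_2$ is not among
  -- them and is recovered from the first component.
  have e : (fun p : Pairs P C => P.pr1 p.snd.rho) = fun p => P.pr2 p.fst.rho := by
    funext p
    exact p.2.symm
  have h1 : ContMDiff (IB.prod (IK.prod IK)) IB ∞ (fun p : Pairs P C => P.pr1 p.snd.rho) := by
    rw [e]
    exact (contMDiff_pr2_rho P C).comp (contMDiff_pairs_fst P C)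
  exact contMDiff_of_pr1_hat P C h1 h2

theorem contMDiff_pairs_mul :
    ContMDiff (IB.prod (IK.prod IK)) (IB.prod IK) ∞ (Pairs.mul : Pairs P C → _) := by
  have h1 : ContMDiff (IB.prod (IK.prod IK)) IB ∞ (fun p : Pairs P C => P.pr1 p.mul.rho) :=
    (contMDiff_pairs_coords P C).fst
  have h2 : ContMDiff (IB.prod (IK.prod IK)) IK ∞ (fun p : Pairs P C => p.mul.hat) :=
    ((contMDiff_hat P C).comp (contMDiff_pairs_fst P C)).mul
      ((contMDiff_hat P C).comp (contMDiff_pairs_snd P C))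
  exact contMDiff_of_pr1_hat P C h1 h2

theorem contMDiff_act (u : Circle) :
    ContMDiff (IB.prod IK) (IB.prod IK) ∞ (fun j : LiftingGerbe P C => j.act u) := by
  have h2 : ContMDiff (IB.prod IK) IK ∞ (fun j : LiftingGerbe P C => (j.act u).hat) :=
    (contMDiff_hat P C).mul contMDiff_const
  exact contMDiff_of_pr1_hat P C (f := fun j : LiftingGerbe P C => j.act u) (contMDiff_pr1_rho P C) h2

theorem contMDiff_act_exp (j : LiftingGerbe P C) :
    ContMDiff 𝓘(ℝ, ℝ) (IB.prod IK) ∞ (fun s : ℝ => j.act (Circle.exp s)) := by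
  have h1 : ContMDiff 𝓘(ℝ, ℝ) IB ∞ (fun s : ℝ => P.pr1 (j.act (Circle.exp s)).rho) :=
    contMDiff_const (c := P.pr1 j.rho)
  exact contMDiff_of_pr1_hat P C (f := fun s : ℝ => j.act (Circle.exp s)) h1
    (C.contMDiff_mul_incl j.hat)

end LiftingGerbe
end GerbeManifolds

/-! ### The gerbe connection as a central difference of two lifts -/

section Connection

variable {EG HG : Type*} [NormedAddCommGroup EG] [NormedSpace ℝ EG] [CompleteSpace EG]
  [TopologicalSpace HG] {IG : ModelWithCorners ℝ EG HG} [IG.Boundaryless]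
  {G : Type*} [TopologicalSpace G] [ChartedSpace HG G] [Group G] [LieGroup IG ∞ G]
  {EK HK : Type*} [NormedAddCommGroup EK] [NormedSpace ℝ EK] [CompleteSpace EK]
  [TopologicalSpace HK] {IK : ModelWithCorners ℝ EK HK} [IK.Boundaryless]
  {K : Type*} [TopologicalSpace K] [ChartedSpace HK K] [Group K] [LieGroup IK ∞ K]
  {EX HX : Type*} [NormedAddCommGroup EX] [NormedSpace ℝ EX]
  [TopologicalSpace HX] {IX : ModelWithCorners ℝ EX HX}
  {X : Type*} [TopologicalSpace X] [ChartedSpace HX X]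
  {EB HB : Type*} [NormedAddCommGroup EB] [NormedSpace ℝ EB]
  [TopologicalSpace HB] {IB : ModelWithCorners ℝ EB HB} [IB.Boundaryless]
  {B : Type*} [TopologicalSpace B] [ChartedSpace HB B] [IsManifold IB ∞ B]

namespace PrincipalBundle

variable {P : PrincipalBundle IG G IB B IX X} {θ : DForm IB B EG 1}

/-- The orbit map of `b` is the orbit map of `b g` after left translation by $g^{-1}$. So a velocity
along the orbit is the fundamental vector at `b g` of its Maurer-Cartan value. -/
theorem mfderiv_act_right (P : PrincipalBundle IG G IB B IX X) (b : B) (g : G)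
    (w : TangentSpace IG g) :
    (mfderiv IG IB (fun h : G => P.act b h) g w : EB)
      = mfderiv IG IB (fun h : G => P.act (P.act b g) h) 1 ((maurerCartan IG G).toCLM g w) := by
  have e : (fun h : G => P.act b h) = (fun h => P.act (P.act b g) h) ∘ fun h => g⁻¹ * h := by
    funext h
    simp [← P.isPrincipalBundle.act_mul]
  have hs : ContMDiff IG IB ∞ (fun h : G => P.act (P.act b g) h) :=
    P.isPrincipalBundle.contMDiff_act.comp (contMDiff_const.prodMk contMDiff_id)
  have h1 := mfderiv_comp g (hs.mdifferentiable (by simp) (g⁻¹ * g)) (mdifferentiable_mulLeft IG g⁻¹ g)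
  have h2 : ∀ h : G, h = 1 → ∀ Y : EG,
      (mfderiv IG IB (fun h : G => P.act (P.act b g) h) h : EG →L[ℝ] EB) Y
        = (mfderiv IG IB (fun h : G => P.act (P.act b g) h) 1 : EG →L[ℝ] EB) Y := by
    rintro h rfl Y
    rfl
  rw [← e] at h1
  exact (congrArg (fun T : EG →L[ℝ] EB => T w) h1).trans (h2 _ (inv_mul_cancel g) _)

/-- The connection form on a product `b g` of a map to `B` and a map to `G`. -/
theorem IsConnection.pullback_act (hθ : P.IsConnection θ) {EM HM : Type*} [NormedAddCommGroup EM]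
    [NormedSpace ℝ EM] [TopologicalSpace HM] {J : ModelWithCorners ℝ EM HM} {M : Type*}
    [TopologicalSpace M] [ChartedSpace HM M] {b : M → B} {g : M → G}
    (hb : MDifferentiable J IB b) (hg : MDifferentiable J IG g) :
    DForm.pullback J IB (fun x => P.act (b x) (g x)) θ
      = DForm.pullback J IG g (maurerCartan IG G)
        + DForm.opApply (fun x => lieAd IG G (g x)⁻¹) (DForm.pullback J IB b θ) := by
  refine DForm.ext_toCLM fun x v => ?_
  have ha : MDifferentiableAt (IB.prod IG) IB (fun p : B × G => P.act p.1 p.2) (b x, g x) :=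
    P.isPrincipalBundle.contMDiff_act.mdifferentiable (by simp) _
  have h1 := mfderiv_comp x ha ((hb x).prodMk (hg x))
  have h2 : (mfderiv J IB (fun x => P.act (b x) (g x)) x v : EB) =
      mfderiv IB IB (fun c => P.act c (g x)) (b x) (mfderiv J IB b x v)
      + mfderiv IG IB (fun h => P.act (b x) h) (g x) (mfderiv J IG g x v) := by
    refine (congrArg (fun T : TangentSpace J x →L[ℝ] EB => T v) h1).trans ?_
    rw [mfderiv_prodMk (hb x) (hg x)]
    exact mfderiv_prod_eq_add_apply ha
  have h3 := congrArg (fun η : DForm IB B EG 1 => η.toCLM (b x) (mfderiv J IB b x v))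
    (hθ.equivariant (g x))
  have h4 := hθ.vertical (P.act (b x) (g x)) ((maurerCartan IG G).toCLM (g x) (mfderiv J IG g x v))
  have h5 : θ.toCLM (P.act (b x) (g x)) (mfderiv J IB (fun x => P.act (b x) (g x)) x v)
      = θ.toCLM (P.act (b x) (g x)) (mfderiv IB IB (fun c => P.act c (g x)) (b x) (mfderiv J IB b x v))
      + θ.toCLM (P.act (b x) (g x))
        (mfderiv IG IB (fun h => P.act (b x) h) (g x) (mfderiv J IG g x v)) := by
    rw [← map_add]
    exact congrArg (θ.toCLM (P.act (b x) (g x))) h2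
  -- Moving `b` contributes through equivariance, moving `g` through the normalisation on vertical
  -- vectors.
  refine h5.trans ((add_comm _ _).trans (congrArg₂ (· + ·) ?_ h3))
  refine Eq.trans ?_ h4
  exact congrArg (θ.toCLM (P.act (b x) (g x))) (P.mfderiv_act_right (b x) (g x) _)

end PrincipalBundle

namespace LiftingGerbe

variable {P : PrincipalBundle IG G IB B IX X} {θ : DForm IB B EG 1}
  {EM HM : Type*} [NormedAddCommGroup EM]
  [NormedSpace ℝ EM] [TopologicalSpace HM] {J : ModelWithCorners ℝ EM HM} {M : Type*}
  [TopologicalSpace M] [ChartedSpace HM M]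
  (C : CentralExtension IG G IK K) (σ : C.Split)

/-- The `Lie K`-valued form `k^* μ + Ad_{k⁻¹} σ(a)`. -/
def liftForm (k : M → K) (a : DForm J M EG 1) : DForm J M EK 1 :=
  DForm.pullback J IK k (maurerCartan IK K)
    + DForm.opApply (fun x => lieAd IK K (k x)⁻¹) (DForm.mapVal σ.toCLM a)

theorem toCLM_liftForm (k : M → K) (a : DForm J M EG 1) (x : M) (v : TangentSpace J x) :
    (liftForm C σ k a).toCLM x v = (DForm.pullback J IK k (maurerCartan IK K)).toCLM x v
      + lieAd IK K (k x)⁻¹ (σ.toCLM (a.toCLM x v)) := rfl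

theorem qStar_pullback_maurerCartan {k : M → K} (hk : MDifferentiable J IK k) (x : M)
    (v : TangentSpace J x) : C.qStar ((DForm.pullback J IK k (maurerCartan IK K)).toCLM x v)
      = (DForm.pullback J IG (fun y => C.q (k y)) (maurerCartan IG G)).toCLM x v := by
  have h := DForm.pullback_comp C.mdifferentiable_q hk (maurerCartan IG G)
  rw [C.qStar_maurerCartan] at h
  exact congrArg (fun η : DForm J M EG 1 => η.toCLM x v) h

variable {C}

/-- This is `pullback_act` for $b_2=b_1q(k)$. It is stated along an arbitrary map `h` so as to serve
the identity of $J_B$, the circle action and its orbits, and the three maps from composable pairs.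
-/
theorem pullback_pr2 (hθ : P.IsConnection θ) {h : M → LiftingGerbe P C}
    (hh : MDifferentiable J (IB.prod IK) h) :
    DForm.pullback J IB (fun y => P.pr2 (h y).rho) θ
      = DForm.pullback J IG (fun y => C.q (h y).hat) (maurerCartan IG G)
        + DForm.opApply (fun y => lieAd IG G (C.q (h y).hat)⁻¹)
          (DForm.pullback J IB (fun y => P.pr1 (h y).rho) θ) := by
  have hb : MDifferentiable J IB (fun y => P.pr1 (h y).rho) :=
    ((contMDiff_pr1_rho P C).mdifferentiable (by simp)).comp hh
  have hk : MDifferentiable J IK (fun y => (h y).hat) :=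
    ((contMDiff_hat P C).mdifferentiable (by simp)).comp hh
  have hg : MDifferentiable J IG (fun y => C.q (h y).hat) := C.mdifferentiable_q.comp hk
  rw [← hθ.pullback_act hb hg]
  congr 1
  funext y
  exact pr2_rho (h y)

/-- Applying `qStar` to the defining formula of `liftForm` gives the gauge formula for
$\pi_2^*\theta$. So `liftForm` and $\sigma(\pi_2^*\theta)$ lift the same form and differ by central
values. -/
theorem qStar_liftForm (hθ : P.IsConnection θ) {h : M → LiftingGerbe P C}
    (hh : MDifferentiable J (IB.prod IK) h) (x : M) (v : TangentSpace J x) :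
    C.qStar ((liftForm C σ (fun y => (h y).hat)
        (DForm.pullback J IB (fun y => P.pr1 (h y).rho) θ)).toCLM x v)
      = (DForm.pullback J IB (fun y => P.pr2 (h y).rho) θ).toCLM x v := by
  have hk : MDifferentiable J IK (fun y => (h y).hat) :=
    ((contMDiff_hat P C).mdifferentiable (by simp)).comp hh
  rw [toCLM_liftForm, map_add, C.qStar_lieAd, σ.qStar_toCLM, qStar_pullback_maurerCartan C hk,
    pullback_pr2 hθ hh, map_inv]
  rfl

/-- The pull-back of the connection form in terms of the components of a map to `J_B`. -/
theorem pullback_connection (hθ : P.IsConnection θ) {h : M → LiftingGerbe P C}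
    (hh : MDifferentiable J (IB.prod IK) h) :
    DForm.pullback J (IB.prod IK) h (connection P C θ σ)
      = DForm.mapVal C.centralCoord (liftForm C σ (fun y => (h y).hat)
          (DForm.pullback J IB (fun y => P.pr1 (h y).rho) θ)
        - DForm.mapVal σ.toCLM (DForm.pullback J IB (fun y => P.pr2 (h y).rho) θ)) := by
  have hk : MDifferentiable J IK (fun y => (h y).hat) :=
    ((contMDiff_hat P C).mdifferentiable (by simp)).comp hh
  have hr : MDifferentiable J (IB.prod IG) (fun y => (h y).rho) :=
    ((contMDiff_rho P C).mdifferentiable (by simp)).comp hh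
  have h1 : DForm.pullback J (IB.prod IK) h
      (DForm.pullback (IB.prod IK) IK hat (C.connectionForm σ))
      = DForm.pullback J IK (fun y => (h y).hat) (C.connectionForm σ) :=
    DForm.pullback_comp ((contMDiff_hat P C).mdifferentiable (by simp)) hh _
  have h2 : DForm.pullback J IK (fun y => (h y).hat)
      (DForm.pullback IK IG C.q (maurerCartan IG G))
      = DForm.pullback J IG (fun y => C.q (h y).hat) (maurerCartan IG G) :=
    DForm.pullback_comp C.mdifferentiable_q hk _
  have h3 : DForm.pullback J (IB.prod IK) h (DForm.pullback (IB.prod IK) (IB.prod IG) rho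
      (DForm.pullback (IB.prod IG) IB P.pr1 θ))
      = DForm.pullback J IB (fun y => P.pr1 (h y).rho) θ := by
    have e1 : DForm.pullback (IB.prod IK) (IB.prod IG) (rho : LiftingGerbe P C → _)
      (DForm.pullback (IB.prod IG) IB P.pr1 θ)
        = DForm.pullback (IB.prod IK) IB (fun j : LiftingGerbe P C => P.pr1 j.rho) θ :=
      DForm.pullback_comp (P.contMDiff_pr1.mdifferentiable (by simp))
        ((contMDiff_rho P C).mdifferentiable (by simp)) θ
    rw [e1]
    exact DForm.pullback_comp ((contMDiff_pr1_rho P C).mdifferentiable (by simp)) hh θ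
  refine DForm.ext_toCLM fun x v => ?_
  rw [pullback_pr2 hθ hh]
  have h4 : (DForm.pullback J (IB.prod IK) h (connection P C θ σ)).toCLM x v
      = (DForm.pullback J (IB.prod IK) h
        (DForm.pullback (IB.prod IK) IK hat (C.connectionForm σ))).toCLM x v
      + C.groupCocycle σ (P.zeta (h x).rho)⁻¹ ((DForm.pullback J (IB.prod IK) h
        (DForm.pullback (IB.prod IK) (IB.prod IG) rho
          (DForm.pullback (IB.prod IG) IB P.pr1 θ))).toCLM x v) := rfl
  rw [h4, h1, h3, zeta_rho, C.groupCocycle_q_inv]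
  have h5 : (DForm.pullback J IK (fun y => (h y).hat) (C.connectionForm σ)).toCLM x v
      = C.centralCoord ((DForm.pullback J IK (fun y => (h y).hat) (maurerCartan IK K)).toCLM x v
        - σ.toCLM ((DForm.pullback J IK (fun y => (h y).hat)
          (DForm.pullback IK IG C.q (maurerCartan IG G))).toCLM x v)) := rfl
  rw [h5, h2, ← map_add, DForm.toCLM_mapVal]
  congr 1
  -- The term $-\sigma(q^*\mu)$ of $\nu_\sigma$ and the term
  -- $-\sigma(\mathrm{Ad}_{q(k)^{-1}}\pi_1^*\theta)$ of the cocycle combine to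
  -- $-\sigma(\pi_2^*\theta)$.
  change _ = ((DForm.pullback J IK (fun y => (h y).hat) (maurerCartan IK K)).toCLM x v
      + lieAd IK K (h x).hat⁻¹ (σ.toCLM ((DForm.pullback J IB (fun y => P.pr1 (h y).rho) θ).toCLM x v)))
    - σ.toCLM ((DForm.pullback J IG (fun y => C.q (h y).hat) (maurerCartan IG G)).toCLM x v
      + lieAd IG G (C.q (h x).hat)⁻¹
        ((DForm.pullback J IB (fun y => P.pr1 (h y).rho) θ).toCLM x v))
  rw [map_add]
  abel

end LiftingGerbe
end Connection

/-! ### Curvature, central brackets and the reduced splitting -/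

section SplittingFacts

variable {EG HG : Type*} [NormedAddCommGroup EG] [NormedSpace ℝ EG] [CompleteSpace EG]
  [TopologicalSpace HG] {IG : ModelWithCorners ℝ EG HG} [IG.Boundaryless]
  {G : Type*} [TopologicalSpace G] [ChartedSpace HG G] [Group G] [LieGroup IG ∞ G]
  {EK HK : Type*} [NormedAddCommGroup EK] [NormedSpace ℝ EK] [CompleteSpace EK]
  [TopologicalSpace HK] {IK : ModelWithCorners ℝ EK HK} [IK.Boundaryless]
  {K : Type*} [TopologicalSpace K] [ChartedSpace HK K] [Group K] [LieGroup IK ∞ K]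
  {EX HX : Type*} [NormedAddCommGroup EX] [NormedSpace ℝ EX]
  [TopologicalSpace HX] {IX : ModelWithCorners ℝ EX HX}
  {X : Type*} [TopologicalSpace X] [ChartedSpace HX X]
  {EB HB : Type*} [NormedAddCommGroup EB] [NormedSpace ℝ EB]
  [TopologicalSpace HB] {IB : ModelWithCorners ℝ EB HB} [IB.Boundaryless]
  {B : Type*} [TopologicalSpace B] [ChartedSpace HB B] [IsManifold IB ∞ B]


/-- For antisymmetric `β` the two terms of the wedge coincide, which the factor one half
compensates. -/
theorem DForm.half_wedge_apply {E H : Type*} [NormedAddCommGroup E] [NormedSpace ℝ E]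
    [TopologicalSpace H] {I : ModelWithCorners ℝ E H} {M : Type*} [TopologicalSpace M]
    [ChartedSpace H M] {F F' : Type*} [NormedAddCommGroup F] [NormedSpace ℝ F]
    [NormedAddCommGroup F'] [NormedSpace ℝ F'] {β : F →L[ℝ] F →L[ℝ] F'}
    (hβ : ∀ X Y, β X Y = - β Y X) (α : DForm I M F 1) (x : M) (v w : TangentSpace I x) :
    ((1 / 2 : ℝ) • DForm.wedge β α α) x ![v, w] = β (α.toCLM x v) (α.toCLM x w) := by
  have h : ((1 / 2 : ℝ) • DForm.wedge β α α) x ![v, w]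
      = (1 / 2 : ℝ) • (β (α.toCLM x v) (α.toCLM x w) - β (α.toCLM x w) (α.toCLM x v)) := rfl
  rw [h, hβ (α.toCLM x w), sub_neg_eq_add, ← two_smul ℝ, smul_smul]
  norm_num

theorem connCurvature_apply (θ : DForm IB B EG 1) (b : B) (v w : TangentSpace IB b) :
    connCurvature IG G θ b ![v, w] = θ.d b ![v, w] + lieBr IG G (θ.toCLM b v) (θ.toCLM b w) :=
  congrArg (fun Y : EG => θ.d b ![v, w] + Y)
    (DForm.half_wedge_apply (β := lieBrCLM IG G) (lieBr_swap IG G) θ b v w)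

theorem smooth_connCurvature {θ : DForm IB B EG 1} (hθ : θ.Smooth) :
    (connCurvature IG G θ).Smooth :=
  hθ.d.add ((hθ.wedge _ hθ).smul _)

theorem CentralExtension.lieCocycle_swap (C : CentralExtension IG G IK K) (σ : C.Split) (Y Z : EG) :
    C.lieCocycle σ Y Z = - C.lieCocycle σ Z Y := by
  rw [C.lieCocycle_apply, C.lieCocycle_apply, lieBr_swap IK K (σ.toCLM Y), lieBr_swap IG G Y,
    map_neg, ← neg_sub', map_neg]

theorem CentralExtension.lieAd_of_qStar_eq_zero (C : CentralExtension IG G IK K) (k : K) {Z : EK}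
    (hZ : C.qStar Z = 0) : lieAd IK K k Z = Z := by
  rw [← C.inclStar_centralCoord hZ, C.lieAd_inclStar]

/-- Central summands do not affect a bracket, so brackets in $\mathrm{Lie}\,K$ depend only on the
images under `qStar`. This replaces $[\Theta,\Theta]$ by $[\sigma\alpha',\sigma\alpha']$. -/
theorem CentralExtension.lieBr_of_qStar_eq {C : CentralExtension IG G IK K} {Z Z' : EK} {Y Y' : EG}
    (σ : C.Split) (h : C.qStar Z = Y) (h' : C.qStar Z' = Y') :
    lieBr IK K Z Z' = lieBr IK K (σ.toCLM Y) (σ.toCLM Y') := by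
  have e : ∀ (Z : EK) (Y : EG), C.qStar Z = Y → ∃ t : ℝ, Z = σ.toCLM Y + C.inclStar t := by
    intro Z Y h
    obtain ⟨t, ht⟩ := C.exists_inclStar_eq (X := Z - σ.toCLM Y) (by
      rw [map_sub, h, σ.qStar_toCLM, sub_self])
    exact ⟨t, by rw [ht]; abel⟩
  obtain ⟨t, rfl⟩ := e Z Y h
  obtain ⟨t', rfl⟩ := e Z' Y' h'
  rw [lieBr_add_right, C.lieBr_inclStar, add_zero, lieBr_swap, lieBr_add_right, C.lieBr_inclStar,
    add_zero, ← lieBr_swap]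

namespace Splitting

variable {P : PrincipalBundle IG G IB B IX X} {C : CentralExtension IG G IK K} (L : Splitting P C)

/-- A continuous linear map is its own derivative at `0`; differentiating the jointly smooth
function $(b,Y)\mapsto L[b,Y]$ in $Y$ gives smoothness in operator norm. -/
theorem contMDiff_lift : ContMDiff IB 𝓘(ℝ, EK →L[ℝ] ℝ) ∞ L.lift := by
  intro b
  have h3 := ContMDiffAt.mfderiv (m := ∞) (fun (b : B) (Y : EK) => L.lift b Y)
    (fun _ => (0 : EK)) (L.smooth (b, 0)) contMDiffAt_const (by simp)
  simp only [mfderiv_eq_fderiv] at h3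
  have h4 := inTangentCoordinates_model_space (I := 𝓘(ℝ, EK)) (I' := 𝓘(ℝ, ℝ)) (fun _ : B => (0 : EK))
    (fun b => L.lift b 0) (fun b => fderiv ℝ (fun Y => L.lift b Y) 0) b
  have h5 := (congrArg (fun T => ContMDiffAt IB 𝓘(ℝ, EK →L[ℝ] ℝ) ∞ T b) h4).mp h3
  have e : L.lift = fun b => fderiv ℝ (fun Y => L.lift b Y) 0 :=
    funext fun b => (L.lift b).fderiv.symm
  rw [e]
  exact h5

theorem contMDiff_reduced (σ : C.Split) : ContMDiff IB 𝓘(ℝ, EG →L[ℝ] ℝ) ∞ (L.reduced σ) :=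
  (((ContinuousLinearMap.compL ℝ EG EK ℝ).flip σ.toCLM).contMDiff).comp L.contMDiff_lift

/-- Both arguments represent the same class in $B\times_{\mathrm{Ad}}\mathrm{Lie}\,K$. -/
theorem lift_act (b : B) (k : K) (Y : EK) :
    L.lift (P.act b (C.q k)) (lieAd IK K k⁻¹ Y) = L.lift b Y := by
  rw [← C.lieAdHat_q_inv]
  exact congrArg (fun z => (L.toFun z).2)
    (Quot.sound (r := fun p p' : B × EK => ∃ g : G, p'.1 = P.act p.1 g ∧ p'.2 = C.lieAdHat g⁻¹ p.2)
      ⟨C.q k, rfl, rfl⟩).symm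

theorem smooth_kappa {θ : DForm IB B EG 1} (hθ : θ.Smooth) (σ : C.Split) : (kappa θ L σ).Smooth :=
  (smooth_connCurvature hθ).opApply (L.contMDiff_reduced σ)

/-- The change of the reduced splitting under the action of the structure group. -/
theorem reduced_sub_reduced_act (σ : C.Split) (b : B) (k : K) (Y : EG) :
    L.reduced σ b Y - L.reduced σ (P.act b (C.q k)) (lieAd IG G (C.q k)⁻¹ Y)
      = C.centralCoord (lieAd IK K k⁻¹ (σ.toCLM Y) - σ.toCLM (lieAd IG G (C.q k)⁻¹ Y)) := by
  have h : L.reduced σ b Y - L.reduced σ (P.act b (C.q k)) (lieAd IG G (C.q k)⁻¹ Y)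
      = L.lift (P.act b (C.q k)) (lieAd IK K k⁻¹ (σ.toCLM Y) - σ.toCLM (lieAd IG G (C.q k)⁻¹ Y)) := by
    rw [map_sub, lift_act]
    rfl
  rw [h]
  -- Both values are now taken at the point $b\,q(k)$ and their difference has a central argument,
  -- on which a splitting is the identity.
  conv_lhs => rw [← C.inclStar_centralCoord (C.qStar_cocycle σ k Y)]
  exact L.center _ _

end Splitting
end SplittingFacts

/-! ### Gerbe connection axioms and the curvature -/

section ConnectionFacts

variable {EG HG : Type*} [NormedAddCommGroup EG] [NormedSpace ℝ EG] [CompleteSpace EG]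
  [TopologicalSpace HG] {IG : ModelWithCorners ℝ EG HG} [IG.Boundaryless]
  {G : Type*} [TopologicalSpace G] [ChartedSpace HG G] [Group G] [LieGroup IG ∞ G]
  {EK HK : Type*} [NormedAddCommGroup EK] [NormedSpace ℝ EK] [CompleteSpace EK]
  [TopologicalSpace HK] {IK : ModelWithCorners ℝ EK HK} [IK.Boundaryless]
  {K : Type*} [TopologicalSpace K] [ChartedSpace HK K] [Group K] [LieGroup IK ∞ K]
  {EX HX : Type*} [NormedAddCommGroup EX] [NormedSpace ℝ EX]
  [TopologicalSpace HX] {IX : ModelWithCorners ℝ EX HX}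
  {X : Type*} [TopologicalSpace X] [ChartedSpace HX X]
  {EB HB : Type*} [NormedAddCommGroup EB] [NormedSpace ℝ EB]
  [TopologicalSpace HB] {IB : ModelWithCorners ℝ EB HB} [IB.Boundaryless]
  {B : Type*} [TopologicalSpace B] [ChartedSpace HB B] [IsManifold IB ∞ B]


theorem DForm.pullback_id {E H : Type*} [NormedAddCommGroup E] [NormedSpace ℝ E]
    [TopologicalSpace H] {I : ModelWithCorners ℝ E H} {M : Type*} [TopologicalSpace M]
    [ChartedSpace H M] {F : Type*} [NormedAddCommGroup F] [NormedSpace ℝ F] {n : ℕ}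
    (η : DForm I M F n) : DForm.pullback I I id η = η := by
  funext x
  ext v
  change η x (fun i => mfderiv I I id x (v i)) = η x v
  rw [mfderiv_id]
  rfl

namespace LiftingGerbe

variable {P : PrincipalBundle IG G IB B IX X} {θ : DForm IB B EG 1}
  {C : CentralExtension IG G IK K} (σ : C.Split)

theorem connection_eq (hθ : P.IsConnection θ) : connection P C θ σ
    = DForm.mapVal C.centralCoord (liftForm C σ hat
        (DForm.pullback (IB.prod IK) IB (fun j : LiftingGerbe P C => P.pr1 j.rho) θ)
      - DForm.mapVal σ.toCLM
        (DForm.pullback (IB.prod IK) IB (fun j : LiftingGerbe P C => P.pr2 j.rho) θ)) := by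
  have h := pullback_connection (J := IB.prod IK) (h := (id : LiftingGerbe P C → _)) σ hθ
    mdifferentiable_id
  rw [DForm.pullback_id] at h
  exact h

theorem smooth_liftForm {EM HM : Type*} [NormedAddCommGroup EM]
    [NormedSpace ℝ EM] [TopologicalSpace HM] {J : ModelWithCorners ℝ EM HM} {M : Type*}
    [TopologicalSpace M] [ChartedSpace HM M] [J.Boundaryless] [IsManifold J ∞ M] {k : M → K}
    (hk : ContMDiff J IK ∞ k) {a : DForm J M EG 1} (ha : a.Smooth) : (liftForm C σ k a).Smooth :=
  (smooth_maurerCartan.pullback hk).add ((ha.mapVal σ.toCLM).opApply (contMDiff_lieAd_inv.comp hk))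

theorem smooth_connection (hθ : P.IsConnection θ) : (connection P C θ σ).Smooth := by
  rw [connection_eq σ hθ]
  exact ((smooth_liftForm σ (contMDiff_hat P C) (hθ.smooth.pullback (contMDiff_pr1_rho P C))).sub
    ((hθ.smooth.pullback (contMDiff_pr2_rho P C)).mapVal _)).mapVal _

theorem qStar_liftForm_sub (hθ : P.IsConnection θ) {EM HM : Type*} [NormedAddCommGroup EM]
    [NormedSpace ℝ EM] [TopologicalSpace HM] {J : ModelWithCorners ℝ EM HM} {M : Type*}
    [TopologicalSpace M] [ChartedSpace HM M] {h : M → LiftingGerbe P C}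
    (hh : MDifferentiable J (IB.prod IK) h) (x : M) (v : TangentSpace J x) :
    C.qStar ((liftForm C σ (fun y => (h y).hat)
        (DForm.pullback J IB (fun y => P.pr1 (h y).rho) θ)).toCLM x v
      - σ.toCLM ((DForm.pullback J IB (fun y => P.pr2 (h y).rho) θ).toCLM x v)) = 0 := by
  rw [map_sub, qStar_liftForm σ hθ hh, σ.qStar_toCLM, sub_self]

theorem toCLM_pullback_connection (hθ : P.IsConnection θ) {EM HM : Type*} [NormedAddCommGroup EM]
    [NormedSpace ℝ EM] [TopologicalSpace HM] {J : ModelWithCorners ℝ EM HM} {M : Type*}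
    [TopologicalSpace M] [ChartedSpace HM M] {h : M → LiftingGerbe P C}
    (hh : MDifferentiable J (IB.prod IK) h) (x : M) (v : TangentSpace J x) :
    (DForm.pullback J (IB.prod IK) h (connection P C θ σ)).toCLM x v
      = C.centralCoord ((DForm.pullback J IK (fun y => (h y).hat) (maurerCartan IK K)).toCLM x v
        + lieAd IK K (h x).hat⁻¹
          (σ.toCLM ((DForm.pullback J IB (fun y => P.pr1 (h y).rho) θ).toCLM x v))
        - σ.toCLM ((DForm.pullback J IB (fun y => P.pr2 (h y).rho) θ).toCLM x v)) := by
  rw [pullback_connection σ hθ hh]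
  rfl

/-- The value at the first factor is central, so $\mathrm{Ad}_{k_2^{-1}}$ may be applied to it for
free. Its three terms then combine with those of the second factor: the Maurer-Cartan terms by the
product rule for $k_1k_2$, the $\sigma$-terms over the middle point cancel, and the outer ones
remain. -/
theorem connection_product (hθ : P.IsConnection θ) :
    DForm.pullback (IB.prod (IK.prod IK)) (IB.prod IK) Pairs.fst (connection P C θ σ)
      + DForm.pullback (IB.prod (IK.prod IK)) (IB.prod IK) Pairs.snd (connection P C θ σ)
      = DForm.pullback (IB.prod (IK.prod IK)) (IB.prod IK) Pairs.mul (connection P C θ σ) := by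
  have h1 := (contMDiff_pairs_fst P C).mdifferentiable (by simp)
  have h2 := (contMDiff_pairs_snd P C).mdifferentiable (by simp)
  have h3 := (contMDiff_pairs_mul P C).mdifferentiable (by simp)
  have hh := (contMDiff_hat P C).mdifferentiable (by simp)
  have e : (fun p : Pairs P C => P.pr1 p.snd.rho) = fun p => P.pr2 p.fst.rho :=
    funext fun p => p.2.symm
  refine DForm.ext_toCLM fun p v => ?_
  have hZ := qStar_liftForm_sub σ hθ h1 p v
  have hA := C.lieAd_of_qStar_eq_zero p.snd.hat⁻¹ hZ
  have hm : (DForm.pullback (IB.prod (IK.prod IK)) IK (fun p : Pairs P C => p.mul.hat)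
      (maurerCartan IK K)).toCLM p v
      = lieAd IK K p.snd.hat⁻¹ ((DForm.pullback (IB.prod (IK.prod IK)) IK
          (fun p : Pairs P C => p.fst.hat) (maurerCartan IK K)).toCLM p v)
        + (DForm.pullback (IB.prod (IK.prod IK)) IK
          (fun p : Pairs P C => p.snd.hat) (maurerCartan IK K)).toCLM p v :=
    maurerCartan_mul_apply ((hh.comp h1) p) ((hh.comp h2) p) v
  have hAd : ∀ Y : EK, lieAd IK K p.mul.hat⁻¹ Y
      = lieAd IK K p.snd.hat⁻¹ (lieAd IK K p.fst.hat⁻¹ Y) := by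
    intro Y
    rw [← lieAd_mul, ← mul_inv_rev]
    rfl
  refine (congrArg₂ (· + ·) (toCLM_pullback_connection σ hθ h1 p v)
    (toCLM_pullback_connection σ hθ h2 p v)).trans
    (Eq.trans ?_ (toCLM_pullback_connection σ hθ h3 p v).symm)
  rw [hm, hAd, e, ← map_add]
  rw [toCLM_liftForm, map_sub, map_add] at hA
  rw [show (fun y : Pairs P C => P.pr1 y.mul.rho) = fun y => P.pr1 y.fst.rho from rfl,
    show (fun y : Pairs P C => P.pr2 y.mul.rho) = fun y => P.pr2 y.snd.rho from rfl, ← hA]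
  congr 1
  abel

/-- As `u` is central, its right action on `K` is a left translation, which preserves
`maurerCartan`. Neither the base points nor $\mathrm{Ad}$ notice it. -/
theorem connection_invariant (hθ : P.IsConnection θ) (u : Circle) :
    DForm.pullback (IB.prod IK) (IB.prod IK) (fun j : LiftingGerbe P C => j.act u)
      (connection P C θ σ) = connection P C θ σ := by
  have h1 := (contMDiff_act P C u).mdifferentiable (by simp)
  have hh := (contMDiff_hat P C).mdifferentiable (by simp)
  rw [pullback_connection σ hθ h1, connection_eq σ hθ]
  have e : (fun j : LiftingGerbe P C => (j.act u).hat) = (fun k => C.incl u * k) ∘ hat :=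
    funext fun j => (C.central u j.hat).symm
  have hm : DForm.pullback (IB.prod IK) IK (fun j : LiftingGerbe P C => (j.act u).hat)
      (maurerCartan IK K) = DForm.pullback (IB.prod IK) IK hat (maurerCartan IK K) := by
    rw [e, ← DForm.pullback_comp (mdifferentiable_mulLeft IK (C.incl u)) hh, maurerCartan_mulLeft]
  have hA : ∀ (j : LiftingGerbe P C) (Y : EK),
      lieAd IK K (j.act u).hat⁻¹ Y = lieAd IK K j.hat⁻¹ Y := by
    intro j Y
    refine C.lieAd_eq_of_q_eq ?_ Y
    change C.q (j.hat * C.incl u)⁻¹ = _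
    rw [map_inv, map_mul, C.q_incl, mul_one, map_inv]
  congr 2
  refine DForm.ext_toCLM fun j v => ?_
  rw [toCLM_liftForm, toCLM_liftForm, hm, hA]
  rfl

/-- Along a circle orbit both points of `B` are constant, so only the Maurer-Cartan term
contributes, and it gives `inclStar t`. -/
theorem connection_vertical (hθ : P.IsConnection θ) (j : LiftingGerbe P C) (t : ℝ) :
    (connection P C θ σ).toCLM j
      (mfderiv 𝓘(ℝ, ℝ) (IB.prod IK) (fun s : ℝ => j.act (Circle.exp s)) 0 t) = t := by
  have h1 := (contMDiff_act_exp P C j).mdifferentiable (by simp)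
  have e0 : ∀ j' : LiftingGerbe P C, j' = j → ∀ w : EB × EK,
      (connection P C θ σ).toCLM j' w = (connection P C θ σ).toCLM j w := by
    rintro _ rfl w
    rfl
  have hj : j.act (Circle.exp 0) = j := ext_of_pr1_hat rfl (by
    change j.hat * C.incl (Circle.exp 0) = j.hat
    rw [C.incl_exp_zero, mul_one])
  have hc : ∀ b : B, (DForm.pullback 𝓘(ℝ, ℝ) IB (fun _ : ℝ => b) θ).toCLM 0 t = 0 := by
    intro b
    refine (congrArg (fun T : ℝ →L[ℝ] EB => θ.toCLM b (T t)) mfderiv_const).trans ?_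
    exact map_zero (θ.toCLM b)
  have hm : (DForm.pullback 𝓘(ℝ, ℝ) IK (fun s : ℝ => (j.act (Circle.exp s)).hat)
      (maurerCartan IK K)).toCLM 0 t = C.inclStar t := by
    refine (maurerCartan_mfderiv ((C.contMDiff_mul_incl j.hat).mdifferentiable (by simp) 0) t).trans ?_
    have e : (fun s : ℝ => (j.hat * C.incl (Circle.exp 0))⁻¹ * (j.hat * C.incl (Circle.exp s)))
        = fun s : ℝ => C.incl (Circle.exp s) := by
      funext s
      rw [C.incl_exp_zero]
      group
    exact congrArg (fun f : ℝ → K => (mfderiv 𝓘(ℝ, ℝ) IK f 0 : ℝ → EK) t) e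
  have key : ∀ (k : K) (Z : EK) (Y Y' : EG), Z = C.inclStar t → Y = 0 → Y' = 0 →
      C.centralCoord (Z + lieAd IK K k (σ.toCLM Y) - σ.toCLM Y') = t := by
    rintro k _ _ _ rfl rfl rfl
    simp [C.centralCoord_inclStar]
  exact (e0 _ hj _).symm.trans ((toCLM_pullback_connection σ hθ h1 0 t).trans
    (key _ _ _ _ hm (hc (P.pr1 j.rho)) (hc (P.pr2 j.rho))))

theorem isGerbeConnection_connection (hθ : P.IsConnection θ) :
    IsGerbeConnection (connection P C θ σ) where
  smooth := smooth_connection σ hθ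
  vertical := connection_vertical σ hθ
  invariant := connection_invariant σ hθ
  product := connection_product σ hθ

theorem half_wedge_add_kappa_apply (L : Splitting P C) (b : B) (v w : TangentSpace IB b) :
    ((1 / 2 : ℝ) • DForm.wedge (C.lieCocycle σ) θ θ + kappa θ L σ) b ![v, w]
      = C.lieCocycle σ (θ.toCLM b v) (θ.toCLM b w)
        + L.reduced σ b (connCurvature IG G θ b ![v, w]) :=
  congrArg (fun t : ℝ => t + L.reduced σ b (connCurvature IG G θ b ![v, w]))
    (DForm.half_wedge_apply (C.lieCocycle_swap σ) θ b v w)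

/-- This is the curvature before the splitting enters: the Lie algebra cocycle at both ends, plus
the failure of `σ` to intertwine the adjoint actions on the curvatures. -/
theorem connection_d_apply (hθ : P.IsConnection θ) (j : LiftingGerbe P C)
    (v w : TangentSpace (IB.prod IK) j) (α α' : DForm (IB.prod IK) (LiftingGerbe P C) EG 1)
    (hα : α = DForm.pullback (IB.prod IK) IB (fun j : LiftingGerbe P C => P.pr1 j.rho) θ)
    (hα' : α' = DForm.pullback (IB.prod IK) IB (fun j : LiftingGerbe P C => P.pr2 j.rho) θ) :
    (connection P C θ σ).d j ![v, w]
      = C.lieCocycle σ (α.toCLM j v) (α.toCLM j w) - C.lieCocycle σ (α'.toCLM j v) (α'.toCLM j w)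
        + C.centralCoord (lieAd IK K j.hat⁻¹
            (σ.toCLM (α.d j ![v, w] + lieBr IG G (α.toCLM j v) (α.toCLM j w)))
          - σ.toCLM (α'.d j ![v, w] + lieBr IG G (α'.toCLM j v) (α'.toCLM j w))) := by
  have hs : α.Smooth := hα ▸ hθ.smooth.pullback (contMDiff_pr1_rho P C)
  have hs' : α'.Smooth := hα' ▸ hθ.smooth.pullback (contMDiff_pr2_rho P C)
  have hΘs := smooth_liftForm σ (contMDiff_hat P C) hs
  -- The gauge formula is used in `K`, with $\beta=\sigma(\alpha)$ and gauge transformation $k$.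
  have h1 := gauge_curvature (contMDiff_hat P C) (hs.mapVal σ.toCLM)
    (rfl : liftForm C σ hat α = _) j v w
  have hq : ∀ u : TangentSpace (IB.prod IK) j,
      C.qStar ((liftForm C σ hat α).toCLM j u) = α'.toCLM j u := by
    intro u
    rw [hα, hα']
    exact qStar_liftForm (h := (id : LiftingGerbe P C → _)) σ hθ mdifferentiable_id j u
  have h2 := CentralExtension.lieBr_of_qStar_eq σ (hq v) (hq w)
  have h3 : (connection P C θ σ).d j ![v, w] = C.centralCoord
      ((liftForm C σ hat α).d j ![v, w] - σ.toCLM (α'.d j ![v, w])) := by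
    rw [connection_eq σ hθ, ← hα, ← hα', (hΘs.sub (hs'.mapVal _)).d_mapVal,
      hΘs.d_sub (hs'.mapVal _), hs'.d_mapVal]
    rfl
  have hb : ∀ Y Y' : EG, lieBr IK K (σ.toCLM Y) (σ.toCLM Y')
      = σ.toCLM (lieBr IG G Y Y') + C.inclStar (C.lieCocycle σ Y Y') := by
    intro Y Y'
    rw [C.inclStar_lieCocycle]
    abel
  -- Both brackets split as $\sigma[\cdot,\cdot]+\omega_\sigma$; the part
  -- $\omega_\sigma(\alpha,\alpha)$ is central and leaves $\mathrm{Ad}_{k^{-1}}$ unchanged.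
  rw [hs.d_mapVal, h2, hb, DForm.toCLM_mapVal, DForm.toCLM_mapVal, hb, DForm.mapVal_apply,
    ← add_assoc (σ.toCLM (α.d j ![v, w])), ← map_add, map_add (lieAd IK K j.hat⁻¹),
    C.lieAd_inclStar] at h1
  rw [h3, eq_sub_of_add_eq h1, ← C.centralCoord_inclStar (C.lieCocycle σ (α.toCLM j v) _ - _),
    ← map_add, map_sub C.inclStar, map_add σ.toCLM (α'.d j ![v, w])]
  congr 1
  abel

/-- What `connection_d_apply` leaves beyond the $\omega_\sigma$ terms is the group cocycle on the
curvature, which is the change of `L.reduced σ` between $b_1$ and $b_2$. -/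
theorem isCurvatureOf_connection (hθ : P.IsConnection θ) (L : Splitting P C) :
    IsCurvatureOf (connection P C θ σ)
      (DForm.pullback (IB.prod IG) IB P.pr1
          ((1 / 2 : ℝ) • DForm.wedge (C.lieCocycle σ) θ θ + kappa θ L σ)
        - DForm.pullback (IB.prod IG) IB P.pr2
          ((1 / 2 : ℝ) • DForm.wedge (C.lieCocycle σ) θ θ + kappa θ L σ)) := by
  have hρ := (contMDiff_rho P C).mdifferentiable (by simp)
  have hp : ∀ (p : P.FibreSq → B) (hp : ContMDiff (IB.prod IG) IB ∞ p) (η : DForm IB B ℝ 2),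
      DForm.pullback (IB.prod IK) (IB.prod IG) rho (DForm.pullback (IB.prod IG) IB p η)
        = DForm.pullback (IB.prod IK) IB (fun j : LiftingGerbe P C => p j.rho) η :=
    fun p hp η => DForm.pullback_comp (hp.mdifferentiable (by simp)) hρ η
  have hd : ∀ (f : LiftingGerbe P C → B) (hf : ContMDiff (IB.prod IK) IB ∞ f) (j : LiftingGerbe P C)
      (v w : TangentSpace (IB.prod IK) j),
      DForm.pullback (IB.prod IK) IB f
          ((1 / 2 : ℝ) • DForm.wedge (C.lieCocycle σ) θ θ + kappa θ L σ) j ![v, w]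
        = C.lieCocycle σ ((DForm.pullback (IB.prod IK) IB f θ).toCLM j v)
            ((DForm.pullback (IB.prod IK) IB f θ).toCLM j w)
          + L.reduced σ (f j) ((DForm.pullback (IB.prod IK) IB f θ).d j ![v, w]
            + lieBr IG G ((DForm.pullback (IB.prod IK) IB f θ).toCLM j v)
              ((DForm.pullback (IB.prod IK) IB f θ).toCLM j w)) := by
    intro f hf j v w
    rw [DForm.pullback_apply, half_wedge_add_kappa_apply, connCurvature_apply,
      hθ.smooth.d_pullback hf, DForm.pullback_apply]
    rfl
  refine DForm.ext_pair fun j v w => ?_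
  have h0 : DForm.pullback (IB.prod IK) (IB.prod IG) rho
      (DForm.pullback (IB.prod IG) IB P.pr1
          ((1 / 2 : ℝ) • DForm.wedge (C.lieCocycle σ) θ θ + kappa θ L σ)
        - DForm.pullback (IB.prod IG) IB P.pr2
          ((1 / 2 : ℝ) • DForm.wedge (C.lieCocycle σ) θ θ + kappa θ L σ)) j ![v, w]
      = DForm.pullback (IB.prod IK) (IB.prod IG) rho (DForm.pullback (IB.prod IG) IB P.pr1
          ((1 / 2 : ℝ) • DForm.wedge (C.lieCocycle σ) θ θ + kappa θ L σ)) j ![v, w]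
        - DForm.pullback (IB.prod IK) (IB.prod IG) rho (DForm.pullback (IB.prod IG) IB P.pr2
          ((1 / 2 : ℝ) • DForm.wedge (C.lieCocycle σ) θ θ + kappa θ L σ)) j ![v, w] := rfl
  refine Eq.trans ?_ h0.symm
  rw [hp _ P.contMDiff_pr1, hp _ P.contMDiff_pr2, hd _ (contMDiff_pr1_rho P C),
    hd _ (contMDiff_pr2_rho P C), connection_d_apply σ hθ j v w _ _ rfl rfl, pr2_rho]
  -- The gauge formula is now used in `G`: the curvature at $b_2$ is $\mathrm{Ad}_{q(k)^{-1}}$ of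
  -- the curvature at $b_1$, the argument that `hL` needs.
  have hG := gauge_curvature (C.contMDiff_q.comp (contMDiff_hat P C))
    (hθ.smooth.pullback (contMDiff_pr1_rho P C))
    (pullback_pr2 (h := (id : LiftingGerbe P C → _)) hθ mdifferentiable_id) j v w
  have hL := L.reduced_sub_reduced_act σ (P.pr1 j.rho) j.hat
    ((DForm.pullback (IB.prod IK) IB (fun j : LiftingGerbe P C => P.pr1 j.rho) θ).d j ![v, w]
      + lieBr IG G
        ((DForm.pullback (IB.prod IK) IB (fun j : LiftingGerbe P C => P.pr1 j.rho) θ).toCLM j v)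
        ((DForm.pullback (IB.prod IK) IB (fun j : LiftingGerbe P C => P.pr1 j.rho) θ).toCLM j w))
  have hG' : (DForm.pullback (IB.prod IK) IB (fun j : LiftingGerbe P C => P.pr2 j.rho) θ).d j ![v, w]
      + lieBr IG G
        ((DForm.pullback (IB.prod IK) IB (fun j : LiftingGerbe P C => P.pr2 j.rho) θ).toCLM j v)
        ((DForm.pullback (IB.prod IK) IB (fun j : LiftingGerbe P C => P.pr2 j.rho) θ).toCLM j w)
      = _ := hG
  rw [hG']
  refine (congrArg (fun t : ℝ => _ + t) hL.symm).trans ?_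
  exact sub_add_sub_comm _ _ _ _

theorem isCurving_connection (hθ : P.IsConnection θ) (L : Splitting P C) :
    IsCurving (connection P C θ σ)
      (-((1 / 2 : ℝ) • DForm.wedge (C.lieCocycle σ) θ θ) - kappa θ L σ) where
  isGerbeConnection := isGerbeConnection_connection σ hθ
  smooth := ((hθ.smooth.wedge _ hθ.smooth).smul _).neg.sub (L.smooth_kappa hθ.smooth σ)
  curvature_eq := by
    have e : ∀ η η' : DForm IB B ℝ 2, -DForm.pullback (IB.prod IG) IB P.pr1 (-η - η')
        + DForm.pullback (IB.prod IG) IB P.pr2 (-η - η')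
        = DForm.pullback (IB.prod IG) IB P.pr1 (η + η')
          - DForm.pullback (IB.prod IG) IB P.pr2 (η + η') := by
      intro η η'
      refine DForm.ext_pair fun x v w => ?_
      have h : ∀ a a' b b' : ℝ, -(-a - a') + (-b - b') = a + a' - (b + b') := by
        intros
        ring
      exact h _ _ _ _
    rw [e]
    exact isCurvatureOf_connection σ hθ L

end LiftingGerbe
end ConnectionFacts

end

theorem mainTheorem3
    {EG HG : Type*} [NormedAddCommGroup EG] [NormedSpace ℝ EG] [CompleteSpace EG]
    [TopologicalSpace HG] {IG : ModelWithCorners ℝ EG HG} [IG.Boundaryless]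
    {G : Type*} [TopologicalSpace G] [ChartedSpace HG G] [Group G] [LieGroup IG ∞ G]
    {EK HK : Type*} [NormedAddCommGroup EK] [NormedSpace ℝ EK] [CompleteSpace EK]
    [TopologicalSpace HK] {IK : ModelWithCorners ℝ EK HK} [IK.Boundaryless]
    {K : Type*} [TopologicalSpace K] [ChartedSpace HK K] [Group K] [LieGroup IK ∞ K]
    {EX HX : Type*} [NormedAddCommGroup EX] [NormedSpace ℝ EX] [CompleteSpace EX]
    [TopologicalSpace HX] {IX : ModelWithCorners ℝ EX HX} [IX.Boundaryless]
    {X : Type*} [TopologicalSpace X] [ChartedSpace HX X] [IsManifold IX ∞ X]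
    {EB HB : Type*} [NormedAddCommGroup EB] [NormedSpace ℝ EB] [CompleteSpace EB]
    [TopologicalSpace HB] {IB : ModelWithCorners ℝ EB HB} [IB.Boundaryless]
    {B : Type*} [TopologicalSpace B] [ChartedSpace HB B] [IsManifold IB ∞ B]
    (C : CentralExtension IG G IK K) (P : PrincipalBundle IG G IB B IX X)
    (θ : DForm IB B EG 1) (hθ : P.IsConnection θ) (L : Splitting P C) (σ : C.Split) :
    (kappa θ L σ).Smooth ∧
    LiftingGerbe.IsCurvatureOf (LiftingGerbe.connection P C θ σ)
      (DForm.pullback (IB.prod IG) IB P.pr1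
          ((1 / 2 : ℝ) • DForm.wedge (C.lieCocycle σ) θ θ + kappa θ L σ)
        - DForm.pullback (IB.prod IG) IB P.pr2
          ((1 / 2 : ℝ) • DForm.wedge (C.lieCocycle σ) θ θ + kappa θ L σ)) ∧
    LiftingGerbe.IsCurving (LiftingGerbe.connection P C θ σ)
      (-((1 / 2 : ℝ) • DForm.wedge (C.lieCocycle σ) θ θ) - kappa θ L σ) :=
  ⟨L.smooth_kappa hθ.smooth σ, LiftingGerbe.isCurvatureOf_connection σ hθ L,
    LiftingGerbe.isCurving_connection σ hθ L⟩
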